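/- **Setting.** Let $\beta\ge 0$, $b>0$, $c>0$ and $R>0$. For $s\ge0$ put $v_s(\lambda)=\dfrac{e^{-bs}\lambda}{1+\frac{c\lambda}{b}(1-e^{-bs})}$ and $v=v_1$. Let $K$ be the set of functions $k:(0,\infty)\to[0,\infty)$ that are right-continuous, locally of bounded variation on $(0,\infty)$ and satisfy $\|k\|_\mu:=\int_0^\infty k(z)(z\wedge1)\,dz<\infty$. Fix $\tilde k_R\in K$ with $\|\tilde k_R\|_\mu\le R$, and let $\tilde K_R$ be the set of $k\in K$ with $k\le\tilde k_R$ on $(0,\infty)$ whose total variation over $[2^i,2^{i+1}]$ is at most $R$ for every $i\in\mathbb Z$. Let $k\in\tilde K_R$, $n(dz)=k(z)\,dz$, and $\psi(z)=\beta z+\int_0^\infty(1-e^{-zu})\,n(du)$. Let $(X_t)_{t\ge0}$ be a stationary CBI-process with branching mechanism $bz+cz^2$ and immigration mechanism $\psi$, that is, a Markov process on $[0,\infty)$ whose transition semigroup satisfies $\int e^{-\lambda y}P_t(x,dy)=\exp\{-xv_t(\lambda)-\int_0^t\psi(v_s(\lambda))\,ds\}$ for $\lambda\ge0$ and whose initial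 law $\eta$ has Laplace transform $\exp\{-\int_0^\infty\psi(v_s(\lambda))\,ds\}$, $\lambda\ge0$. Let $w$ be a bounded, measurable, nonnegative function with compact support, the support containing $[0,a]$ for some $a>0$, and let $\|f\|_{L^2(w)}^2=\int_0^\infty|f(\lambda)|^2w(\lambda)\,d\lambda$. For $k'\in\tilde K_R$ put $$g_2(\lambda,k')=-\beta\int_0^1v_s(\lambda)\,ds-\int_0^1\!\int_0^\infty(1-e^{-zv_s(\lambda)})k'(z)\,dz\,ds ,$$ let $g=g_2(\cdot,k)$, and let $\tilde\Psi_R\subset L^2(w)$ be the closure of $\{g_2(\cdot,k'):k'\in\tilde K_R\}$ in $L^2(w)$. For $n\ge1$ let $$g_{2,n}(\lambda)=\ln\Big(\frac1n\sum_{j=1}^n\exp\{-\lambda X_j+X_{j-1}v(\lambda)\}\Big),\qquad \hat g_{2,n}=\operatorname*{arg\,min}_{f\in\tilde\Psi_R}\|g_{2,n}-f\|_{L^2(w)} .$$ **Theorem 4.4.** Assume that $z^2n(dz)$ is a finite measure and that $\exp\{-\int_0^\infty\psi(v_s(\lambda))\,ds\}<\infty$ for every $\lambda\in\big(-\frac{be^{-b}}{c(1-e^{-b})},\infty\big)$,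 in the sense that $\int_0^\infty|\psi(v_s(\lambda))|\,ds<\infty$, where $|\psi(z)|=\beta|z|+\int_0^\infty|1-e^{-zu}|\,n(du)\in[0,\infty]$ for all real $z$. Then the limit $$\lim_{n\to\infty}n\,\mathbf E\big[\|\hat g_{2,n}-g\|_{L^2(w)}^2\big]$$ exists and is finite. -/

import Mathlib

open MeasureTheory ProbabilityTheory Filter Set Topology
open scoped NNReal ENNReal

noncomputable section

namespace CBI

/-- The cumulant semigroup `v_s(l)` of the branching mechanism `φ(z) = b z + c z ^ 2`, i.e. the
solution of `∂v/∂s = -φ(v)`, `v_0(l) = l`, in closed form. -/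
def v (b c s l : ℝ) : ℝ :=
  Real.exp (-(b * s)) * l / (1 + c * l / b * (1 - Real.exp (-(b * s))))

/-- The immigration mechanism `ψ(z) = β z + ∫ (1 - e ^ (-z u)) n(du)`, with `n(du) = k(u) du` on
the half-line `(0, ∞)`. -/
def psi (β : ℝ) (k : ℝ → ℝ) (z : ℝ) : ℝ :=
  β * z + ∫ u in Ioi (0 : ℝ), (1 - Real.exp (-(z * u))) * k u

/-- `|ψ(z)|` as an extended nonnegative number, meaningful for all real `z`: for `k ≥ 0`, `β ≥ 0`
both summands of `ψ(z)` have the sign of `z`, and for `z < 0` the integral may diverge. -/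
def absPsi (β : ℝ) (k : ℝ → ℝ) (z : ℝ) : ℝ≥0∞ :=
  ENNReal.ofReal (|β * z|) +
    ∫⁻ u in Ioi (0 : ℝ), ENNReal.ofReal (|1 - Real.exp (-(z * u))| * k u)

/-- The kernels `Q t` have the Laplace transforms of the transition semigroup of the CBI-process
with branching mechanism `b z + c z ^ 2` and immigration mechanism `psi β k`; these determine
`Q t` uniquely. -/
structure IsTransitionSemigroup (β b c : ℝ) (k : ℝ → ℝ) (Q : ℝ≥0 → Kernel ℝ≥0 ℝ≥0) : Prop where
  markov : ∀ t, IsMarkovKernel (Q t)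
  laplace : ∀ (t x : ℝ≥0) (l : ℝ), 0 ≤ l →
    ∫ y, Real.exp (-(l * (y : ℝ))) ∂(Q t x) =
      Real.exp (-((x : ℝ) * v b c t l) - ∫ s in (0 : ℝ)..(t : ℝ), psi β k (v b c s l))

/-- The past of the process `X` up to time `s`. -/
@[reducible] def past {Ω : Type*} (X : ℝ≥0 → Ω → ℝ≥0) (s : ℝ≥0) : MeasurableSpace Ω :=
  ⨆ (u : ℝ≥0) (_ : u ≤ s), MeasurableSpace.comap (X u) inferInstance

/-- `X` is, under `P`, a stationary CBI-process: a Markov process with state space `[0, ∞)` and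
the CBI transition semigroup, started from the stationary law `η`, which is given by its
Laplace transform `exp (-∫₀^∞ ψ(v_s(l)) ds)`. -/
structure IsStationaryCBI {Ω : Type*} [MeasurableSpace Ω] (P : Measure Ω)
    (β b c : ℝ) (k : ℝ → ℝ) (X : ℝ≥0 → Ω → ℝ≥0) : Prop where
  measurable : ∀ t, Measurable (X t)
  initial : ∀ l : ℝ, 0 ≤ l →
    ∫ ω, Real.exp (-(l * (X 0 ω : ℝ))) ∂P =
      Real.exp (-∫ s in Ioi (0 : ℝ), psi β k (v b c s l))
  markov : ∃ Q : ℝ≥0 → Kernel ℝ≥0 ℝ≥0, IsTransitionSemigroup β b c k Q ∧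
    ∀ (s t : ℝ≥0) (f : ℝ≥0 → ℝ), Measurable f → (∃ C : ℝ, ∀ y, |f y| ≤ C) →
      P[fun ω => f (X (s + t) ω) | past X s] =ᵐ[P] fun ω => ∫ y, f y ∂(Q t (X s ω))

/-- The class `K` of jump densities: nonnegative right-continuous functions on `(0, ∞)` that are
locally of bounded variation there and integrable with respect to `μ(dz) = (z ∧ 1) dz`. Only the
values on `(0, ∞)` matter. -/
structure MemK (k : ℝ → ℝ) : Prop where
  nonneg : ∀ z, 0 < z → 0 ≤ k z
  rightCont : ∀ z, 0 < z → ContinuousWithinAt k (Ici z) z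
  locBV : LocallyBoundedVariationOn k (Ioi 0)
  integrable : IntegrableOn (fun z => k z * min z 1) (Ioi 0)

/-- The subclass of `K` cut out by the envelope `kR` and by the bound `R` on the total variation
over each dyadic interval. -/
structure MemKR (R : ℝ) (kR k : ℝ → ℝ) : Prop where
  memK : MemK k
  le_envelope : ∀ z, 0 < z → k z ≤ kR z
  variation : ∀ i : ℤ,
    eVariationOn k (Icc ((2 : ℝ) ^ i) ((2 : ℝ) ^ (i + 1))) ≤ ENNReal.ofReal R

/-- `g₂(l, k) = -β ∫₀¹ v_s(l) ds - ∫₀¹ ∫₀^∞ (1 - e ^ (-z v_s(l))) k(z) dz ds`. -/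
def g₂ (β b c : ℝ) (k : ℝ → ℝ) (l : ℝ) : ℝ :=
  -∫ s in (0 : ℝ)..1, psi β k (v b c s l)

/-- The transition-based empirical Laplace transform of the observations `x 0, …, x n`. -/
def L₂ (b c : ℝ) (x : ℕ → ℝ≥0) (n : ℕ) (l : ℝ) : ℝ :=
  (1 / (n : ℝ)) * ∑ i ∈ Finset.range n,
    Real.exp (-(l * (x (i + 1) : ℝ)) + (x i : ℝ) * v b c 1 l)

/-- The logarithm of the empirical Laplace transform. -/
def gEmp (b c : ℝ) (x : ℕ → ℝ≥0) (n : ℕ) (l : ℝ) : ℝ :=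
  Real.log (L₂ b c x n l)

/-- Weight functions: bounded, nonnegative, with compact (closed) support that contains an
interval `[0, a]`, `a > 0`. -/
structure IsWeight (w : ℝ → ℝ) : Prop where
  measurable : Measurable w
  nonneg : ∀ l, 0 ≤ w l
  bounded : ∃ C : ℝ, ∀ l, w l ≤ C
  compactSupport : HasCompactSupport w
  support : ∃ a : ℝ, 0 < a ∧ Icc 0 a ⊆ tsupport w

/-- The measure `w(l) dl` on `(0, ∞)`; the space `L²(w)` is `Lp ℝ 2 (wMeasure w)`. -/
def wMeasure (w : ℝ → ℝ) : Measure ℝ :=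
  (volume.restrict (Ioi (0 : ℝ))).withDensity fun l => ENNReal.ofReal (w l)

/-- The set of all `g₂(·, k')`, for `k'` in the restricted class, as a subset of `L²(w)`. -/
def PsiR (β b c R : ℝ) (kR w : ℝ → ℝ) : Set (Lp ℝ 2 (wMeasure w)) :=
  {f | ∃ k', MemKR R kR k' ∧ f =ᵐ[wMeasure w] g₂ β b c k'}

/-- `f` is the element of the closed set `closure S` that is nearest to the function `h` in
`L²(w)`. An element of `S` that minimizes the distance to `h` over `S` has this property. -/
def IsNearest (w : ℝ → ℝ) (S : Set (Lp ℝ 2 (wMeasure w))) (h : ℝ → ℝ)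
    (f : Lp ℝ 2 (wMeasure w)) : Prop :=
  f ∈ closure S ∧ ∀ f' ∈ closure S,
    eLpNorm (fun l => h l - f l) 2 (wMeasure w) ≤ eLpNorm (fun l => h l - f' l) 2 (wMeasure w)

end CBI

end

/-! Work in the Hilbert space `L²(w)`. Let `K` be the closure of the candidate set; it is convex,
since the class of densities is convex and `g₂` is affine in the density. Let `π` be the metric
projection onto `K`, and let `E_n` be the empirical log-transform. The estimator is `π E_n` and the
true `g` lies in `K`, so `n ‖ĝ_n - g‖² = N_n(√n (E_n - g))²` with `N_n z = ‖√n (π(g + z/√n) - g)‖`.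
The vector inside this norm is the projection of `z` onto `√n (K - g)`. These convex sets increase
with `n`, so the vector converges (`IsConvexProj.exists_tendsto_diffQuot`). Each `N_n` is moreover
1-Lipschitz and vanishes at `0`.

On the probabilistic side, `E_n = g + log (1 + Y_n)`, where `Y_n` is the mean of the scores `exp(-λ
X_j + X_{j-1} v(λ) - g(λ)) - 1`. The Laplace transform of the transition kernel makes the scores
stationary martingale differences. Three facts are needed.

Square integrability. The conditional second moment of a score is of order `exp(x (2 v(λ) -
v(2λ)))`, and `2 v(λ) - v(2λ)` stays strictly below the critical exponent `b e^{-b} / (c (1 -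
e^{-b}))` for bounded `λ`. Below that exponent the stationary law has exponential moments: as a
function of `-λ`, its Laplace transform is a power series with nonnegative coefficients, and the
moment hypothesis keeps the series finite up to the critical exponent (`PosSeries.integrable_exp`,
`CBI.integrable_exp_of_laplace`).

Central limit theorem. Since `v_t(λ) → 0`, the process forgets its starting point, so squared scores
are asymptotically uncorrelated with the past. A characteristic function recursion then gives
asymptotic normality of every scalar projection of `√n Y_n` (`IsMixingMDS.tendsto_charFun`).

Linearization. The difference `log (1 + Y_n) - Y_n` is `o(n^{-1/2})` in mean square. Where `Y_n` is
near `-1` the logarithm is held from below by Jensen's inequality and a bound on the sample mean of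
the process (`IsStationaryCBI.gEmp_remainder`).

Orthogonality of martingale differences makes the covariance of `√n Y_n` the same for all `n ≥ 1`.
Hence expansion tails in an orthonormal basis are uniformly small and squared norms are uniformly
integrable. Finite-dimensional Gaussian limits are therefore enough to show that `E N_n(√n (E_n -
g))²` is Cauchy (`exists_tendsto_lintegral_sq`); no Gaussian measure on the Hilbert space is
constructed. -/

/-! ### Metric projections onto closed convex sets -/

section Projection

variable {H : Type*} [NormedAddCommGroup H] [InnerProductSpace ℝ H]

open scoped RealInnerProductSpace

/-- `π` is the metric projection onto the set `K`, described by its variational inequality. -/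
def IsConvexProj (K : Set H) (π : H → H) : Prop :=
  ∀ u, π u ∈ K ∧ ∀ w ∈ K, ⟪u - π u, w - π u⟫ ≤ 0

lemma exists_isConvexProj [CompleteSpace H] {K : Set H} (hne : K.Nonempty) (hcl : IsClosed K)
    (hconv : Convex ℝ K) : ∃ π, IsConvexProj K π := by
  have h := exists_norm_eq_iInf_of_complete_convex hne hcl.isComplete hconv
  choose π hπ using h
  exact ⟨π, fun u => ⟨(hπ u).1,
    (norm_eq_iInf_iff_real_inner_le_zero hconv (hπ u).1).1 (hπ u).2⟩⟩

namespace IsConvexProj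

variable {K : Set H} {π : H → H}

/-- The angle at `π u` is not acute, so Pythagoras survives as an inequality. The extra term `‖w - π
u‖ ^ 2` turns closeness of distances into closeness of points; uniqueness of the projection and the
Cauchy estimate below both rest on it. -/
lemma norm_sub_sq_add_le (hπ : IsConvexProj K π) (u : H) {w : H} (hw : w ∈ K) :
    ‖u - π u‖ ^ 2 + ‖w - π u‖ ^ 2 ≤ ‖u - w‖ ^ 2 := by
  have h := (hπ u).2 w hw
  have e : u - w = (u - π u) - (w - π u) := by abel
  rw [e, norm_sub_sq_real (u - π u) (w - π u)]
  linarith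

lemma eq_of_norm_le (hπ : IsConvexProj K π) {u w : H} (hw : w ∈ K)
    (h : ‖u - w‖ ≤ ‖u - π u‖) : w = π u := by
  have h1 := hπ.norm_sub_sq_add_le u hw
  have h2 : ‖u - w‖ ^ 2 ≤ ‖u - π u‖ ^ 2 := by gcongr
  have h3 : ‖w - π u‖ ^ 2 ≤ 0 := by linarith
  have h4 : ‖w - π u‖ = 0 := by
    have := sq_nonneg ‖w - π u‖
    exact pow_eq_zero_iff (two_ne_zero) |>.1 (le_antisymm h3 this)
  exact sub_eq_zero.1 (norm_eq_zero.1 h4)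

/-- Test each variational inequality with the other projection, add the two, and apply
Cauchy–Schwarz. -/
lemma norm_sub_le (hπ : IsConvexProj K π) (u u' : H) : ‖π u - π u'‖ ≤ ‖u - u'‖ := by
  have h1 := (hπ u).2 _ (hπ u').1
  have h2 := (hπ u').2 _ (hπ u).1
  have h3 : ‖π u - π u'‖ ^ 2 ≤ ⟪u - u', π u - π u'⟫ := by
    have e1 : ⟪u - π u, π u' - π u⟫ = - ⟪u - π u, π u - π u'⟫ := by
      rw [← inner_neg_right]; congr 1; abel
    have e2 : ⟪u - u', π u - π u'⟫
        = ⟪u - π u, π u - π u'⟫ - ⟪u' - π u', π u - π u'⟫ + ⟪π u - π u', π u - π u'⟫ := by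
      rw [← inner_sub_left, ← inner_add_left]; congr 1; abel
    rw [e2, real_inner_self_eq_norm_sq]
    linarith
  have h4 := real_inner_le_norm (u - u') (π u - π u')
  by_contra! hlt
  have hpos : 0 < ‖π u - π u'‖ := lt_of_le_of_lt (norm_nonneg _) hlt
  nlinarith

lemma apply_of_mem (hπ : IsConvexProj K π) {g : H} (hg : g ∈ K) : π g = g :=
  (hπ.eq_of_norm_le hg (by simp)).symm

/-- Difference quotients of the projection at a point of `K` are closer to each other than the
decrease of their distances from the direction. -/
lemma norm_diffQuot_sub_sq_le (hπ : IsConvexProj K π) (hconv : Convex ℝ K) {g : H} (hg : g ∈ K)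
    (h : H) {r r' : ℝ} (hr : 0 < r) (hrr' : r ≤ r') :
    ‖r • (π (g + r⁻¹ • h) - g) - r' • (π (g + r'⁻¹ • h) - g)‖ ^ 2 ≤
      ‖h - r • (π (g + r⁻¹ • h) - g)‖ ^ 2 - ‖h - r' • (π (g + r'⁻¹ • h) - g)‖ ^ 2 := by
  have hr' : 0 < r' := hr.trans_le hrr'
  set p := r • (π (g + r⁻¹ • h) - g) with hp
  set u := g + r'⁻¹ • h with hu
  -- This point is the convex combination of `g` and `π (g + r⁻¹ • h)` with weight `r / r'` on the
  -- latter. In other words `r (K - g) ⊆ r' (K - g)`, so `p` competes with the projection of `h`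
  -- onto the larger set.
  have hw : g + r'⁻¹ • p ∈ K := by
    have := hconv hg (hπ (g + r⁻¹ • h)).1 (a := 1 - r'⁻¹ * r) (b := r'⁻¹ * r)
      (by rw [sub_nonneg, inv_mul_le_one₀ hr']; exact hrr') (by positivity) (by ring)
    convert this using 1
    rw [hp, smul_smul, smul_sub, sub_smul, one_smul]
    abel
  have h1 := hπ.norm_sub_sq_add_le u hw
  have e1 : h - r' • (π u - g) = r' • (u - π u) := by
    rw [hu, ← sub_eq_zero]
    simp only [smul_sub, smul_add, smul_smul, mul_inv_cancel₀ hr'.ne', one_smul]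
    abel
  have e2 : p - r' • (π u - g) = r' • (g + r'⁻¹ • p - π u) := by
    rw [← sub_eq_zero]
    simp only [smul_sub, smul_add, smul_smul, mul_inv_cancel₀ hr'.ne', one_smul]
    abel
  have e3 : h - p = r' • (u - (g + r'⁻¹ • p)) := by
    rw [hu, ← sub_eq_zero]
    simp only [smul_sub, smul_add, smul_smul, mul_inv_cancel₀ hr'.ne', one_smul]
    abel
  rw [e1, e2, e3]
  simp only [norm_smul, Real.norm_eq_abs, abs_of_pos hr', mul_pow]
  nlinarith [sq_nonneg r', mul_le_mul_of_nonneg_left h1 (sq_nonneg r')]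

/-- The metric projection onto a closed convex set has directional derivatives at the points of
the set. -/
lemma exists_tendsto_diffQuot [CompleteSpace H] (hπ : IsConvexProj K π) (hconv : Convex ℝ K)
    {g : H} (hg : g ∈ K) (h : H) {r : ℕ → ℝ} (hr : ∀ n, 0 < r n) (hmono : Monotone r) :
    ∃ p, Tendsto (fun n => r n • (π (g + (r n)⁻¹ • h) - g)) atTop (𝓝 p) := by
  set p : ℕ → H := fun n => r n • (π (g + (r n)⁻¹ • h) - g)
  set d : ℕ → ℝ := fun n => ‖h - p n‖ ^ 2
  -- The squared distances `d` decrease and are bounded below, hence Cauchy; this inequality passes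
  -- the property on to `p`.
  have key : ∀ m n, m ≤ n → ‖p m - p n‖ ^ 2 ≤ d m - d n := fun m n hmn =>
    hπ.norm_diffQuot_sub_sq_le hconv hg h (hr m) (hmono hmn)
  have hanti : Antitone d := fun m n hmn => by
    have := key m n hmn
    nlinarith [sq_nonneg ‖p m - p n‖]
  have hd : CauchySeq d :=
    (tendsto_atTop_ciInf hanti ⟨0, by rintro _ ⟨n, rfl⟩; positivity⟩).cauchySeq
  refine cauchySeq_tendsto_of_complete (Metric.cauchySeq_iff'.2 fun ε hε => ?_)
  obtain ⟨N, hN⟩ := Metric.cauchySeq_iff'.1 hd (ε ^ 2) (by positivity)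
  refine ⟨N, fun n hn => ?_⟩
  have h1 := key N n hn
  have h2 := hN n hn
  rw [dist_comm, Real.dist_eq] at h2
  have h3 := (le_abs_self _).trans_lt h2
  rw [dist_comm, dist_eq_norm]
  exact lt_of_pow_lt_pow_left₀ 2 hε.le (h1.trans_lt h3)

end IsConvexProj

end Projection

/-! ### A central limit theorem for mixing martingale differences -/

section MartingaleCLT

set_option linter.unusedSectionVars false

variable {Ω : Type*} [m0 : MeasurableSpace Ω]

/-- `D` is a sequence of identically distributed square integrable martingale differences whose
squares are asymptotically uncorrelated with the past. -/
structure IsMixingMDS (P : Measure Ω) (F : ℕ → MeasurableSpace Ω) (D : ℕ → Ω → ℝ) : Prop where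
  le : ∀ j, F j ≤ m0
  mono : Monotone F
  meas : ∀ j, Measurable[F (j + 1)] (D j)
  memLp : MemLp (D 0) 2 P
  ident : ∀ j, IdentDistrib (D j) (D 0) P P
  mart : ∀ (j : ℕ) (φ : Ω → ℝ), Measurable[F j] φ → (∀ ω, |φ ω| ≤ 1) → ∫ ω, φ ω * D j ω ∂P = 0
  mix : ∀ ε > 0, ∃ m, ∀ (j : ℕ) (φ : Ω → ℝ), Measurable[F j] φ → (∀ ω, |φ ω| ≤ 1) →
    |∫ ω, φ ω * (D (j + m) ω ^ 2 - ∫ ω, D 0 ω ^ 2 ∂P) ∂P| ≤ ε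

/-- The second order Taylor remainder of `x ↦ exp (i x)`. -/
lemma norm_cexp_mul_I_taylor_le (x : ℝ) :
    ‖Complex.exp (x * Complex.I) - (1 + x * Complex.I - x ^ 2 / 2)‖ ≤ 4 * (x ^ 2 * min 1 |x|) := by
  rcases le_total |x| 1 with h | h
  · have hn : ‖(x : ℂ) * Complex.I‖ ≤ 1 := by simpa using h
    have := Complex.exp_bound hn (n := 3) (by norm_num)
    rw [min_eq_right h]
    have e : ∑ m ∈ Finset.range 3, ((x : ℂ) * Complex.I) ^ m / (m.factorial : ℂ)
        = 1 + x * Complex.I - x ^ 2 / 2 := by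
      simp [Finset.sum_range_succ, mul_pow, Nat.factorial]
      ring
    rw [e] at this
    refine this.trans ?_
    have e2 : ‖(x : ℂ) * Complex.I‖ = |x| := by simp
    rw [e2, ← sq_abs x]
    norm_num [Nat.factorial]
    have : |x| ^ 2 * |x| = |x| ^ 3 := by ring
    rw [sq_abs] at this
    rw [this]
    nlinarith [pow_nonneg (abs_nonneg x) 3]
  · rw [min_eq_left h]
    have h1 : ‖Complex.exp (x * Complex.I)‖ = 1 := Complex.norm_exp_ofReal_mul_I x
    have h2 : ‖(1 + x * Complex.I - x ^ 2 / 2 : ℂ)‖ ≤ 1 + |x| + x ^ 2 / 2 := by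
      refine (norm_sub_le _ _).trans (add_le_add ((norm_add_le _ _).trans ?_) ?_)
      · simp
      · simp
    refine (norm_sub_le _ _).trans ?_
    rw [h1]
    nlinarith [sq_abs x, abs_nonneg x]

/-- The conditions `mart` and `mix` speak of real test functions bounded by one. Splitting into
cosine and sine makes them applicable to characteristic functions. -/
lemma integral_cexp_mul_ofReal {P : Measure Ω} [IsFiniteMeasure P] {θ q : Ω → ℝ}
    (hθ : Measurable θ) (hq : Integrable q P) :
    ∫ ω, Complex.exp (θ ω * Complex.I) * (q ω : ℂ) ∂P =
      ((∫ ω, Real.cos (θ ω) * q ω ∂P : ℝ) : ℂ) + ((∫ ω, Real.sin (θ ω) * q ω ∂P : ℝ) : ℂ) *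
        Complex.I := by
  have hc : Integrable (fun ω => Real.cos (θ ω) * q ω) P :=
    hq.bdd_mul (c := 1) (Real.continuous_cos.measurable.comp hθ).aestronglyMeasurable
      (ae_of_all _ fun ω => Real.abs_cos_le_one _)
  have hs : Integrable (fun ω => Real.sin (θ ω) * q ω) P :=
    hq.bdd_mul (c := 1) (Real.continuous_sin.measurable.comp hθ).aestronglyMeasurable
      (ae_of_all _ fun ω => Real.abs_sin_le_one _)
  rw [← integral_complex_ofReal, ← integral_complex_ofReal, ← integral_mul_const, ← integral_add]
  · refine integral_congr_ae (ae_of_all _ fun ω => ?_)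
    simp only [Complex.exp_mul_I]
    push_cast
    ring
  · exact hc.ofReal
  · exact hs.ofReal.mul_const _

lemma exists_integral_tail_le {P : Measure Ω} {q : Ω → ℝ} (hq : Integrable q P) {ε : ℝ}
    (hε : 0 < ε) : ∃ B : ℝ, 0 ≤ B ∧ ∫ ω, {ω | B < |q ω|}.indicator (fun ω => |q ω|) ω ∂P ≤ ε := by
  have h : Tendsto (fun n : ℕ => ∫ ω, {ω | (n : ℝ) < |q ω|}.indicator (fun ω => |q ω|) ω ∂P) atTop
      (𝓝 (∫ _, (0 : ℝ) ∂P)) := by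
    refine tendsto_integral_of_dominated_convergence (fun ω => |q ω|) (fun n => ?_) hq.abs
      (fun n => ae_of_all _ fun ω => ?_) (ae_of_all _ fun ω => ?_)
    · exact hq.abs.aestronglyMeasurable.indicator₀
        (nullMeasurableSet_lt aemeasurable_const hq.abs.aemeasurable)
    · rw [Real.norm_eq_abs]
      by_cases hω : ω ∈ {ω | (n : ℝ) < |q ω|}
      · rw [indicator_of_mem hω, abs_abs]
      · rw [indicator_of_notMem hω]; simp
    · refine tendsto_const_nhds.congr' ?_
      obtain ⟨N, hN⟩ := exists_nat_ge |q ω|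
      filter_upwards [eventually_ge_atTop N] with n hn
      rw [indicator_of_notMem]
      simp only [mem_ofPred_eq, not_lt]
      exact hN.trans (by exact_mod_cast hn)
  rw [integral_zero] at h
  obtain ⟨n, hn⟩ := (h.eventually (ge_mem_nhds hε)).exists
  exact ⟨n, by positivity, hn⟩

namespace IsMixingMDS

variable {P : Measure Ω} [IsProbabilityMeasure P] {F : ℕ → MeasurableSpace Ω} {D : ℕ → Ω → ℝ}

lemma measurable (h : IsMixingMDS P F D) (j : ℕ) : Measurable (D j) :=
  (h.meas j).mono (h.le _) le_rfl

lemma memLp' (h : IsMixingMDS P F D) (j : ℕ) : MemLp (D j) 2 P :=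
  (h.ident j).memLp_iff.2 h.memLp

lemma integrable (h : IsMixingMDS P F D) (j : ℕ) : Integrable (D j) P :=
  (h.memLp' j).integrable (by norm_num)

lemma integral_comp_eq (h : IsMixingMDS P F D) (j : ℕ) {g : ℝ → ℝ} (hg : Measurable g) :
    ∫ ω, g (D j ω) ∂P = ∫ ω, g (D 0 ω) ∂P :=
  ((h.ident j).comp hg).integral_eq

lemma measurable_sum (h : IsMixingMDS P F D) (n : ℕ) :
    Measurable[F n] (fun ω => ∑ j ∈ Finset.range n, D j ω) := by
  refine Finset.measurable_sum _ fun j hj => ?_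
  exact (h.meas j).mono (h.mono (by simp at hj; omega)) le_rfl

/-- Truncating `φ` at level `N` and rescaling by `N⁻¹` gives an admissible test function; dominated
convergence removes the truncation. -/
lemma integral_mul_eq_zero (h : IsMixingMDS P F D) {j : ℕ} {φ : Ω → ℝ} (hφ : Measurable[F j] φ)
    (hφ2 : MemLp φ 2 P) : ∫ ω, φ ω * D j ω ∂P = 0 := by
  have hint : Integrable (fun ω => φ ω * D j ω) P := hφ2.integrable_mul (h.memLp' j)
  have hz : ∀ N : ℕ, ∫ ω, max (-(N : ℝ)) (min N (φ ω)) * D j ω ∂P = 0 := by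
    intro N
    rcases Nat.eq_zero_or_pos N with rfl | hN
    · have : ∀ ω, max (-((0 : ℕ) : ℝ)) (min ((0 : ℕ) : ℝ) (φ ω)) * D j ω = 0 := by
        intro ω; simp
      simp
    have hN' : (0 : ℝ) < N := by exact_mod_cast hN
    have := h.mart j (fun ω => (N : ℝ)⁻¹ * max (-(N : ℝ)) (min N (φ ω)))
      (by
        have : Measurable fun x : ℝ => (N : ℝ)⁻¹ * max (-(N : ℝ)) (min N x) := by fun_prop
        exact this.comp hφ)
      (fun ω => by
        rw [abs_mul, abs_inv, abs_of_pos hN', inv_mul_le_one₀ hN']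
        exact abs_le.2 ⟨le_max_left _ _, max_le (by linarith) (min_le_left _ _)⟩)
    simp only [mul_assoc, integral_const_mul] at this
    exact (mul_eq_zero.1 this).resolve_left (by positivity)
  have hlim : Tendsto (fun N : ℕ => ∫ ω, max (-(N : ℝ)) (min N (φ ω)) * D j ω ∂P) atTop
      (𝓝 (∫ ω, φ ω * D j ω ∂P)) := by
    refine tendsto_integral_of_dominated_convergence (fun ω => ‖φ ω * D j ω‖) (fun n => ?_)
      hint.norm (fun n => ae_of_all _ fun ω => ?_) (ae_of_all _ fun ω => ?_)
    · have h1 : Measurable fun x : ℝ => max (-(n : ℝ)) (min n x) := by fun_prop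
      exact ((h1.comp (hφ.mono (h.le _) le_rfl)).mul (h.measurable j)).aestronglyMeasurable
    · rw [norm_mul, norm_mul]
      gcongr
      have hn : (0 : ℝ) ≤ n := by positivity
      rw [Real.norm_eq_abs, Real.norm_eq_abs, abs_le]
      constructor
      · rcases le_total (n : ℝ) (φ ω) with h1 | h1
        · rw [min_eq_left h1]
          exact le_trans (by have := abs_nonneg (φ ω); linarith) (le_max_right _ _)
        · rw [min_eq_right h1]
          exact le_trans (neg_abs_le _) (le_max_right _ _)
      · exact max_le (by have := abs_nonneg (φ ω); linarith)
          ((min_le_right _ _).trans (le_abs_self _))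
    · refine tendsto_const_nhds.congr' ?_
      obtain ⟨N, hN⟩ := exists_nat_ge |φ ω|
      filter_upwards [eventually_ge_atTop N] with n hn
      have h1 : |φ ω| ≤ n := hN.trans (by exact_mod_cast hn)
      rw [abs_le] at h1
      rw [min_eq_right h1.2, max_eq_right h1.1]
  simp only [hz] at hlim
  exact (tendsto_nhds_unique hlim tendsto_const_nhds)

lemma memLp_sum (h : IsMixingMDS P F D) (n : ℕ) :
    MemLp (fun ω => ∑ j ∈ Finset.range n, D j ω) 2 P :=
  memLp_finsetSum _ fun j _ => h.memLp' j

/-- The cross terms vanish by orthogonality. That the variance is exact for every `n`, not only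
asymptotically, is what later yields uniform integrability and uniform tails. -/
lemma integral_sum_sq (h : IsMixingMDS P F D) (n : ℕ) :
    ∫ ω, (∑ j ∈ Finset.range n, D j ω) ^ 2 ∂P = n * ∫ ω, D 0 ω ^ 2 ∂P := by
  induction n with
  | zero => simp
  | succ n ih =>
    have e : ∀ ω, (∑ j ∈ Finset.range (n + 1), D j ω) ^ 2 =
        (∑ j ∈ Finset.range n, D j ω) ^ 2 + (2 * ((∑ j ∈ Finset.range n, D j ω) * D n ω)
          + D n ω ^ 2) := by
      intro ω; rw [Finset.sum_range_succ]; ring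
    have hi2 : Integrable (fun ω => 2 * ((∑ j ∈ Finset.range n, D j ω) * D n ω)) P :=
      ((h.memLp_sum n).integrable_mul (h.memLp' n)).const_mul 2
    have hi3 : Integrable (fun ω => D n ω ^ 2) P := (h.memLp' n).integrable_sq
    have hi1 : Integrable (fun ω => (∑ j ∈ Finset.range n, D j ω) ^ 2) P :=
      (h.memLp_sum n).integrable_sq
    simp_rw [e]
    rw [integral_add hi1 (by exact hi2.add hi3), integral_add hi2 hi3, ih,
      integral_const_mul, h.integral_mul_eq_zero (h.measurable_sum n) (h.memLp_sum n),
      h.integral_comp_eq n (g := fun x => x ^ 2) (by fun_prop)]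
    push_cast
    ring

/-- The exponential up to time `j` is measurable with respect to the past, so `mix` controls its
correlation with the square `m` steps later; cosine and sine contribute `ε / 4` each. Replacing the
sum up to `j + m` by the sum up to `j` costs `|a|` times `m` increments where the centred square is
at most `B`. Elsewhere it costs at most twice the tail, which is another `ε / 2`. -/
lemma norm_integral_cexp_mul_le (h : IsMixingMDS P F D) {ε : ℝ} (hε : 0 < ε) :
    ∃ m : ℕ, ∃ C : ℝ, 0 ≤ C ∧ ∀ (a : ℝ) (j : ℕ),
      ‖∫ ω, Complex.exp ((a * ∑ i ∈ Finset.range (j + m), D i ω : ℝ) * Complex.I) *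
        ((D (j + m) ω ^ 2 - ∫ ω, D 0 ω ^ 2 ∂P : ℝ) : ℂ) ∂P‖ ≤ ε + C * |a| := by
  set s2 := ∫ ω, D 0 ω ^ 2 ∂P with hs2
  obtain ⟨m, hm⟩ := h.mix (ε / 4) (by positivity)
  have hq : ∀ j, Integrable (fun ω => D j ω ^ 2 - s2) P := fun j =>
    (h.memLp' j).integrable_sq.sub (integrable_const _)
  obtain ⟨B, hB0, hB⟩ := exists_integral_tail_le (hq 0) (ε := ε / 4) (by positivity)
  refine ⟨m, B * (m * ∫ ω, |D 0 ω| ∂P), by positivity, fun a j => ?_⟩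
  set S : ℕ → Ω → ℝ := fun k ω => a * ∑ i ∈ Finset.range k, D i ω with hS
  have hSm : ∀ k, Measurable[F k] (S k) := fun k => (h.measurable_sum k).const_mul a
  have hSm' : ∀ k, Measurable (S k) := fun k => (hSm k).mono (h.le _) le_rfl
  set q : Ω → ℝ := fun ω => D (j + m) ω ^ 2 - s2 with hqdef
  have hqi : Integrable q P := hq _
  have hexp : ∀ k, Integrable (fun ω => Complex.exp (S k ω * Complex.I) * (q ω : ℂ)) P := by
    intro k
    refine hqi.ofReal.bdd_mul (c := 1) ?_ (ae_of_all _ fun ω => ?_)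
    · have := hSm' k
      exact Measurable.aestronglyMeasurable (by fun_prop)
    · rw [Complex.norm_exp_ofReal_mul_I]
  have hsplit : ∫ ω, Complex.exp (S (j + m) ω * Complex.I) * (q ω : ℂ) ∂P =
      ∫ ω, (Complex.exp (S (j + m) ω * Complex.I) * (q ω : ℂ) -
        Complex.exp (S j ω * Complex.I) * (q ω : ℂ)) ∂P +
      ∫ ω, Complex.exp (S j ω * Complex.I) * (q ω : ℂ) ∂P := by
    rw [integral_sub (hexp _) (hexp _)]; ring
  have h2 : ‖∫ ω, Complex.exp (S j ω * Complex.I) * (q ω : ℂ) ∂P‖ ≤ ε / 2 := by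
    rw [integral_cexp_mul_ofReal (hSm' j) hqi]
    have hc := hm j (fun ω => Real.cos (S j ω)) (Real.continuous_cos.measurable.comp (hSm j))
      (fun ω => Real.abs_cos_le_one _)
    have hs := hm j (fun ω => Real.sin (S j ω)) (Real.continuous_sin.measurable.comp (hSm j))
      (fun ω => Real.abs_sin_le_one _)
    refine (norm_add_le _ _).trans ?_
    rw [norm_mul, Complex.norm_I, mul_one, Complex.norm_real, Complex.norm_real, Real.norm_eq_abs,
      Real.norm_eq_abs]
    linarith
  have habs : ∀ i, Integrable (fun ω => |D i ω|) P := fun i => (h.integrable i).abs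
  have htail : Integrable (fun ω => {ω | B < |q ω|}.indicator (fun ω => |q ω|) ω) P :=
    hqi.abs.indicator₀ (nullMeasurableSet_lt aemeasurable_const hqi.abs.aemeasurable)
  have h1 : ‖∫ ω, (Complex.exp (S (j + m) ω * Complex.I) * (q ω : ℂ) -
        Complex.exp (S j ω * Complex.I) * (q ω : ℂ)) ∂P‖ ≤
      B * (m * ∫ ω, |D 0 ω| ∂P) * |a| + ε / 2 := by
    have hb : Integrable (fun ω => B * |a| * ∑ i ∈ Finset.range m, |D (j + i) ω| +
        2 * {ω | B < |q ω|}.indicator (fun ω => |q ω|) ω) P :=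
      ((integrable_finsetSum _ fun i _ => habs (j + i)).const_mul _).add (htail.const_mul 2)
    refine (norm_integral_le_of_norm_le hb (ae_of_all _ fun ω => ?_)).trans ?_
    · rw [← sub_mul, norm_mul, Complex.norm_real, Real.norm_eq_abs]
      have hle2 : ‖Complex.exp (S (j + m) ω * Complex.I) - Complex.exp (S j ω * Complex.I)‖ ≤ 2 := by
        refine (norm_sub_le _ _).trans ?_
        rw [Complex.norm_exp_ofReal_mul_I, Complex.norm_exp_ofReal_mul_I]; norm_num
      have hle : ‖Complex.exp (S (j + m) ω * Complex.I) - Complex.exp (S j ω * Complex.I)‖ ≤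
          |a| * ∑ i ∈ Finset.range m, |D (j + i) ω| := by
        have e : Complex.exp (S (j + m) ω * Complex.I) - Complex.exp (S j ω * Complex.I) =
            Complex.exp (S j ω * Complex.I) *
              (Complex.exp (Complex.I * ((S (j + m) ω - S j ω : ℝ) : ℂ)) - 1) := by
          rw [mul_sub, ← Complex.exp_add, mul_one]
          congr 2
          push_cast; ring
        rw [e, norm_mul, Complex.norm_exp_ofReal_mul_I, one_mul]
        refine (Real.norm_exp_I_mul_ofReal_sub_one_le).trans ?_
        have e2 : S (j + m) ω - S j ω = a * ∑ i ∈ Finset.range m, D (j + i) ω := by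
          simp only [hS]
          rw [Finset.sum_range_add]; ring
        rw [e2, Real.norm_eq_abs, abs_mul]
        gcongr
        exact Finset.abs_sum_le_sum_abs _ _
      have hnn : 0 ≤ |a| * ∑ i ∈ Finset.range m, |D (j + i) ω| := by positivity
      by_cases hω : B < |q ω|
      · rw [indicator_of_mem (by exact hω)]
        have : 0 ≤ B * |a| * ∑ i ∈ Finset.range m, |D (j + i) ω| := by positivity
        nlinarith [abs_nonneg (q ω)]
      · rw [indicator_of_notMem (by exact hω)]
        push Not at hω
        nlinarith [abs_nonneg (q ω), mul_le_mul hle hω (abs_nonneg _) hnn]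
    · rw [integral_add ((integrable_finsetSum _ fun i _ => habs (j + i)).const_mul _)
        (htail.const_mul 2), integral_const_mul, integral_const_mul,
        integral_finsetSum _ fun i _ => habs (j + i)]
      have e1 : ∀ i, ∫ ω, |D (j + i) ω| ∂P = ∫ ω, |D 0 ω| ∂P := fun i =>
        h.integral_comp_eq (j + i) (g := fun x => |x|) (by fun_prop)
      have e2 : ∫ ω, {ω | B < |q ω|}.indicator (fun ω => |q ω|) ω ∂P =
          ∫ ω, {ω | B < |D 0 ω ^ 2 - s2|}.indicator (fun ω => |D 0 ω ^ 2 - s2|) ω ∂P := by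
        have hg : Measurable ({x : ℝ | B < |x ^ 2 - s2|}.indicator (fun x => |x ^ 2 - s2|)) := by
          refine Measurable.indicator (by fun_prop) ?_
          exact measurableSet_lt measurable_const (by fun_prop)
        exact h.integral_comp_eq (j + m) hg
      simp only [e1, Finset.sum_const, Finset.card_range, nsmul_eq_mul]
      rw [e2]
      nlinarith
  rw [hsplit]
  refine (norm_add_le _ _).trans ?_
  linarith

/-- A crude bound for the first few indices, which have no past `m` steps back. -/
lemma norm_integral_cexp_mul_le' (h : IsMixingMDS P F D) (a : ℝ) (k : ℕ) :
    ‖∫ ω, Complex.exp ((a * ∑ i ∈ Finset.range k, D i ω : ℝ) * Complex.I) *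
        ((D k ω ^ 2 - ∫ ω, D 0 ω ^ 2 ∂P : ℝ) : ℂ) ∂P‖ ≤ 2 * ∫ ω, D 0 ω ^ 2 ∂P := by
  set s2 := ∫ ω, D 0 ω ^ 2 ∂P with hs2
  have hs2nn : 0 ≤ s2 := integral_nonneg fun ω => sq_nonneg _
  refine (norm_integral_le_of_norm_le
    (((h.memLp' k).integrable_sq).add (integrable_const s2)) (ae_of_all _ fun ω => ?_)).trans ?_
  · rw [norm_mul, Complex.norm_exp_ofReal_mul_I, one_mul, Complex.norm_real, Real.norm_eq_abs,
      Pi.add_apply, abs_le]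
    constructor <;> nlinarith [sq_nonneg (D k ω)]
  · rw [integral_add' (h.memLp' k).integrable_sq (integrable_const _),
      h.integral_comp_eq k (g := fun x => x ^ 2) (by fun_prop)]
    simp [← hs2]; linarith

/-- The scalar central limit theorem, in terms of characteristic functions. -/
theorem tendsto_charFun (h : IsMixingMDS P F D) (t : ℝ) :
    Tendsto (fun n : ℕ => ∫ ω, Complex.exp
      ((t / √n * ∑ i ∈ Finset.range n, D i ω : ℝ) * Complex.I) ∂P) atTop
      (𝓝 (Complex.exp (-((t ^ 2 * (∫ ω, D 0 ω ^ 2 ∂P) / 2 : ℝ) : ℂ)))) := by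
  set s2 := ∫ ω, D 0 ω ^ 2 ∂P with hs2
  have hs2nn : 0 ≤ s2 := integral_nonneg fun ω => sq_nonneg _
  set ψ : ℝ → ℕ → ℂ := fun a k => ∫ ω, Complex.exp
      ((a * ∑ i ∈ Finset.range k, D i ω : ℝ) * Complex.I) ∂P with hψ
  set ρ : ℝ → ℝ := fun a => ∫ ω, D 0 ω ^ 2 * min 1 |a * D 0 ω| ∂P with hρ
  set Q : ℝ → ℕ → ℂ := fun a k => ∫ ω, Complex.exp
    ((a * ∑ i ∈ Finset.range k, D i ω : ℝ) * Complex.I) * ((D k ω ^ 2 - s2 : ℝ) : ℂ) ∂P with hQ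
  have hSm : ∀ (a : ℝ) (k : ℕ), Measurable[F k] fun ω => a * ∑ i ∈ Finset.range k, D i ω :=
    fun a k => (h.measurable_sum k).const_mul a
  have hSm' : ∀ (a : ℝ) (k : ℕ), Measurable fun ω => a * ∑ i ∈ Finset.range k, D i ω :=
    fun a k => (hSm a k).mono (h.le _) le_rfl
  have hbm : ∀ (a : ℝ) (k : ℕ), AEStronglyMeasurable (fun ω => Complex.exp
      ((a * ∑ i ∈ Finset.range k, D i ω : ℝ) * Complex.I)) P := by
    intro a k
    have := hSm' a k
    exact Measurable.aestronglyMeasurable (by fun_prop)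
  have hbd : ∀ (a : ℝ) (k : ℕ) (q : Ω → ℂ), Integrable q P → Integrable (fun ω => Complex.exp
      ((a * ∑ i ∈ Finset.range k, D i ω : ℝ) * Complex.I) * q ω) P := by
    intro a k q hq
    refine hq.bdd_mul (c := 1) (hbm a k) (ae_of_all _ fun ω => ?_)
    rw [Complex.norm_exp_ofReal_mul_I]
  have hρi : ∀ (a : ℝ) (k : ℕ), Integrable (fun ω => D k ω ^ 2 * min 1 |a * D k ω|) P := by
    intro a k
    refine Integrable.mono' (h.memLp' k).integrable_sq ?_ (ae_of_all _ fun ω => ?_)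
    · have := h.measurable k
      exact Measurable.aestronglyMeasurable (by fun_prop)
    · rw [Real.norm_eq_abs, abs_mul, abs_of_nonneg (sq_nonneg (D k ω)),
        abs_of_nonneg (le_min zero_le_one (abs_nonneg _))]
      exact mul_le_of_le_one_right (sq_nonneg _) (min_le_left _ _)
  -- one step of the recursion
  have hstep : ∀ (a : ℝ) (k : ℕ), ‖ψ a (k + 1) - (1 - (a ^ 2 * s2 / 2 : ℝ)) * ψ a k‖ ≤
      4 * a ^ 2 * ρ a + a ^ 2 / 2 * ‖Q a k‖ := by
    intro a k
    set E : Ω → ℂ := fun ω => Complex.exp ((a * ∑ i ∈ Finset.range k, D i ω : ℝ) * Complex.I)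
    set r : Ω → ℂ := fun ω => Complex.exp ((a * D k ω : ℝ) * Complex.I) -
      (1 + (a * D k ω : ℝ) * Complex.I - (a * D k ω : ℝ) ^ 2 / 2)
    have hD1 : Integrable (fun ω => ((D k ω : ℝ) : ℂ)) P := (h.integrable k).ofReal
    have hD2 : Integrable (fun ω => ((D k ω ^ 2 - s2 : ℝ) : ℂ)) P :=
      ((h.memLp' k).integrable_sq.sub (integrable_const _)).ofReal
    have hr : Integrable r P := by
      refine Integrable.mono' ((hρi a k).const_mul (4 * a ^ 2)) ?_ (ae_of_all _ fun ω => ?_)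
      · have := h.measurable k
        exact Measurable.aestronglyMeasurable (by fun_prop)
      · refine (norm_cexp_mul_I_taylor_le _).trans (le_of_eq ?_)
        ring
    have e1 : ψ a (k + 1) = ∫ ω, ((1 - (a ^ 2 * s2 / 2 : ℝ)) * E ω + ((a * Complex.I) *
        (E ω * (D k ω : ℂ)) - (a ^ 2 / 2 : ℝ) * (E ω * ((D k ω ^ 2 - s2 : ℝ) : ℂ)) +
        E ω * r ω)) ∂P := by
      refine integral_congr_ae (ae_of_all _ fun ω => ?_)
      simp only [E, r, Finset.sum_range_succ, mul_add, Complex.ofReal_add, add_mul, Complex.exp_add]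
      push_cast
      ring
    have i0 : Integrable E P := by
      have := hbd a k (fun _ => 1) (integrable_const _)
      simp only [mul_one] at this
      exact this
    have i1 : Integrable (fun ω => (a * Complex.I) * (E ω * (D k ω : ℂ))) P :=
      (hbd a k _ hD1).const_mul _
    have i2 : Integrable (fun ω => (a ^ 2 / 2 : ℝ) * (E ω * ((D k ω ^ 2 - s2 : ℝ) : ℂ))) P :=
      (hbd a k _ hD2).const_mul _
    have i3 : Integrable (fun ω => E ω * r ω) P := hbd a k _ hr
    have hz : ∫ ω, E ω * (D k ω : ℂ) ∂P = 0 := by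
      have := integral_cexp_mul_ofReal (hSm' a k) (h.integrable k)
      have hc := h.mart k _ (Real.continuous_cos.measurable.comp (hSm a k))
        (fun ω => Real.abs_cos_le_one _)
      have hs := h.mart k _ (Real.continuous_sin.measurable.comp (hSm a k))
        (fun ω => Real.abs_sin_le_one _)
      simp only [Function.comp_apply] at hc hs
      rw [hc, hs] at this
      simp only [Complex.ofReal_zero, zero_mul, add_zero] at this
      exact this
    rw [integral_add (i0.const_mul _) (by exact (i1.sub i2).add i3),
      integral_add (by exact i1.sub i2) i3, integral_sub i1 i2, integral_const_mul,
      integral_const_mul, integral_const_mul, hz] at e1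
    have e2 : ψ a (k + 1) - (1 - (a ^ 2 * s2 / 2 : ℝ)) * ψ a k =
        ∫ ω, E ω * r ω ∂P - (a ^ 2 / 2 : ℝ) * Q a k := by
      rw [e1]; simp only [hψ, hQ, E]; ring
    rw [e2]
    refine (norm_sub_le _ _).trans (add_le_add ?_ ?_)
    · refine (norm_integral_le_of_norm_le ((hρi a k).const_mul (4 * a ^ 2))
        (ae_of_all _ fun ω => ?_)).trans (le_of_eq ?_)
      · rw [norm_mul, Complex.norm_exp_ofReal_mul_I, one_mul]
        refine (norm_cexp_mul_I_taylor_le _).trans (le_of_eq ?_)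
        ring
      · rw [integral_const_mul]
        congr 1
        exact h.integral_comp_eq k (g := fun x => x ^ 2 * min 1 |a * x|) (by fun_prop)
    · rw [norm_mul, Complex.norm_real, Real.norm_eq_abs, abs_of_nonneg (by positivity)]
  -- the remainder
  have hρ0 : Tendsto (fun n : ℕ => ρ (t / √n)) atTop (𝓝 0) := by
    have hlim : Tendsto (fun n : ℕ => t / √(n : ℝ)) atTop (𝓝 0) :=
      tendsto_const_nhds.div_atTop (Real.tendsto_sqrt_atTop.comp tendsto_natCast_atTop_atTop)
    have : Tendsto (fun n : ℕ => ρ (t / √n)) atTop (𝓝 (∫ _, (0 : ℝ) ∂P)) := by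
      refine tendsto_integral_of_dominated_convergence (fun ω => D 0 ω ^ 2)
        (fun n => (hρi _ 0).aestronglyMeasurable) (h.memLp' 0).integrable_sq
        (fun n => ae_of_all _ fun ω => ?_) (ae_of_all _ fun ω => ?_)
      · rw [Real.norm_eq_abs, abs_mul, abs_of_nonneg (sq_nonneg (D 0 ω)),
          abs_of_nonneg (le_min zero_le_one (abs_nonneg _))]
        exact mul_le_of_le_one_right (sq_nonneg _) (min_le_left _ _)
      · have hc : Continuous fun a : ℝ => D 0 ω ^ 2 * min 1 |a * D 0 ω| := by fun_prop
        have := (hc.tendsto 0).comp hlim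
        simpa [Function.comp_def] using this
    simpa using this
  have hpow : Tendsto (fun n : ℕ => ((1 - ((t / √n) ^ 2 * s2 / 2 : ℝ) : ℂ)) ^ n) atTop
      (𝓝 (Complex.exp (-((t ^ 2 * s2 / 2 : ℝ) : ℂ)))) := by
    refine (Complex.tendsto_one_add_div_pow_exp (-((t ^ 2 * s2 / 2 : ℝ) : ℂ))).congr fun n => ?_
    congr 1
    rw [div_pow, Real.sq_sqrt (Nat.cast_nonneg n)]
    push_cast
    ring
  -- The multiplier `1 - a² s2 / 2` has modulus at most one, so the one-step errors merely add up.
  have hsum : ∀ a : ℝ, a ^ 2 * s2 / 2 ≤ 1 → ∀ n : ℕ,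
      ‖ψ a n - (1 - (a ^ 2 * s2 / 2 : ℝ)) ^ n‖ ≤
        ∑ k ∈ Finset.range n, (4 * a ^ 2 * ρ a + a ^ 2 / 2 * ‖Q a k‖) := by
    intro a ha n
    induction n with
    | zero => simp [hψ]
    | succ n ih =>
      have e : ψ a (n + 1) - (1 - (a ^ 2 * s2 / 2 : ℝ)) ^ (n + 1) =
          (1 - (a ^ 2 * s2 / 2 : ℝ)) * (ψ a n - (1 - (a ^ 2 * s2 / 2 : ℝ)) ^ n) +
            (ψ a (n + 1) - (1 - (a ^ 2 * s2 / 2 : ℝ)) * ψ a n) := by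
        rw [pow_succ]; ring
      rw [e, Finset.sum_range_succ]
      refine (norm_add_le _ _).trans (add_le_add ?_ (hstep a n))
      rw [norm_mul]
      refine le_trans (mul_le_of_le_one_left (norm_nonneg _) ?_) ih
      rw [← Complex.ofReal_one, ← Complex.ofReal_sub, Complex.norm_real, Real.norm_eq_abs, abs_le]
      have : 0 ≤ a ^ 2 * s2 / 2 := by positivity
      constructor <;> linarith
  have hdiff : Tendsto (fun n : ℕ => ψ (t / √n) n - (1 - ((t / √n) ^ 2 * s2 / 2 : ℝ)) ^ n) atTop
      (𝓝 0) := by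
    rw [Metric.tendsto_atTop]
    intro ε hε
    -- Summing `n` errors with weight `t² / (2n)` multiplies this tolerance by `t² / 2`; dividing by
    -- `1 + t²` keeps the result below `ε`.
    obtain ⟨m, C, hC0, hC⟩ := h.norm_integral_cexp_mul_le (ε := ε / (1 + t ^ 2)) (by positivity)
    have hbound : ∀ n : ℕ, 1 ≤ n → (t / √n) ^ 2 * s2 / 2 ≤ 1 →
        ‖ψ (t / √n) n - (1 - ((t / √n) ^ 2 * s2 / 2 : ℝ)) ^ n‖ ≤
        4 * t ^ 2 * ρ (t / √n) + t ^ 2 * m * s2 / n +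
          t ^ 2 / 2 * (ε / (1 + t ^ 2) + C * |t / √n|) := by
      intro n hn ha
      have hn' : (0 : ℝ) < n := by exact_mod_cast hn
      refine (hsum _ ha n).trans ?_
      have ha2 : (t / √n) ^ 2 = t ^ 2 / n := by rw [div_pow, Real.sq_sqrt hn'.le]
      -- The first `m` indices receive the crude bound and all others are shifted by `m`; extending
      -- the range to `m + n` only adds nonnegative terms.
      have hQb : ∑ k ∈ Finset.range n, ‖Q (t / √n) k‖ ≤
          m * (2 * s2) + n * (ε / (1 + t ^ 2) + C * |t / √n|) := by
        have hnn : 0 ≤ ε / (1 + t ^ 2) + C * |t / √n| := by positivity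
        calc ∑ k ∈ Finset.range n, ‖Q (t / √n) k‖
            ≤ ∑ k ∈ Finset.range (m + n), ‖Q (t / √n) k‖ :=
              Finset.sum_le_sum_of_subset_of_nonneg (Finset.range_mono (by omega))
                (fun _ _ _ => norm_nonneg _)
          _ = ∑ k ∈ Finset.range m, ‖Q (t / √n) k‖ +
              ∑ k ∈ Finset.range n, ‖Q (t / √n) (k + m)‖ := by
              rw [Finset.sum_range_add]; simp only [add_comm]
          _ ≤ ∑ k ∈ Finset.range m, 2 * s2 +
              ∑ k ∈ Finset.range n, (ε / (1 + t ^ 2) + C * |t / √n|) := by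
              refine add_le_add (Finset.sum_le_sum fun k _ => ?_) (Finset.sum_le_sum fun k _ => ?_)
              · exact h.norm_integral_cexp_mul_le' _ _
              · exact hC _ _
          _ = _ := by simp only [Finset.sum_const, Finset.card_range, nsmul_eq_mul]
      rw [Finset.sum_add_distrib, ← Finset.mul_sum _ _ ((t / √n) ^ 2 / 2), Finset.sum_const,
        Finset.card_range, nsmul_eq_mul, ha2]
      have : t ^ 2 / n / 2 * ∑ k ∈ Finset.range n, ‖Q (t / √n) k‖ ≤
          t ^ 2 / n / 2 * (m * (2 * s2) + n * (ε / (1 + t ^ 2) + C * |t / √n|)) := by gcongr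
      refine (add_le_add le_rfl this).trans (le_of_eq ?_)
      field_simp
      ring
    have hlim0 : Tendsto (fun n : ℕ => t / √(n : ℝ)) atTop (𝓝 0) :=
      tendsto_const_nhds.div_atTop (Real.tendsto_sqrt_atTop.comp tendsto_natCast_atTop_atTop)
    have hlim : Tendsto (fun n : ℕ => 4 * t ^ 2 * ρ (t / √n) + t ^ 2 * m * s2 / n +
          t ^ 2 / 2 * (ε / (1 + t ^ 2) + C * |t / √n|)) atTop
        (𝓝 (4 * t ^ 2 * 0 + 0 + t ^ 2 / 2 * (ε / (1 + t ^ 2) + C * |(0 : ℝ)|))) := by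
      refine ((hρ0.const_mul _).add ?_).add ((tendsto_const_nhds.add (hlim0.abs.const_mul _)).const_mul _)
      exact tendsto_const_nhds.div_atTop tendsto_natCast_atTop_atTop
    have hlt : 4 * t ^ 2 * 0 + 0 + t ^ 2 / 2 * (ε / (1 + t ^ 2) + C * |(0 : ℝ)|) < ε := by
      simp only [abs_zero, mul_zero, add_zero, zero_add]
      rw [div_mul_div_comm, div_lt_iff₀ (by positivity)]
      nlinarith [mul_nonneg hε.le (sq_nonneg t)]
    have hsmall : ∀ᶠ n : ℕ in atTop, (t / √n) ^ 2 * s2 / 2 ≤ 1 := by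
      have : Tendsto (fun n : ℕ => (t / √n) ^ 2 * s2 / 2) atTop (𝓝 (0 ^ 2 * s2 / 2)) :=
        ((hlim0.pow 2).mul_const _).div_const _
      exact this.eventually (ge_mem_nhds (by norm_num))
    obtain ⟨N, hN⟩ := eventually_atTop.1
      ((hlim.eventually (gt_mem_nhds hlt)).and (hsmall.and (eventually_ge_atTop 1)))
    refine ⟨N, fun n hn => ?_⟩
    obtain ⟨h1, h2, h3⟩ := hN n hn
    rw [dist_zero_right]
    exact (hbound n h3 h2).trans_lt h1
  have := hdiff.add hpow
  simp only [sub_add_cancel, zero_add] at this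
  exact this

end IsMixingMDS

end MartingaleCLT

/-! ### Convergence of quadratic functionals under weak convergence -/

section WeakConvergence

set_option linter.unusedSectionVars false

variable {E : Type*} [NormedAddCommGroup E] [MeasurableSpace E] [BorelSpace E]

lemma eLpNorm_two_sq {α F : Type*} [MeasurableSpace α] [NormedAddCommGroup F] (f : α → F)
    (μ : Measure α) : eLpNorm f 2 μ ^ 2 = ∫⁻ x, ‖f x‖ₑ ^ 2 ∂μ := by
  have := eLpNorm_nnreal_pow_eq_lintegral (f := f) (μ := μ) (p := 2) (by norm_num)
  simpa using this

lemma integral_sub_max_eq {μ : Measure E} {K : ℝ}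
    (hi : Integrable (fun z => ‖z‖ ^ 2) μ) (hm : Integrable (fun z : E => min (‖z‖ ^ 2) K) μ) :
    ∫ z, max (‖z‖ ^ 2 - K) 0 ∂μ = ∫ z, ‖z‖ ^ 2 ∂μ - ∫ z, min (‖z‖ ^ 2) K ∂μ := by
  rw [← integral_sub hi hm]
  refine integral_congr_ae (ae_of_all _ fun z => ?_)
  rcases le_total (‖z‖ ^ 2) K with h | h
  · simp [h]
  · simp [h]

lemma integrable_min_norm_sq (μ : Measure E) [IsFiniteMeasure μ] {K : ℝ} (hK : 0 ≤ K) :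
    Integrable (fun z : E => min (‖z‖ ^ 2) K) μ := by
  refine Integrable.mono' (integrable_const K) ?_ (ae_of_all _ fun z => ?_)
  · exact (measurable_norm.pow_const 2).min measurable_const |>.aestronglyMeasurable
  · rw [Real.norm_eq_abs, abs_of_nonneg (le_min (by positivity) hK)]
    exact min_le_right _ _

/-- Weak convergence together with convergence of second moments makes the squared norms uniformly
integrable. -/
lemma exists_integral_max_sub_le {μ : ℕ → ProbabilityMeasure E} {μ₀ : ProbabilityMeasure E}
    (h : Tendsto μ atTop (𝓝 μ₀)) {V : ℝ}
    (hi : ∀ᶠ n in atTop, Integrable (fun z => ‖z‖ ^ 2) (μ n : Measure E))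
    (hV : ∀ᶠ n in atTop, ∫ z, ‖z‖ ^ 2 ∂(μ n : Measure E) = V)
    (hi₀ : Integrable (fun z => ‖z‖ ^ 2) (μ₀ : Measure E))
    (hV₀ : ∫ z, ‖z‖ ^ 2 ∂(μ₀ : Measure E) = V) {ε : ℝ} (hε : 0 < ε) :
    ∃ K : ℝ, 0 ≤ K ∧ (∀ᶠ n in atTop, ∫ z, max (‖z‖ ^ 2 - K) 0 ∂(μ n : Measure E) ≤ ε) ∧
      ∫ z, max (‖z‖ ^ 2 - K) 0 ∂(μ₀ : Measure E) ≤ ε := by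
  have hlim : Tendsto (fun K : ℕ => ∫ z, max (‖z‖ ^ 2 - K) 0 ∂(μ₀ : Measure E)) atTop
      (𝓝 (∫ _, (0 : ℝ) ∂(μ₀ : Measure E))) := by
    refine tendsto_integral_of_dominated_convergence (fun z => ‖z‖ ^ 2) (fun n => ?_) hi₀
      (fun n => ae_of_all _ fun z => ?_) (ae_of_all _ fun z => ?_)
    · exact (((measurable_norm.pow_const 2).sub_const _).max measurable_const).aestronglyMeasurable
    · rw [Real.norm_eq_abs, abs_of_nonneg (le_max_right _ _)]
      have : (0 : ℝ) ≤ n := by positivity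
      exact max_le (by linarith) (by positivity)
    · refine tendsto_const_nhds.congr' ?_
      obtain ⟨N, hN⟩ := exists_nat_ge (‖z‖ ^ 2)
      filter_upwards [eventually_ge_atTop N] with n hn
      rw [max_eq_right]
      have : (N : ℝ) ≤ n := by exact_mod_cast hn
      linarith
  rw [integral_zero] at hlim
  obtain ⟨K, hK⟩ := (hlim.eventually (gt_mem_nhds hε)).exists
  have hK0 : (0 : ℝ) ≤ K := by positivity
  refine ⟨K, hK0, ?_, hK.le⟩
  let f : BoundedContinuousFunction E ℝ := BoundedContinuousFunction.ofNormedAddCommGroup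
    (fun z => min (‖z‖ ^ 2) (K : ℝ)) (by fun_prop) K (fun z => by
      rw [Real.norm_eq_abs, abs_of_nonneg (le_min (by positivity) hK0)]
      exact min_le_right _ _)
  have hf := (ProbabilityMeasure.tendsto_iff_forall_integral_tendsto.1 h) f
  -- The excess over `K` equals the second moment minus the integral of the bounded continuous
  -- function `min (‖z‖ ^ 2) K`. The second moments agree, so weak convergence carries the bound
  -- from `μ₀` to `μ n`.
  rw [integral_sub_max_eq hi₀ (integrable_min_norm_sq _ hK0), hV₀] at hK
  have hf' : Tendsto (fun n => V - ∫ z, f z ∂(μ n : Measure E)) atTop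
    (𝓝 (V - ∫ z, f z ∂(μ₀ : Measure E))) := tendsto_const_nhds.sub hf
  filter_upwards [hf'.eventually (gt_mem_nhds hK), hi, hV] with n h1 h2 h3
  rw [integral_sub_max_eq h2 (integrable_min_norm_sq _ hK0), h3]
  exact h1.le

/-- A common Lipschitz constant gives equicontinuity, so convergence on a finite `δ / 3`-net of the
compact ball suffices. -/
lemma tendsto_sup_ball_of_lipschitz [ProperSpace E] {N : ℕ → E → ℝ} {N₀ : E → ℝ}
    (hN : ∀ n z w, |N n z - N n w| ≤ ‖z - w‖) (hN₀ : ∀ z w, |N₀ z - N₀ w| ≤ ‖z - w‖)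
    (hlim : ∀ z, Tendsto (fun n => N n z) atTop (𝓝 (N₀ z))) (r : ℝ) {δ : ℝ} (hδ : 0 < δ) :
    ∀ᶠ n in atTop, ∀ z, ‖z‖ ≤ r → |N n z - N₀ z| ≤ δ := by
  have htb := (isCompact_closedBall (0 : E) r).totallyBounded
  obtain ⟨t, htf, ht⟩ := Metric.totallyBounded_iff.1 htb (δ / 3) (by positivity)
  have hev : ∀ᶠ n in atTop, ∀ y ∈ t, |N n y - N₀ y| < δ / 3 := by
    rw [htf.eventually_all]
    intro y _
    have := Metric.tendsto_nhds.1 (hlim y) (δ / 3) (by positivity)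
    simpa [Real.dist_eq] using this
  filter_upwards [hev] with n hn z hz
  obtain ⟨y, hy, hzy⟩ := mem_iUnion₂.1 (ht (mem_closedBall_zero_iff.2 hz))
  rw [Metric.mem_ball, dist_eq_norm] at hzy
  have h1 := hN n z y
  have h2 := hN₀ y z
  rw [norm_sub_rev] at h2
  have h3 := (hn y hy).le
  have : N n z - N₀ z = (N n z - N n y) + (N n y - N₀ y) + (N₀ y - N₀ z) := by ring
  rw [this]
  refine (abs_add_three _ _ _).trans ?_
  linarith

/-- Convergence of `∫ N_n² dμ_n` for `1`-Lipschitz `N_n`, pointwise convergent, and weakly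
convergent `μ_n` with constant second moment. -/
lemma tendsto_integral_sq_of_lipschitz [ProperSpace E] {μ : ℕ → ProbabilityMeasure E}
    {μ₀ : ProbabilityMeasure E} (h : Tendsto μ atTop (𝓝 μ₀)) {V : ℝ}
    (hi : ∀ᶠ n in atTop, Integrable (fun z => ‖z‖ ^ 2) (μ n : Measure E))
    (hV : ∀ᶠ n in atTop, ∫ z, ‖z‖ ^ 2 ∂(μ n : Measure E) = V)
    (hi₀ : Integrable (fun z => ‖z‖ ^ 2) (μ₀ : Measure E))
    (hV₀ : ∫ z, ‖z‖ ^ 2 ∂(μ₀ : Measure E) = V)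
    {N : ℕ → E → ℝ} {N₀ : E → ℝ}
    (hN : ∀ n z w, |N n z - N n w| ≤ ‖z - w‖) (hNz : ∀ n, N n 0 = 0)
    (hlim : ∀ z, Tendsto (fun n => N n z) atTop (𝓝 (N₀ z))) :
    Tendsto (fun n => ∫ z, N n z ^ 2 ∂(μ n : Measure E)) atTop
      (𝓝 (∫ z, N₀ z ^ 2 ∂(μ₀ : Measure E))) := by
  have hN₀ : ∀ z w, |N₀ z - N₀ w| ≤ ‖z - w‖ := fun z w =>
    le_of_tendsto ((hlim z).sub (hlim w)).abs (Eventually.of_forall fun n => hN n z w)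
  have hN₀z : N₀ 0 = 0 := tendsto_nhds_unique (hlim 0) (by simp [hNz])
  have hNc : ∀ n, Continuous (N n) := fun n =>
    (LipschitzWith.of_dist_le_mul (K := 1) fun z w => by
      simpa [Real.dist_eq, dist_eq_norm] using hN n z w).continuous
  have hN₀c : Continuous N₀ :=
    (LipschitzWith.of_dist_le_mul (K := 1) fun z w => by
      simpa [Real.dist_eq, dist_eq_norm] using hN₀ z w).continuous
  have hNle : ∀ n z, N n z ^ 2 ≤ ‖z‖ ^ 2 := fun n z => by
    have := hN n z 0
    rw [hNz, sub_zero, sub_zero] at this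
    rw [← sq_abs]; gcongr
  have hN₀le : ∀ z, N₀ z ^ 2 ≤ ‖z‖ ^ 2 := fun z => by
    have := hN₀ z 0
    rw [hN₀z, sub_zero, sub_zero] at this
    rw [← sq_abs]; gcongr
  have hV0 : 0 ≤ V := hV₀ ▸ integral_nonneg fun z => by positivity
  rw [Metric.tendsto_nhds]
  intro ε hε
  obtain ⟨K, hK0, hK, hK₀⟩ := exists_integral_max_sub_le h hi hV hi₀ hV₀ (ε := ε / 8) (by positivity)
  -- truncation error
  have htr : ∀ (M : E → ℝ) (ν : Measure E), IsProbabilityMeasure ν → Continuous M →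
      (∀ z, M z ^ 2 ≤ ‖z‖ ^ 2) →
      Integrable (fun z => ‖z‖ ^ 2) ν → ∫ z, max (‖z‖ ^ 2 - K) 0 ∂ν ≤ ε / 8 →
      |∫ z, M z ^ 2 ∂ν - ∫ z, min (M z ^ 2) K ∂ν| ≤ ε / 8 := by
    intro M ν _ hM hMle hνi hνK
    have i1 : Integrable (fun z => M z ^ 2) ν := by
      refine Integrable.mono' hνi (hM.pow 2).measurable.aestronglyMeasurable (ae_of_all _ fun z => ?_)
      rw [Real.norm_eq_abs, abs_of_nonneg (sq_nonneg _)]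
      exact hMle z
    have i2 : Integrable (fun z => min (M z ^ 2) K) ν := by
      refine Integrable.mono' hνi ((hM.pow 2).min continuous_const).measurable.aestronglyMeasurable
        (ae_of_all _ fun z => ?_)
      rw [Real.norm_eq_abs, abs_of_nonneg (le_min (sq_nonneg _) hK0)]
      exact (min_le_left _ _).trans (hMle z)
    have i3 : Integrable (fun z : E => max (‖z‖ ^ 2 - K) 0) ν := by
      refine Integrable.mono' hνi
        (((measurable_norm.pow_const 2).sub_const _).max measurable_const).aestronglyMeasurable
        (ae_of_all _ fun z => ?_)
      rw [Real.norm_eq_abs, abs_of_nonneg (le_max_right _ _)]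
      exact max_le (by linarith) (by positivity)
    rw [← integral_sub i1 i2]
    refine le_trans ?_ hνK
    rw [← Real.norm_eq_abs]
    refine norm_integral_le_of_norm_le i3 (ae_of_all _ fun z => ?_)
    rw [Real.norm_eq_abs]
    rcases le_total (M z ^ 2) K with hle | hle
    · rw [min_eq_left hle, sub_self, abs_zero]; exact le_max_right _ _
    · rw [min_eq_right hle, abs_of_nonneg (by linarith)]
      exact le_max_of_le_left (by linarith [hMle z])
  -- the truncated limit
  let f : BoundedContinuousFunction E ℝ := BoundedContinuousFunction.ofNormedAddCommGroup
    (fun z => min (N₀ z ^ 2) K) (by fun_prop) K (fun z => by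
      rw [Real.norm_eq_abs, abs_of_nonneg (le_min (by positivity) hK0)]
      exact min_le_right _ _)
  have hf : Tendsto (fun n => ∫ z, min (N₀ z ^ 2) K ∂(μ n : Measure E)) atTop
      (𝓝 (∫ z, min (N₀ z ^ 2) K ∂(μ₀ : Measure E))) :=
    (ProbabilityMeasure.tendsto_iff_forall_integral_tendsto.1 h) f
  have hf' := Metric.tendsto_nhds.1 hf (ε / 8) (by positivity)
  -- uniform convergence on a large ball
  obtain ⟨r, hr1, hr⟩ : ∃ r : ℝ, 1 ≤ r ∧ K * V / r ^ 2 ≤ ε / 8 := by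
    refine ⟨1 + 8 * (K * V) / ε, by simp; positivity, ?_⟩
    rw [div_le_iff₀ (by positivity)]
    have hKV : 0 ≤ K * V := by positivity
    have h1 : 0 ≤ 8 * (K * V) / ε := by positivity
    have h2 : ε / 8 * (8 * (K * V) / ε) = K * V := by field_simp
    nlinarith [mul_nonneg hε.le (sq_nonneg (8 * (K * V) / ε))]
  have hr0 : 0 < r := by linarith
  -- On the ball `|N n + N₀| ≤ 2 r`, so this tolerance makes the squares differ by at most `ε / 8`.
  -- Outside it the truncated squares differ by at most `K`, and Chebyshev bounds the contribution
  -- by `K V / r²`.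
  have hball := tendsto_sup_ball_of_lipschitz hN hN₀ hlim r (δ := ε / (16 * r)) (by positivity)
  filter_upwards [hK, hf', hball, hi, hV] with n h1 h2 h3 h4 h5
  have e1 := htr (N n) (μ n) inferInstance (hNc n) (hNle n) h4 h1
  have e2 := htr N₀ μ₀ inferInstance hN₀c hN₀le hi₀ hK₀
  have e3 : |∫ z, min (N n z ^ 2) K ∂(μ n : Measure E) - ∫ z, min (N₀ z ^ 2) K ∂(μ n : Measure E)| ≤
      ε / 8 + ε / 8 := by
    have i2 : ∀ M : E → ℝ, Continuous M → Integrable (fun z => min (M z ^ 2) K)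
        (μ n : Measure E) := by
      intro M hM
      refine Integrable.mono' (integrable_const K)
        ((hM.pow 2).min continuous_const).measurable.aestronglyMeasurable (ae_of_all _ fun z => ?_)
      rw [Real.norm_eq_abs, abs_of_nonneg (le_min (sq_nonneg _) hK0)]
      exact min_le_right _ _
    rw [← integral_sub (i2 _ (hNc n)) (i2 _ hN₀c), ← Real.norm_eq_abs]
    refine (norm_integral_le_of_norm_le (g := fun z => ε / 8 + K / r ^ 2 * ‖z‖ ^ 2)
      ((integrable_const _).add (h4.const_mul _)) (ae_of_all _ fun z => ?_)).trans ?_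
    · rw [Real.norm_eq_abs]
      rcases le_total ‖z‖ r with hz | hz
      · have h6 : |min (N n z ^ 2) K - min (N₀ z ^ 2) K| ≤ |N n z ^ 2 - N₀ z ^ 2| := by
          have := abs_min_sub_min_le_max (N n z ^ 2) K (N₀ z ^ 2) K
          simpa using this
        have h7 : |N n z ^ 2 - N₀ z ^ 2| ≤ ε / 8 := by
          have : N n z ^ 2 - N₀ z ^ 2 = (N n z - N₀ z) * (N n z + N₀ z) := by ring
          rw [this, abs_mul]
          have h8 : |N n z + N₀ z| ≤ 2 * r := by
            refine (abs_add_le _ _).trans ?_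
            have a1 := abs_le_of_sq_le_sq (hNle n z) (norm_nonneg z)
            have a2 := abs_le_of_sq_le_sq (hN₀le z) (norm_nonneg z)
            linarith
          calc |N n z - N₀ z| * |N n z + N₀ z| ≤ ε / (16 * r) * (2 * r) := by
                gcongr; exact h3 z hz
            _ = ε / 8 := by field_simp; ring
        have : 0 ≤ K / r ^ 2 * ‖z‖ ^ 2 := by positivity
        linarith
      · have h6 : |min (N n z ^ 2) K - min (N₀ z ^ 2) K| ≤ K := by
          have a1 : 0 ≤ min (N n z ^ 2) K := le_min (sq_nonneg _) hK0
          have a2 : 0 ≤ min (N₀ z ^ 2) K := le_min (sq_nonneg _) hK0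
          have a3 : min (N n z ^ 2) K ≤ K := min_le_right _ _
          have a4 : min (N₀ z ^ 2) K ≤ K := min_le_right _ _
          rw [abs_le]; constructor <;> linarith
        have h7 : K ≤ K / r ^ 2 * ‖z‖ ^ 2 := by
          rw [div_mul_eq_mul_div, le_div_iff₀ (by positivity)]
          gcongr
        have : 0 ≤ ε / 8 := by positivity
        linarith
    · rw [integral_add (integrable_const _) (h4.const_mul _), integral_const_mul, h5]
      simp only [integral_const, probReal_univ, smul_eq_mul, one_mul]
      have : K / r ^ 2 * V = K * V / r ^ 2 := by ring
      linarith
  rw [Real.dist_eq] at h2 ⊢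
  have key : ∫ z, N n z ^ 2 ∂(μ n : Measure E) - ∫ z, N₀ z ^ 2 ∂(μ₀ : Measure E) =
      (∫ z, N n z ^ 2 ∂(μ n : Measure E) - ∫ z, min (N n z ^ 2) K ∂(μ n : Measure E)) +
      (∫ z, min (N n z ^ 2) K ∂(μ n : Measure E) - ∫ z, min (N₀ z ^ 2) K ∂(μ n : Measure E)) +
      (∫ z, min (N₀ z ^ 2) K ∂(μ n : Measure E) - ∫ z, min (N₀ z ^ 2) K ∂(μ₀ : Measure E)) -
      (∫ z, N₀ z ^ 2 ∂(μ₀ : Measure E) - ∫ z, min (N₀ z ^ 2) K ∂(μ₀ : Measure E)) := by ring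
  rw [key]
  refine (abs_sub _ _).trans_lt ?_
  refine (add_le_add (abs_add_three _ _ _) le_rfl).trans_lt ?_
  linarith

end WeakConvergence

/-! ### Orthonormal expansions of random vectors -/

section Hilbert

open scoped RealInnerProductSpace

variable {H : Type*} [NormedAddCommGroup H] [InnerProductSpace ℝ H]

/-- Distinct basis vectors are at distance `√2`, so balls of radius `1 / 2` around them are disjoint
open sets. Countability is needed to exchange sums over the basis with integrals. -/
lemma HilbertBasis.countable_index [SecondCountableTopology H] {ι : Type*}
    (b : HilbertBasis ι ℝ H) : Countable ι := by
  have hdist : ∀ i j, i ≠ j → 1 ≤ ‖b i - b j‖ := by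
    intro i j hij
    have h1 : ‖b i - b j‖ ^ 2 = 2 := by
      rw [norm_sub_sq_real, b.orthonormal.1 i, b.orthonormal.1 j, b.orthonormal.2 hij]
      norm_num
    nlinarith [norm_nonneg (b i - b j)]
  have hd : Pairwise fun i j => Disjoint (Metric.ball (b i) (1 / 2)) (Metric.ball (b j) (1 / 2)) := by
    intro i j hij
    refine Metric.ball_disjoint_ball ?_
    rw [dist_eq_norm]
    linarith [hdist i j hij]
  exact hd.countable_of_isOpen_disjoint (fun i => Metric.isOpen_ball)
    (fun i => ⟨b i, Metric.mem_ball_self (by norm_num)⟩)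

lemma HilbertBasis.hasSum_inner_sq {ι : Type*} (b : HilbertBasis ι ℝ H) (x : H) :
    HasSum (fun i => ⟪b i, x⟫ ^ 2) (‖x‖ ^ 2) := by
  have := b.hasSum_inner_mul_inner x x
  rw [real_inner_self_eq_norm_sq] at this
  refine this.congr_fun fun i => ?_
  rw [real_inner_comm x, sq]

lemma HilbertBasis.enorm_sq_eq_tsum {ι : Type*} (b : HilbertBasis ι ℝ H) (x : H) :
    ‖x‖ₑ ^ 2 = ∑' i, ENNReal.ofReal (⟪b i, x⟫ ^ 2) := by
  rw [← ENNReal.ofReal_tsum_of_nonneg (fun i => sq_nonneg _) (b.hasSum_inner_sq x).summable,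
    (b.hasSum_inner_sq x).tsum_eq, ENNReal.ofReal_pow (norm_nonneg _), ofReal_norm]

end Hilbert

/-! ### Quadratic functionals of asymptotically Gaussian random vectors in a Hilbert space -/

section HilbertCLT

set_option linter.unusedSectionVars false

open scoped RealInnerProductSpace

variable {H : Type*} [NormedAddCommGroup H] [InnerProductSpace ℝ H]
variable {Ω : Type*} [MeasurableSpace Ω]

lemma HilbertBasis.inner_sub_sum {ι : Type*} [DecidableEq ι] (b : HilbertBasis ι ℝ H)
    (s : Finset ι) (x : H) (i : ι) :
    ⟪b i, x - ∑ j ∈ s, ⟪b j, x⟫ • b j⟫ = if i ∈ s then 0 else ⟪b i, x⟫ := by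
  rw [inner_sub_right, inner_sum]
  simp only [inner_smul_right, orthonormal_iff_ite.1 b.orthonormal, mul_ite, mul_one, mul_zero,
    Finset.sum_ite_eq]
  split_ifs <;> simp

/-- A random vector `G` has the covariance operator of `D`, in the weak sense. -/
def SameCovariance (P : Measure Ω) (G D : Ω → H) : Prop :=
  ∀ h : H, ∫⁻ ω, ENNReal.ofReal (⟪h, G ω⟫ ^ 2) ∂P = ∫⁻ ω, ENNReal.ofReal (⟪h, D ω⟫ ^ 2) ∂P

variable [MeasurableSpace H] [BorelSpace H] [SecondCountableTopology H]

/-- By Parseval the expansion error depends only on the variances of the coordinates. The right side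
no longer involves `G`, so a finite set of coordinates good for `D` is good for every `G n` with the
same covariance. -/
lemma SameCovariance.lintegral_enorm_sub_sum_sq {P : Measure Ω} {G D : Ω → H}
    (h : SameCovariance P G D) (hG : Measurable G) {ι : Type*}
    [DecidableEq ι] (b : HilbertBasis ι ℝ H) (s : Finset ι) :
    ∫⁻ ω, ‖G ω - ∑ j ∈ s, ⟪b j, G ω⟫ • b j‖ₑ ^ 2 ∂P =
      ∑' i : {i // i ∉ s}, ∫⁻ ω, ENNReal.ofReal (⟪b i, D ω⟫ ^ 2) ∂P := by
  have := b.countable_index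
  simp_rw [b.enorm_sq_eq_tsum, b.inner_sub_sum]
  rw [lintegral_tsum]
  · have : ∀ i, ∫⁻ ω, ENNReal.ofReal ((if i ∈ s then 0 else ⟪b i, G ω⟫) ^ 2) ∂P =
        {i | i ∉ s}.indicator (fun i => ∫⁻ ω, ENNReal.ofReal (⟪b i, D ω⟫ ^ 2) ∂P) i := by
      intro i
      by_cases hi : i ∈ s
      · simp [hi]
      · simp [hi, h (b i)]
    simp_rw [this]
    exact (tsum_subtype {i | i ∉ s} _).symm
  · intro i
    split_ifs
    · fun_prop
    · fun_prop

lemma lintegral_enorm_sq_eq_tsum (P : Measure Ω) {D : Ω → H}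
    (hD : Measurable D) {ι : Type*} (b : HilbertBasis ι ℝ H) :
    ∫⁻ ω, ‖D ω‖ₑ ^ 2 ∂P = ∑' i, ∫⁻ ω, ENNReal.ofReal (⟪b i, D ω⟫ ^ 2) ∂P := by
  have := b.countable_index
  simp_rw [b.enorm_sq_eq_tsum]
  rw [lintegral_tsum]
  intro i
  fun_prop

variable {P : Measure Ω} [IsProbabilityMeasure P]

/-- Convergence of the squared `L²` norms of `1`-Lipschitz functions of finite-dimensional
projections. -/
lemma tendsto_integral_sq_comp_sum {D : Ω → H} (hD : Measurable D)
    (hD2 : ∫⁻ ω, ‖D ω‖ₑ ^ 2 ∂P ≠ ∞)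
    {G : ℕ → Ω → H} (hG : ∀ n, Measurable (G n))
    (hcov : ∀ n, 1 ≤ n → SameCovariance P (G n) D)
    (hclt : ∀ h : H, Tendsto (fun n => ∫ ω, Complex.exp ((⟪h, G n ω⟫ : ℝ) * Complex.I) ∂P) atTop
      (𝓝 (Complex.exp (-(((∫ ω, ⟪h, D ω⟫ ^ 2 ∂P) / 2 : ℝ) : ℂ)))))
    {N : ℕ → H → ℝ} (hN : ∀ n z w, |N n z - N n w| ≤ ‖z - w‖) (hNz : ∀ n, N n 0 = 0)
    (hlim : ∀ z, ∃ l, Tendsto (fun n => N n z) atTop (𝓝 l))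
    {ι : Type*} [DecidableEq ι] (b : HilbertBasis ι ℝ H) (s : Finset ι) :
    ∃ l : ℝ, Tendsto (fun n => ∫ ω, N n (∑ j ∈ s, ⟪b j, G n ω⟫ • b j) ^ 2 ∂P) atTop (𝓝 l) := by
  choose N₀ hN₀ using hlim
  let inc : EuclideanSpace ℝ s → H := fun z => ∑ i : s, z i • b i
  let Z : ℕ → Ω → EuclideanSpace ℝ s := fun n ω => WithLp.toLp 2 fun i : s => ⟪b i, G n ω⟫
  have hinc_sub : ∀ z w, inc z - inc w = inc (z - w) := by
    intro z w
    simp [inc, sub_smul, Finset.sum_sub_distrib]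
  have hons : Orthonormal ℝ (fun i : s => b i) := b.orthonormal.comp _ Subtype.val_injective
  have hinc_norm : ∀ z, ‖inc z‖ = ‖z‖ := by
    intro z
    have : ‖inc z‖ ^ 2 = ‖z‖ ^ 2 := by
      rw [← real_inner_self_eq_norm_sq, EuclideanSpace.norm_sq_eq]
      simp only [inc]
      rw [hons.inner_sum]
      simp [sq]
    exact (pow_left_inj₀ (norm_nonneg _) (norm_nonneg _) two_ne_zero).1 this
  have hincZ : ∀ n ω, inc (Z n ω) = ∑ j ∈ s, ⟪b j, G n ω⟫ • b j := by
    intro n ω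
    simp only [inc, Z]
    exact Finset.sum_coe_sort s fun j => ⟪b j, G n ω⟫ • b j
  have hZm : ∀ n, Measurable (Z n) := by
    intro n
    have := hG n
    exact (WithLp.measurable_toLp 2 _).comp (measurable_pi_lambda _ fun i => by fun_prop)
  have hDL : ∀ h : H, MemLp (fun ω => ⟪h, D ω⟫) 2 P := by
    intro h
    have : MemLp D 2 P := by
      refine ⟨hD.aestronglyMeasurable, ?_⟩
      rw [lt_top_iff_ne_top]
      intro htop
      apply hD2
      rw [← eLpNorm_two_sq, htop]; rfl
    exact this.const_inner h
  have hGL : ∀ n, 1 ≤ n → ∀ h : H, MemLp (fun ω => ⟪h, G n ω⟫) 2 P := by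
    intro n hn h
    have hm : Measurable fun ω => ⟪h, G n ω⟫ := by have := hG n; fun_prop
    rw [memLp_two_iff_integrable_sq hm.aestronglyMeasurable]
    refine ⟨(hm.pow_const 2).aestronglyMeasurable, ?_⟩
    rw [hasFiniteIntegral_iff_ofReal (ae_of_all _ fun ω => sq_nonneg _), hcov n hn h,
      ← hasFiniteIntegral_iff_ofReal (ae_of_all _ fun ω => sq_nonneg _)]
    exact (hDL h).integrable_sq.2
  have hGD : ∀ n, 1 ≤ n → ∀ h : H, ∫ ω, ⟪h, G n ω⟫ ^ 2 ∂P = ∫ ω, ⟪h, D ω⟫ ^ 2 ∂P := by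
    intro n hn h
    rw [integral_eq_lintegral_of_nonneg_ae (ae_of_all _ fun ω => sq_nonneg _)
        (hGL n hn h).integrable_sq.aestronglyMeasurable,
      integral_eq_lintegral_of_nonneg_ae (ae_of_all _ fun ω => sq_nonneg _)
        (hDL h).integrable_sq.aestronglyMeasurable, hcov n hn h]
  -- the covariance matrix
  let S : Matrix s s ℝ := Matrix.of fun i j => ∫ ω, ⟪b i, D ω⟫ * ⟪b j, D ω⟫ ∂P
  have hquad : ∀ x : s → ℝ, x ⬝ᵥ S.mulVec x = ∫ ω, ⟪∑ i : s, x i • b i, D ω⟫ ^ 2 ∂P := by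
    intro x
    have e : ∀ ω, ⟪∑ i : s, x i • b i, D ω⟫ ^ 2 =
        ∑ i : s, ∑ j : s, x i * (x j * (⟪b i, D ω⟫ * ⟪b j, D ω⟫)) := by
      intro ω
      rw [sq, sum_inner, Finset.sum_mul_sum]
      refine Finset.sum_congr rfl fun i _ => Finset.sum_congr rfl fun j _ => ?_
      rw [real_inner_smul_left, real_inner_smul_left]; ring
    have hint : ∀ i j : s, Integrable (fun ω => x i * (x j * (⟪b i, D ω⟫ * ⟪b j, D ω⟫))) P :=
      fun i j => (((hDL _).integrable_mul (hDL _)).const_mul _).const_mul _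
    simp_rw [e]
    rw [integral_finsetSum _ fun i _ => integrable_finsetSum _ fun j _ => hint i j]
    simp only [dotProduct, Matrix.mulVec, Finset.mul_sum]
    refine Finset.sum_congr rfl fun i _ => ?_
    rw [integral_finsetSum _ fun j _ => hint i j]
    refine Finset.sum_congr rfl fun j _ => ?_
    rw [integral_const_mul, integral_const_mul]
    simp only [S, Matrix.of_apply]
    ring
  have hS : S.PosSemidef := by
    refine Matrix.PosSemidef.of_dotProduct_mulVec_nonneg ?_ fun x => ?_
    · ext i j
      simp only [Matrix.conjTranspose_apply, star_trivial, S, Matrix.of_apply]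
      simp_rw [mul_comm]
    · rw [star_trivial, hquad]
      exact integral_nonneg fun ω => sq_nonneg _
  let μ : ℕ → ProbabilityMeasure (EuclideanSpace ℝ s) := fun n =>
    ⟨P.map (Z n), Measure.isProbabilityMeasure_map (hZm n).aemeasurable⟩
  let μ₀ : ProbabilityMeasure (EuclideanSpace ℝ s) := ⟨multivariateGaussian 0 S, inferInstance⟩
  have hinner : ∀ n ω t, ⟪Z n ω, t⟫ = ⟪inc t, G n ω⟫ := by
    intro n ω t
    simp only [inc, sum_inner, real_inner_smul_left, PiLp.inner_apply, Z]
    rfl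
  -- By Lévy's continuity theorem and the Cramér–Wold device: the characteristic function of `Z n`
  -- at `t` is that of the scalar `⟪inc t, G n⟫` at `1`, for which `hclt` gives the limit.
  have hweak : Tendsto μ atTop (𝓝 μ₀) := by
    rw [ProbabilityMeasure.tendsto_iff_tendsto_charFun]
    intro t
    have e1 : ∀ n, charFun (μ n : Measure (EuclideanSpace ℝ s)) t =
        ∫ ω, Complex.exp ((⟪inc t, G n ω⟫ : ℝ) * Complex.I) ∂P := by
      intro n
      simp only [μ, ProbabilityMeasure.coe_mk, charFun_apply]
      rw [integral_map (hZm n).aemeasurable (Measurable.aestronglyMeasurable (by fun_prop))]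
      simp_rw [hinner]
    have e2 : charFun (μ₀ : Measure (EuclideanSpace ℝ s)) t =
        Complex.exp (-(((∫ ω, ⟪inc t, D ω⟫ ^ 2 ∂P) / 2 : ℝ) : ℂ)) := by
      simp only [μ₀, ProbabilityMeasure.coe_mk]
      rw [charFun_multivariateGaussian hS, inner_zero_right, hquad]
      congr 1
      push_cast
      ring
    simp_rw [e1, e2]
    exact hclt _
  set V : ℝ := ∑ i : s, ∫ ω, ⟪b i, D ω⟫ ^ 2 ∂P with hV
  have hnormZ : ∀ n ω, ‖Z n ω‖ ^ 2 = ∑ i : s, ⟪b i, G n ω⟫ ^ 2 := by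
    intro n ω
    rw [EuclideanSpace.norm_sq_eq]
    simp [Z]
  have hi : ∀ n, 1 ≤ n → Integrable (fun z => ‖z‖ ^ 2) (μ n : Measure (EuclideanSpace ℝ s)) := by
    intro n hn
    simp only [μ, ProbabilityMeasure.coe_mk]
    rw [integrable_map_measure (Measurable.aestronglyMeasurable (by fun_prop))
      (hZm n).aemeasurable]
    simp only [Function.comp_def, hnormZ]
    exact integrable_finsetSum _ fun i _ => (hGL n hn _).integrable_sq
  have hVn : ∀ n, 1 ≤ n → ∫ z, ‖z‖ ^ 2 ∂(μ n : Measure (EuclideanSpace ℝ s)) = V := by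
    intro n hn
    simp only [μ, ProbabilityMeasure.coe_mk]
    rw [integral_map (hZm n).aemeasurable (Measurable.aestronglyMeasurable (by fun_prop))]
    simp only [hnormZ]
    rw [integral_finsetSum _ fun i _ => (hGL n hn _).integrable_sq]
    exact Finset.sum_congr rfl fun i _ => hGD n hn _
  have hcoord : ∀ i : s, MeasurePreserving (fun x : EuclideanSpace ℝ s => x.ofLp i)
      (multivariateGaussian 0 S) (gaussianReal 0 (S i i).toNNReal) := fun i => by
    simpa using measurePreserving_eval_multivariateGaussian (μ := 0) hS (i := i)
  have hsqi : ∀ v : ℝ≥0, Integrable (fun x : ℝ => x ^ 2) (gaussianReal 0 v) := fun v =>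
    (memLp_id_gaussianReal (μ := 0) (v := v) 2).integrable_sq
  have hsq : ∀ v : ℝ≥0, ∫ x : ℝ, x ^ 2 ∂(gaussianReal 0 v) = v := fun v => by
    have h1 := variance_eq_sub (memLp_id_gaussianReal (μ := 0) (v := v) 2)
    rw [variance_id_gaussianReal] at h1
    simp only [Pi.pow_apply, id_eq, integral_id_gaussianReal] at h1
    rw [h1]; ring
  have hcoordi : ∀ i : s, Integrable (fun z : EuclideanSpace ℝ s => z.ofLp i ^ 2)
      (multivariateGaussian 0 S) := fun i => (hcoord i).integrable_comp_of_integrable (hsqi _)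
  have hi₀ : Integrable (fun z => ‖z‖ ^ 2) (μ₀ : Measure (EuclideanSpace ℝ s)) := by
    simp only [μ₀, ProbabilityMeasure.coe_mk, EuclideanSpace.norm_sq_eq, Real.norm_eq_abs, sq_abs]
    exact integrable_finsetSum _ fun i _ => hcoordi i
  have hV₀ : ∫ z, ‖z‖ ^ 2 ∂(μ₀ : Measure (EuclideanSpace ℝ s)) = V := by
    simp only [μ₀, ProbabilityMeasure.coe_mk, EuclideanSpace.norm_sq_eq, Real.norm_eq_abs, sq_abs]
    rw [integral_finsetSum _ fun i _ => hcoordi i]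
    refine Finset.sum_congr rfl fun i _ => ?_
    have h1 := (hcoord i).map_eq
    have h2 : ∫ z : EuclideanSpace ℝ s, z.ofLp i ^ 2 ∂(multivariateGaussian 0 S) =
        ∫ x : ℝ, x ^ 2 ∂(gaussianReal 0 (S i i).toNNReal) := by
      rw [← h1, integral_map (hcoord i).measurable.aemeasurable
        (Measurable.aestronglyMeasurable (by fun_prop))]
    rw [h2, hsq, Real.coe_toNNReal]
    · simp only [S, Matrix.of_apply, sq]
    · simp only [S, Matrix.of_apply, ← sq]
      exact integral_nonneg fun ω => sq_nonneg _
  -- Since `inc` is a linear isometry, `N n ∘ inc` is again 1-Lipschitz and vanishes at the origin.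
  have hfin := tendsto_integral_sq_of_lipschitz (N := fun n z => N n (inc z))
    (N₀ := fun z => N₀ (inc z)) hweak
    (eventually_atTop.2 ⟨1, hi⟩) (eventually_atTop.2 ⟨1, hVn⟩) hi₀ hV₀
    (fun n z w => (hN n _ _).trans (by rw [hinc_sub, hinc_norm]))
    (fun n => by simp [inc, hNz]) (fun z => hN₀ _)
  refine ⟨_, hfin.congr fun n => ?_⟩
  have hNc : Continuous (N n) :=
    (LipschitzWith.of_dist_le_mul (K := 1) fun z w => by
      simpa [Real.dist_eq, dist_eq_norm] using hN n z w).continuous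
  have hincc : Continuous inc := by fun_prop
  have hm : AEStronglyMeasurable (fun z => N n (inc z) ^ 2) (P.map (Z n)) :=
    ((hNc.comp hincc).pow 2).measurable.aestronglyMeasurable
  simp only [μ, ProbabilityMeasure.coe_mk]
  rw [integral_map (hZm n).aemeasurable hm]
  simp_rw [hincZ]

/-- Convergence of the second moments of `1`-Lipschitz, pointwise convergent functions of
asymptotically Gaussian random vectors. -/
theorem exists_tendsto_lintegral_sq [CompleteSpace H] {D : Ω → H} (hD : Measurable D)
    (hD2 : ∫⁻ ω, ‖D ω‖ₑ ^ 2 ∂P ≠ ∞)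
    {G : ℕ → Ω → H} (hG : ∀ n, Measurable (G n))
    (hcov : ∀ n, 1 ≤ n → SameCovariance P (G n) D)
    (hclt : ∀ h : H, Tendsto (fun n => ∫ ω, Complex.exp ((⟪h, G n ω⟫ : ℝ) * Complex.I) ∂P) atTop
      (𝓝 (Complex.exp (-(((∫ ω, ⟪h, D ω⟫ ^ 2 ∂P) / 2 : ℝ) : ℂ)))))
    {N : ℕ → H → ℝ} (hN : ∀ n z w, |N n z - N n w| ≤ ‖z - w‖) (hNz : ∀ n, N n 0 = 0)
    (hlim : ∀ z, ∃ l, Tendsto (fun n => N n z) atTop (𝓝 l))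
    {G' : ℕ → Ω → H} (hG' : ∀ n, Measurable (G' n))
    (hdiff : Tendsto (fun n => ∫⁻ ω, ‖G' n ω - G n ω‖ₑ ^ 2 ∂P) atTop (𝓝 0)) :
    ∃ L : ℝ≥0, Tendsto (fun n => ∫⁻ ω, ‖N n (G' n ω)‖ₑ ^ 2 ∂P) atTop (𝓝 (L : ℝ≥0∞)) := by
  classical
  obtain ⟨w, b, -⟩ := exists_hilbertBasis ℝ H
  have hNc : ∀ n, Continuous (N n) := fun n =>
    (LipschitzWith.of_dist_le_mul (K := 1) fun z w => by
      simpa [Real.dist_eq, dist_eq_norm] using hN n z w).continuous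
  set a : ℕ → ℝ≥0∞ := fun n => eLpNorm (fun ω => N n (G' n ω)) 2 P with ha
  have hpr : ∀ (s : Finset w) n, Measurable fun ω => ∑ j ∈ s, ⟪b j, G n ω⟫ • b j := by
    intro s n
    have := hG n
    fun_prop
  -- tails of the expansion
  have htail : Tendsto (fun s : Finset w =>
      ∑' i : {i // i ∉ s}, ∫⁻ ω, ENNReal.ofReal (⟪b i, D ω⟫ ^ 2) ∂P) atTop (𝓝 0) :=
    ENNReal.tendsto_tsum_compl_atTop_zero (by rwa [← lintegral_enorm_sq_eq_tsum P hD b])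
  -- Being eventually `ε`-close to some number, for each `ε`, makes `a` Cauchy. The budget is `ε /
  -- 4` for replacing `G'` by `G`, `ε / 4` for cutting the expansion to `s`, and `ε / 4` for the
  -- finite-dimensional limit.
  have hclose : ∀ ε : ℝ, 0 < ε → ∃ l : ℝ, ∀ᶠ n in atTop, a n ≠ ∞ ∧ |(a n).toReal - l| ≤ ε := by
    intro ε hε
    obtain ⟨s, hs⟩ := (htail.eventually (gt_mem_nhds
      (show (0 : ℝ≥0∞) < ENNReal.ofReal (ε / 4) ^ 2 by positivity))).exists
    obtain ⟨l, hl⟩ := tendsto_integral_sq_comp_sum hD hD2 hG hcov hclt hN hNz hlim b s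
    have hl' := (Real.continuous_sqrt.tendsto l).comp hl
    refine ⟨√l, ?_⟩
    filter_upwards [Metric.tendsto_nhds.1 hl' (ε / 4) (by positivity), eventually_ge_atTop 1,
      hdiff.eventually (gt_mem_nhds
        (show (0 : ℝ≥0∞) < ENNReal.ofReal (ε / 4) ^ 2 by positivity))] with n h1 h2 h3
    have hdif : eLpNorm (fun ω => G' n ω - G n ω) 2 P ≤ ENNReal.ofReal (ε / 4) := by
      rw [← eLpNorm_two_sq] at h3
      exact le_of_not_gt fun hgt => absurd h3 (not_lt.2 (pow_le_pow_left' hgt.le 2))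
    have htl : eLpNorm (fun ω => G n ω - ∑ j ∈ s, ⟪b j, G n ω⟫ • b j) 2 P ≤
        ENNReal.ofReal (ε / 4) := by
      rw [← (hcov n h2).lintegral_enorm_sub_sum_sq (hG n) b s, ← eLpNorm_two_sq] at hs
      exact le_of_not_gt fun hgt => absurd hs (not_lt.2 (pow_le_pow_left' hgt.le 2))
    set y : ℝ≥0∞ := eLpNorm (fun ω => N n (∑ j ∈ s, ⟪b j, G n ω⟫ • b j)) 2 P with hy
    have hd : eLpNorm (fun ω => N n (G' n ω) - N n (∑ j ∈ s, ⟪b j, G n ω⟫ • b j)) 2 P ≤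
        ENNReal.ofReal (ε / 2) := by
      calc eLpNorm (fun ω => N n (G' n ω) - N n (∑ j ∈ s, ⟪b j, G n ω⟫ • b j)) 2 P
          ≤ eLpNorm (fun ω => G' n ω - ∑ j ∈ s, ⟪b j, G n ω⟫ • b j) 2 P :=
            eLpNorm_mono fun ω => hN n _ _
        _ = eLpNorm ((fun ω => G' n ω - G n ω) +
              fun ω => G n ω - ∑ j ∈ s, ⟪b j, G n ω⟫ • b j) 2 P := by
            congr 1; ext ω; simp
        _ ≤ _ := eLpNorm_add_le ((hG' n).sub (hG n)).aestronglyMeasurable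
            ((hG n).sub (hpr s n)).aestronglyMeasurable (by norm_num)
        _ ≤ ENNReal.ofReal (ε / 4) + ENNReal.ofReal (ε / 4) := add_le_add hdif htl
        _ = ENNReal.ofReal (ε / 2) := by
            rw [← ENNReal.ofReal_add (by positivity) (by positivity)]; congr 1; ring
    have m1 : AEStronglyMeasurable (fun ω => N n (G' n ω)) P :=
      ((hNc n).measurable.comp (hG' n)).aestronglyMeasurable
    have m2 : AEStronglyMeasurable (fun ω => N n (∑ j ∈ s, ⟪b j, G n ω⟫ • b j)) P :=
      ((hNc n).measurable.comp (hpr s n)).aestronglyMeasurable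
    have hay : a n ≤ y + ENNReal.ofReal (ε / 2) := by
      have := eLpNorm_add_le m2 (m1.sub m2) (p := 2) (by norm_num)
      have e : (fun ω => N n (∑ j ∈ s, ⟪b j, G n ω⟫ • b j)) +
          ((fun ω => N n (G' n ω)) - fun ω => N n (∑ j ∈ s, ⟪b j, G n ω⟫ • b j)) =
          fun ω => N n (G' n ω) := by ext ω; simp
      rw [e] at this
      exact this.trans (add_le_add le_rfl hd)
    have hya : y ≤ a n + ENNReal.ofReal (ε / 2) := by
      have := eLpNorm_sub_le m1 (m1.sub m2) (p := 2) (by norm_num)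
      have e : (fun ω => N n (G' n ω)) -
          ((fun ω => N n (G' n ω)) - fun ω => N n (∑ j ∈ s, ⟪b j, G n ω⟫ • b j)) =
          fun ω => N n (∑ j ∈ s, ⟪b j, G n ω⟫ • b j) := by ext ω; simp
      rw [e] at this
      exact this.trans (add_le_add le_rfl hd)
    have hpy : MemLp (fun ω => N n (∑ j ∈ s, ⟪b j, G n ω⟫ • b j)) 2 P := by
      have hGn : MemLp (fun ω => ∑ j ∈ s, ⟪b j, G n ω⟫ • b j) 2 P := by
        have hg : MemLp (G n) 2 P := by
          refine ⟨(hG n).aestronglyMeasurable, ?_⟩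
          have h5 : ∫⁻ ω, ‖G n ω‖ₑ ^ 2 ∂P = ∫⁻ ω, ‖D ω‖ₑ ^ 2 ∂P := by
            rw [lintegral_enorm_sq_eq_tsum P (hG n) b, lintegral_enorm_sq_eq_tsum P hD b]
            exact tsum_congr fun i => hcov n h2 _
          rw [lt_top_iff_ne_top]
          intro htop
          apply hD2
          rw [← h5, ← eLpNorm_two_sq, htop]; rfl
        refine memLp_finsetSum _ fun i _ => ?_
        have h6 : MemLp (fun ω => ⟪(b i : H), G n ω⟫) 2 P := hg.const_inner _
        exact (ContinuousLinearMap.toSpanSingleton ℝ (b i : H)).comp_memLp' h6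
      refine hGn.mono m2 (ae_of_all _ fun ω => ?_)
      have := hN n (∑ j ∈ s, ⟪b j, G n ω⟫ • b j) 0
      rwa [hNz, sub_zero, sub_zero] at this
    have hyfin : y ≠ ∞ := hpy.2.ne
    have hafin : a n ≠ ∞ := ne_top_of_le_ne_top (by finiteness) hay
    have hyr : y.toReal = √(∫ ω, N n (∑ j ∈ s, ⟪b j, G n ω⟫ • b j) ^ 2 ∂P) := by
      rw [eq_comm, Real.sqrt_eq_iff_eq_sq (integral_nonneg fun ω => sq_nonneg _)
        ENNReal.toReal_nonneg, ← ENNReal.toReal_pow, hy, eLpNorm_two_sq,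
        integral_eq_lintegral_of_nonneg_ae (ae_of_all _ fun ω => sq_nonneg _)
          hpy.integrable_sq.aestronglyMeasurable]
      congr 1
      refine lintegral_congr fun ω => ?_
      rw [← Real.enorm_of_nonneg (sq_nonneg _), enorm_pow]
    have r1 : (a n).toReal ≤ y.toReal + ε / 2 := by
      have := ENNReal.toReal_mono (by finiteness) hay
      rwa [ENNReal.toReal_add hyfin (by finiteness), ENNReal.toReal_ofReal (by positivity)] at this
    have r2 : y.toReal ≤ (a n).toReal + ε / 2 := by
      have := ENNReal.toReal_mono (by finiteness) hya
      rwa [ENNReal.toReal_add hafin (by finiteness), ENNReal.toReal_ofReal (by positivity)] at this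
    refine ⟨hafin, ?_⟩
    simp only [Function.comp_apply, Real.dist_eq] at h1
    rw [← hyr, abs_lt] at h1
    rw [abs_le]
    constructor <;> linarith [h1.1, h1.2]
  have hcau : CauchySeq fun n => (a n).toReal := by
    refine Metric.cauchySeq_iff'.2 fun ε hε => ?_
    obtain ⟨l, hl⟩ := hclose (ε / 3) (by positivity)
    obtain ⟨M, hM⟩ := eventually_atTop.1 hl
    refine ⟨M, fun n hn => ?_⟩
    have h1 := abs_le.1 (hM n hn).2
    have h2 := abs_le.1 (hM M le_rfl).2
    rw [Real.dist_eq, abs_lt]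
    constructor <;> linarith [h1.1, h1.2, h2.1, h2.2]
  obtain ⟨l, hl⟩ := cauchySeq_tendsto_of_complete hcau
  obtain ⟨_, hl1⟩ := hclose 1 one_pos
  have h2 := (ENNReal.continuous_ofReal.tendsto _).comp (hl.pow 2)
  refine ⟨(l ^ 2).toNNReal, h2.congr' ?_⟩
  filter_upwards [hl1] with n hn
  simp only [Function.comp_apply]
  rw [ENNReal.ofReal_pow ENNReal.toReal_nonneg, ENNReal.ofReal_toReal hn.1, ha, eLpNorm_two_sq]

end HilbertCLT

/-! ### Power series with nonnegative coefficients and exponential moments -/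

section PosSeries

/-- `f` is the sum, on `(-ρ, ρ)`, of a power series with nonnegative coefficients. -/
def PosSeries (ρ : ℝ) (f : ℝ → ℝ) : Prop :=
  ∃ a : ℕ → ℝ, (∀ n, 0 ≤ a n) ∧ ∀ z, |z| < ρ → HasSum (fun n => a n * z ^ n) (f z)

lemma hasSum_prod_of_abs {f : ℕ × ℕ → ℝ} {g G : ℕ → ℝ} {S : ℝ}
    (hG : ∀ n, HasSum (fun j => |f (n, j)|) (G n)) (hGs : Summable G)
    (hg : ∀ n, HasSum (fun j => f (n, j)) (g n)) (hS : HasSum g S) : HasSum f S := by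
  have h1 : Summable fun p => |f p| := by
    rw [summable_prod_of_nonneg fun p => abs_nonneg _]
    refine ⟨fun n => (hG n).summable, ?_⟩
    simpa [fun n => (hG n).tsum_eq] using hGs
  have h2 : Summable f := h1.of_abs
  have h3 := h2.hasSum.prod_fiberwise hg
  have h4 := h2.hasSum
  rwa [h3.unique hS] at h4

namespace PosSeries

variable {ρ : ℝ} {f g : ℝ → ℝ}

/-- Collect terms of equal exponent. Evaluation at `ρ / 2` shows that the coefficients sharing an
exponent are summable, and nonnegativity passes to their sums. -/
lemma of_index {ι : Type*} {a : ι → ℝ} (ha : ∀ i, 0 ≤ a i) (d : ι → ℕ)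
    (h : ∀ z, |z| < ρ → HasSum (fun i => a i * z ^ d i) (f z)) : PosSeries ρ f := by
  rcases le_or_gt ρ 0 with hρ | hρ
  · exact ⟨0, fun n => le_rfl, fun z hz => absurd hz (not_lt.2 (hρ.trans (abs_nonneg z)))⟩
  have hfib : ∀ n, Summable fun i : {i // d i = n} => a i := by
    intro n
    have h1 := (h (ρ / 2) (by rw [abs_of_pos (by positivity)]; linarith)).summable
    have h2 := (h1.subtype {i | d i = n}).mul_right ((ρ / 2) ^ n)⁻¹
    refine h2.congr fun i => ?_
    have : d i.1 = n := i.2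
    simp only [Function.comp_apply, this]
    field_simp
  refine ⟨fun n => ∑' i : {i // d i = n}, a i, fun n => tsum_nonneg fun i => ha _, fun z hz => ?_⟩
  have h1 := (Equiv.sigmaFiberEquiv d).hasSum_iff.2 (h z hz)
  refine h1.sigma fun n => ?_
  have h2 := (hfib n).hasSum.mul_right (z ^ n)
  refine h2.congr_fun fun i => ?_
  simp [Equiv.sigmaFiberEquiv, i.2]

/-- With nonnegative coefficients, the absolute values of the terms at `z` are the terms at `|z|`.
Convergence at `|z|` is thus absolute convergence of the double series. -/
lemma of_double {g : ℕ → ℝ → ℝ} (hg : ∀ n, PosSeries ρ (g n))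
    (hs : ∀ z, |z| < ρ → HasSum (fun n => g n z) (f z)) : PosSeries ρ f := by
  choose a ha hsum using hg
  refine of_index (ι := ℕ × ℕ) (a := fun p => a p.1 p.2) (fun p => ha _ _) (fun p => p.2)
    fun z hz => ?_
  refine hasSum_prod_of_abs (G := fun n => g n |z|) (fun n => ?_) (hs |z| (by rwa [abs_abs])).summable
    (fun n => hsum n z hz) (hs z hz)
  refine (hsum n |z| (by rwa [abs_abs])).congr_fun fun j => ?_
  rw [abs_mul, abs_of_nonneg (ha _ _), abs_pow]

lemma const (ρ : ℝ) {c : ℝ} (hc : 0 ≤ c) : PosSeries ρ fun _ => c := by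
  refine ⟨fun n => if n = 0 then c else 0, fun n => by dsimp only; split_ifs <;> simp [hc], fun z _ => ?_⟩
  refine (hasSum_ite_eq 0 c).congr_fun fun n => ?_
  by_cases h : n = 0 <;> simp [h]

lemma congr (hf : PosSeries ρ f) (h : ∀ z, |z| < ρ → f z = g z) : PosSeries ρ g := by
  obtain ⟨a, ha, hs⟩ := hf
  exact ⟨a, ha, fun z hz => h z hz ▸ hs z hz⟩

lemma add (hf : PosSeries ρ f) (hg : PosSeries ρ g) : PosSeries ρ fun z => f z + g z := by
  obtain ⟨a, ha, hs⟩ := hf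
  obtain ⟨a', ha', hs'⟩ := hg
  refine ⟨fun n => a n + a' n, fun n => add_nonneg (ha n) (ha' n), fun z hz => ?_⟩
  exact ((hs z hz).add (hs' z hz)).congr_fun fun n => by ring

lemma const_mul {c : ℝ} (hc : 0 ≤ c) (hf : PosSeries ρ f) : PosSeries ρ fun z => c * f z := by
  obtain ⟨a, ha, hs⟩ := hf
  refine ⟨fun n => c * a n, fun n => mul_nonneg hc (ha n), fun z hz => ?_⟩
  exact ((hs z hz).mul_left c).congr_fun fun n => by ring

lemma mul (hf : PosSeries ρ f) (hg : PosSeries ρ g) : PosSeries ρ fun z => f z * g z := by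
  obtain ⟨a, ha, hs⟩ := hf
  obtain ⟨a', ha', hs'⟩ := hg
  refine of_index (ι := ℕ × ℕ) (a := fun p => a p.1 * a' p.2) (fun p => mul_nonneg (ha _) (ha' _))
    (fun p => p.1 + p.2) fun z hz => ?_
  have hz' : |(|z|)| < ρ := by rwa [abs_abs]
  refine hasSum_prod_of_abs (G := fun n => a n * |z| ^ n * g |z|) (g := fun n => a n * z ^ n * g z)
    (fun n => ?_) ((hs |z| hz').mul_right _).summable (fun n => ?_) ((hs z hz).mul_right _)
  · refine ((hs' |z| hz').mul_left _).congr_fun fun j => ?_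
    rw [abs_mul, abs_of_nonneg (mul_nonneg (ha _) (ha' _)), abs_pow]
    ring
  · exact ((hs' z hz).mul_left _).congr_fun fun j => by ring

lemma pow (hf : PosSeries ρ f) (n : ℕ) : PosSeries ρ fun z => f z ^ n := by
  induction n with
  | zero => simpa using const ρ zero_le_one
  | succ n ih => simpa [pow_succ] using ih.mul hf

lemma exp (hf : PosSeries ρ f) : PosSeries ρ fun z => Real.exp (f z) := by
  refine of_double (g := fun n z => (n.factorial : ℝ)⁻¹ * f z ^ n)
    (fun n => (hf.pow n).const_mul (by positivity)) fun z _ => ?_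
  have := NormedSpace.expSeries_div_hasSum_exp (f z)
  rw [← Real.exp_eq_exp_ℝ] at this
  exact this.congr_fun fun n => by rw [div_eq_inv_mul]

/-- Integrals of power series with nonnegative coefficients depending on a parameter. -/
lemma integral {α ι : Type*} [MeasurableSpace α] {m : Measure α} [Countable ι] {a : ι → α → ℝ}
    (ha : ∀ i, AEStronglyMeasurable (a i) m) (hnn : ∀ i, ∀ᵐ x ∂m, 0 ≤ a i x) (d : ι → ℕ)
    {F : α → ℝ → ℝ} (hsum : ∀ z, |z| < ρ → ∀ᵐ x ∂m, HasSum (fun i => a i x * z ^ d i) (F x z))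
    (hfin : ∀ θ, 0 ≤ θ → θ < ρ → ∫⁻ x, ENNReal.ofReal (F x θ) ∂m < ∞) :
    PosSeries ρ (fun z => ∫ x, F x z ∂m) := by
  rcases le_or_gt ρ 0 with hρ | hρ
  · exact ⟨0, fun n => le_rfl, fun z hz => absurd hz (not_lt.2 (hρ.trans (abs_nonneg z)))⟩
  refine of_index (a := fun i => ∫ x, a i x ∂m) (fun i => integral_nonneg_of_ae (hnn i)) d
    fun z hz => ?_
  have hz' : |(|z|)| < ρ := by rwa [abs_abs]
  have hnn' : ∀ᵐ x ∂m, ∀ i, 0 ≤ a i x := ae_all_iff.2 hnn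
  have h1 : ∑' i, ∫⁻ x, ENNReal.ofReal (a i x * |z| ^ d i) ∂m =
      ∫⁻ x, ENNReal.ofReal (F x |z|) ∂m := by
    rw [← lintegral_tsum fun i => ((ha i).aemeasurable.mul_const _).ennreal_ofReal]
    refine lintegral_congr_ae ?_
    filter_upwards [hsum _ hz', hnn'] with x hx hx'
    rw [← ENNReal.ofReal_tsum_of_nonneg (fun i => mul_nonneg (hx' i) (by positivity)) hx.summable,
      hx.tsum_eq]
  have h1' := (h1 ▸ hfin |z| (abs_nonneg z) (by simpa using hz)).ne
  have hnorm : ∀ i, ∫⁻ x, ‖a i x * z ^ d i‖ₑ ∂m = ∫⁻ x, ENNReal.ofReal (a i x * |z| ^ d i) ∂m := by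
    intro i
    refine lintegral_congr_ae ?_
    filter_upwards [hnn i] with x hx
    rw [← ofReal_norm, norm_mul, norm_pow, Real.norm_eq_abs, Real.norm_eq_abs, abs_of_nonneg hx]
  have hint : ∀ i, Integrable (fun x => a i x * z ^ d i) m := by
    intro i
    refine ⟨(ha i).mul_const _, ?_⟩
    rw [hasFiniteIntegral_iff_enorm, hnorm i]
    exact lt_of_le_of_lt (ENNReal.le_tsum i) h1'.lt_top
  have hs : Summable fun i => ∫ x, ‖a i x * z ^ d i‖ ∂m := by
    have : ∀ i, ∫ x, ‖a i x * z ^ d i‖ ∂m =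
        (∫⁻ x, ENNReal.ofReal (a i x * |z| ^ d i) ∂m).toReal := by
      intro i
      rw [integral_norm_eq_lintegral_enorm (hint i).aestronglyMeasurable, hnorm i]
    simp_rw [this]
    exact ENNReal.summable_toReal h1'
  have h2 := hasSum_integral_of_summable_integral_norm hint hs
  have h3 : ∫ x, ∑' i, a i x * z ^ d i ∂m = ∫ x, F x z ∂m := by
    refine integral_congr_ae ?_
    filter_upwards [hsum z hz] with x hx
    exact hx.tsum_eq
  rw [h3] at h2
  exact h2.congr_fun fun i => by rw [integral_mul_const]

/-- Analyticity near `0` and uniqueness of power series identify the coefficients, for which the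
smaller ball of radius `ρ / 2` is enough. The expansion itself remains valid on all of `(-ρ, ρ)`. -/
lemma exists_iteratedDeriv (hf : PosSeries ρ f) (hρ : 0 < ρ) : AnalyticAt ℝ f 0 ∧
    (∀ n, 0 ≤ iteratedDeriv n f 0) ∧
    ∀ z, |z| < ρ → HasSum (fun n => iteratedDeriv n f 0 / n.factorial * z ^ n) (f z) := by
  obtain ⟨a, ha, hs⟩ := hf
  have hp : HasFPowerSeriesOnBall f (FormalMultilinearSeries.ofScalars ℝ a) 0
      (ENNReal.ofReal (ρ / 2)) := by
    refine ⟨?_, by simpa using hρ, ?_⟩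
    · rw [ENNReal.ofReal]
      refine FormalMultilinearSeries.le_radius_of_summable _ ?_
      have h1 := (hs (ρ / 2) (by rw [abs_of_pos (by positivity)]; linarith)).summable
      refine h1.congr fun n => ?_
      rw [FormalMultilinearSeries.ofScalars_norm, Real.norm_eq_abs, abs_of_nonneg (ha n),
        Real.coe_toNNReal _ (by positivity)]
    · intro y hy
      have hy' : |y| < ρ := by
        rw [Metric.mem_eball, edist_zero_right, ← ofReal_norm, ENNReal.ofReal_lt_ofReal_iff
          (by positivity), Real.norm_eq_abs] at hy
        linarith
      simpa [FormalMultilinearSeries.ofScalars_apply_eq, mul_comm] using hs y hy'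
  have han : AnalyticAt ℝ f 0 := hp.analyticAt
  have heq := (hp.hasFPowerSeriesAt).eq_formalMultilinearSeries han.hasFPowerSeriesAt
  have hc : ∀ n, a n = iteratedDeriv n f 0 / n.factorial := by
    intro n
    have := congrArg (fun p : FormalMultilinearSeries ℝ ℝ ℝ => p.coeff n) heq
    simpa [FormalMultilinearSeries.coeff_ofScalars] using this
  refine ⟨han, fun n => ?_, fun z hz => ?_⟩
  · have h1 := hc n
    rw [eq_div_iff (by positivity)] at h1
    rw [← h1]
    exact mul_nonneg (ha n) (by positivity)
  · exact (hs z hz).congr_fun fun n => by rw [hc]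

/-- A nonnegative random variable whose Laplace transform extends to a power series with
nonnegative coefficients in the variable `-l` has exponential moments. -/
theorem integrable_exp {Ω : Type*} [MeasurableSpace Ω] {μ : Measure Ω} [IsProbabilityMeasure μ]
    {Y : Ω → ℝ} (hY : Measurable Y) (hY0 : ∀ ω, 0 ≤ Y ω) (hf : PosSeries ρ f)
    (h : ∀ z, -ρ < z → z ≤ 0 → ∫ ω, Real.exp (z * Y ω) ∂μ = f z) {θ : ℝ} (hθ : θ < ρ) :
    Integrable (fun ω => Real.exp (θ * Y ω)) μ := by
  have hle : ∀ t ≤ 0, Integrable (fun ω => Real.exp (t * Y ω)) μ := by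
    intro t ht
    refine Integrable.mono' (integrable_const 1) (by fun_prop) (ae_of_all _ fun ω => ?_)
    rw [Real.norm_eq_abs, Real.abs_exp, Real.exp_le_one_iff]
    exact mul_nonpos_of_nonpos_of_nonneg ht (hY0 ω)
  rcases le_or_gt θ 0 with hθ0 | hθ0
  · exact hle θ hθ0
  have hρ : 0 < ρ := hθ0.trans hθ
  obtain ⟨han, hnn, hs⟩ := hf.exists_iteratedDeriv hρ
  have hint : ∀ t < 0, t ∈ interior (integrableExpSet Y μ) := by
    intro t ht
    have : Iio (0 : ℝ) ⊆ interior (integrableExpSet Y μ) :=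
      interior_maximal (fun x hx => hle x (le_of_lt hx)) isOpen_Iio
    exact this ht
  -- For `t < 0` the tilted moments are derivatives of the moment generating function, which
  -- coincides with `f` near `t`. Letting `t ↑ 0`, Fatou's lemma bounds the moments by the
  -- derivatives of `f` at `0`; summing the exponential series in `θ` then gives the claim.
  have hmom : ∀ n : ℕ, ∫⁻ ω, ENNReal.ofReal (Y ω ^ n) ∂μ ≤ ENNReal.ofReal (iteratedDeriv n f 0) := by
    intro n
    have hd : ∀ t, -ρ < t → t < 0 →
        ∫⁻ ω, ENNReal.ofReal (Y ω ^ n * Real.exp (t * Y ω)) ∂μ =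
          ENNReal.ofReal (iteratedDeriv n f t) := by
      intro t ht1 ht2
      have e1 : mgf Y μ =ᶠ[𝓝 t] f := by
        filter_upwards [Ioo_mem_nhds ht1 ht2] with x hx
        exact h x hx.1 hx.2.le
      rw [← e1.iteratedDeriv_eq n, iteratedDeriv_mgf (hint t ht2),
        ofReal_integral_eq_lintegral_ofReal]
      · exact integrable_pow_mul_exp_of_mem_interior_integrableExpSet (hint t ht2) n
      · exact ae_of_all _ fun ω => mul_nonneg (pow_nonneg (hY0 ω) n) (Real.exp_nonneg _)
    -- The shift by `2` keeps every `t k` strictly inside `(-ρ, 0)`.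
    set t : ℕ → ℝ := fun k => -(ρ / (k + 2)) with ht
    have ht0 : Tendsto t atTop (𝓝 0) := by
      rw [← neg_zero]
      exact ((tendsto_const_nhds (x := ρ)).div_atTop
        (tendsto_atTop_add_const_right _ _ tendsto_natCast_atTop_atTop)).neg
    have ht1 : ∀ k, -ρ < t k ∧ t k < 0 := by
      intro k
      simp only [ht]
      have : ρ / ((k : ℝ) + 2) < ρ := by
        apply div_lt_self hρ
        have : (0 : ℝ) ≤ k := by positivity
        linarith
      exact ⟨by linarith, by simp; positivity⟩
    have hlim : Tendsto (fun k => ENNReal.ofReal (iteratedDeriv n f (t k))) atTop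
        (𝓝 (ENNReal.ofReal (iteratedDeriv n f 0))) := by
      have hc : ContinuousAt (iteratedDeriv n f) 0 := by
        rw [iteratedDeriv_eq_iterate]
        exact (han.iterated_deriv n).continuousAt
      exact (ENNReal.continuous_ofReal.tendsto _).comp (hc.tendsto.comp ht0)
    calc ∫⁻ ω, ENNReal.ofReal (Y ω ^ n) ∂μ
        = ∫⁻ ω, liminf (fun k => ENNReal.ofReal (Y ω ^ n * Real.exp (t k * Y ω))) atTop ∂μ := by
          refine lintegral_congr fun ω => ?_
          have hc : Continuous fun x : ℝ => ENNReal.ofReal (Y ω ^ n * Real.exp (x * Y ω)) :=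
            ENNReal.continuous_ofReal.comp (by fun_prop)
          have := (hc.tendsto 0).comp ht0
          simp only [zero_mul, Real.exp_zero, mul_one] at this
          exact this.liminf_eq.symm
      _ ≤ liminf (fun k => ∫⁻ ω, ENNReal.ofReal (Y ω ^ n * Real.exp (t k * Y ω)) ∂μ) atTop :=
          lintegral_liminf_le fun k => by fun_prop
      _ = liminf (fun k => ENNReal.ofReal (iteratedDeriv n f (t k))) atTop := by
          congr 1; ext k; exact hd _ (ht1 k).1 (ht1 k).2
      _ = ENNReal.ofReal (iteratedDeriv n f 0) := hlim.liminf_eq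
  refine ⟨by fun_prop, ?_⟩
  rw [hasFiniteIntegral_iff_ofReal (ae_of_all _ fun ω => Real.exp_nonneg _)]
  have hser : ∀ ω, ENNReal.ofReal (Real.exp (θ * Y ω)) =
      ∑' n : ℕ, ENNReal.ofReal (θ ^ n / n.factorial) * ENNReal.ofReal (Y ω ^ n) := by
    intro ω
    have h1 := NormedSpace.expSeries_div_hasSum_exp (θ * Y ω)
    rw [← Real.exp_eq_exp_ℝ] at h1
    have hY0' := hY0 ω
    rw [← h1.tsum_eq, ENNReal.ofReal_tsum_of_nonneg (fun n => by positivity) h1.summable]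
    refine tsum_congr fun n => ?_
    rw [← ENNReal.ofReal_mul (by positivity), mul_pow]
    congr 1; ring
  simp_rw [hser]
  rw [lintegral_tsum fun n => by fun_prop]
  have hθs := hs θ (by rwa [abs_of_pos hθ0])
  refine lt_of_le_of_lt (ENNReal.tsum_le_tsum
    (g := fun n : ℕ => ENNReal.ofReal (iteratedDeriv n f 0 / n.factorial * θ ^ n)) fun n => ?_) ?_
  · rw [lintegral_const_mul _ (by fun_prop)]
    refine (mul_le_mul_right (hmom n) _).trans (le_of_eq ?_)
    rw [← ENNReal.ofReal_mul (by positivity)]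
    congr 1; ring
  · rw [← ENNReal.ofReal_tsum_of_nonneg (fun n => mul_nonneg (div_nonneg (hnn n) (by positivity))
      (by positivity)) hθs.summable]
    exact ENNReal.ofReal_lt_top

end PosSeries

end PosSeries

/-! ### The cumulant semigroup and the immigration mechanism -/

namespace CBI

section Cumulant

variable {b c : ℝ}

lemma one_sub_exp_nonneg (hb : 0 < b) {s : ℝ} (hs : 0 ≤ s) : 0 ≤ 1 - Real.exp (-(b * s)) := by
  rw [sub_nonneg, Real.exp_le_one_iff]
  have := mul_nonneg hb.le hs
  linarith

lemma v_den_ge (hb : 0 < b) (hc : 0 < c) {s l : ℝ} (hs : 0 ≤ s) (hl : 0 ≤ l) :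
    1 ≤ 1 + c * l / b * (1 - Real.exp (-(b * s))) := by
  have := one_sub_exp_nonneg hb hs
  have : 0 ≤ c * l / b * (1 - Real.exp (-(b * s))) := by positivity
  linarith

lemma v_nonneg (hb : 0 < b) (hc : 0 < c) {s l : ℝ} (hs : 0 ≤ s) (hl : 0 ≤ l) : 0 ≤ v b c s l := by
  have := v_den_ge hb hc hs hl
  unfold v
  positivity

lemma v_le (hb : 0 < b) (hc : 0 < c) {s l : ℝ} (hs : 0 ≤ s) (hl : 0 ≤ l) :
    v b c s l ≤ Real.exp (-(b * s)) * l := by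
  have := v_den_ge hb hc hs hl
  exact div_le_self (by positivity) this

lemma v_le_self (hb : 0 < b) (hc : 0 < c) {s l : ℝ} (hs : 0 ≤ s) (hl : 0 ≤ l) : v b c s l ≤ l := by
  refine (v_le hb hc hs hl).trans (mul_le_of_le_one_left hl ?_)
  rw [Real.exp_le_one_iff]
  have := mul_nonneg hb.le hs
  linarith

/-- The flow property of the autonomous equation solved by `v`; here it is checked on the closed
form, two fractional linear maps being composed. -/
lemma v_add (hb : 0 < b) (hc : 0 < c) {s t l : ℝ} (hs : 0 ≤ s) (ht : 0 ≤ t) (hl : 0 ≤ l) :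
    v b c s (v b c t l) = v b c (s + t) l := by
  have h1 := v_den_ge hb hc ht hl
  have h2 := v_den_ge hb hc hs (v_nonneg hb hc ht hl)
  have h3 := v_den_ge hb hc (add_nonneg hs ht) hl
  have e : Real.exp (-(b * (s + t))) = Real.exp (-(b * s)) * Real.exp (-(b * t)) := by
    rw [← Real.exp_add]; congr 1; ring
  unfold v at *
  rw [e] at h3 ⊢
  set p := Real.exp (-(b * s))
  set q := Real.exp (-(b * t))
  have hd : 1 + c * (q * l / (1 + c * l / b * (1 - q))) / b * (1 - p) =
      (1 + c * l / b * (1 - p * q)) / (1 + c * l / b * (1 - q)) := by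
    rw [eq_div_iff (by linarith)]
    have : (1 + c * l / b * (1 - q)) ≠ 0 := by linarith
    have h4 : c * (q * l / (1 + c * l / b * (1 - q))) / b * (1 - p) * (1 + c * l / b * (1 - q)) =
        c * (q * l) / b * (1 - p) * ((1 + c * l / b * (1 - q)) / (1 + c * l / b * (1 - q))) := by
      ring
    rw [add_mul, h4, div_self this]
    ring
  rw [hd]
  have n1 : (1 + c * l / b * (1 - q)) ≠ 0 := by linarith
  have n2 : (1 + c * l / b * (1 - p * q)) ≠ 0 := by linarith
  rw [mul_div_assoc', div_div_div_cancel_right₀ n1]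
  ring

lemma measurable_v (b c : ℝ) : Measurable fun p : ℝ × ℝ => v b c p.1 p.2 := by
  unfold v
  fun_prop

lemma continuousOn_v (hb : 0 < b) (hc : 0 < c) :
    ContinuousOn (fun p : ℝ × ℝ => v b c p.1 p.2) (Ici 0 ×ˢ Ici 0) := by
  unfold v
  refine ContinuousOn.div (by fun_prop) (by fun_prop) fun p hp => ?_
  have := v_den_ge hb hc hp.1 hp.2
  linarith

lemma continuousOn_v_left (hb : 0 < b) (hc : 0 < c) {l : ℝ} (hl : 0 ≤ l) :
    ContinuousOn (fun s => v b c s l) (Ici 0) :=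
  (continuousOn_v hb hc).comp (f := fun s : ℝ => (s, l)) (by fun_prop) fun _ hs => ⟨hs, hl⟩

lemma tendsto_v_atTop (hb : 0 < b) (hc : 0 < c) {l : ℝ} (hl : 0 ≤ l) :
    Tendsto (fun s => v b c s l) atTop (𝓝 0) := by
  have h1 : Tendsto (fun s => Real.exp (-(b * s)) * l) atTop (𝓝 (0 * l)) := by
    refine Tendsto.mul_const _ (Real.tendsto_exp_neg_atTop_nhds_zero.comp ?_)
    exact tendsto_id.const_mul_atTop hb
  rw [zero_mul] at h1
  refine tendsto_of_tendsto_of_tendsto_of_le_of_le' tendsto_const_nhds h1 ?_ ?_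
  · filter_upwards [eventually_ge_atTop 0] with s hs using v_nonneg hb hc hs hl
  · filter_upwards [eventually_ge_atTop 0] with s hs using v_le hb hc hs hl

end Cumulant

/-! ### Growth and continuity of the immigration mechanism, and its integrability along the cumulant
flow. -/

section Immigration

variable {β : ℝ} {k : ℝ → ℝ}

lemma MemK.aestronglyMeasurable (hk : MemK k) :
    AEStronglyMeasurable k (volume.restrict (Ioi 0)) := by
  have h1 : AEStronglyMeasurable (fun z => k z * min z 1 * (min z 1)⁻¹)
      (volume.restrict (Ioi 0)) :=
    hk.integrable.aestronglyMeasurable.mul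
      (Measurable.aestronglyMeasurable (by fun_prop))
  refine h1.congr ?_
  filter_upwards [ae_restrict_mem measurableSet_Ioi] with z hz
  have : 0 < min z 1 := lt_min hz one_pos
  field_simp

lemma one_sub_exp_le_max {z u : ℝ} (hu : 0 < u) :
    1 - Real.exp (-(z * u)) ≤ max z 1 * min u 1 := by
  have h1 : 1 - Real.exp (-(z * u)) ≤ z * u := by
    have := Real.add_one_le_exp (-(z * u)); linarith
  have h2 : 1 - Real.exp (-(z * u)) ≤ 1 := by
    have := Real.exp_pos (-(z * u)); linarith
  rcases le_total u 1 with h | h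
  · rw [min_eq_left h]
    exact h1.trans (by gcongr; exact le_max_left _ _)
  · rw [min_eq_right h, mul_one]
    exact h2.trans (le_max_right _ _)

lemma one_sub_exp_mem {z u : ℝ} (hz : 0 ≤ z) (hu : 0 ≤ u) : 0 ≤ 1 - Real.exp (-(z * u)) := by
  rw [sub_nonneg, Real.exp_le_one_iff]
  have := mul_nonneg hz hu
  linarith

lemma MemK.norm_integrand_le (hk : MemK k) {z u : ℝ} (hz : 0 ≤ z) (hu : 0 < u) :
    ‖(1 - Real.exp (-(z * u))) * k u‖ ≤ max z 1 * (k u * min u 1) := by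
  have hku := hk.nonneg u hu
  rw [Real.norm_eq_abs, abs_of_nonneg (mul_nonneg (one_sub_exp_mem hz hu.le) hku)]
  calc (1 - Real.exp (-(z * u))) * k u ≤ max z 1 * min u 1 * k u := by
        gcongr; exact one_sub_exp_le_max hu
    _ = _ := by ring

lemma MemK.integrable_integrand (hk : MemK k) {z : ℝ} (hz : 0 ≤ z) :
    IntegrableOn (fun u => (1 - Real.exp (-(z * u))) * k u) (Ioi 0) := by
  refine Integrable.mono' (hk.integrable.const_mul (max z 1))
    ((Measurable.aestronglyMeasurable (by fun_prop)).mul hk.aestronglyMeasurable) ?_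
  filter_upwards [ae_restrict_mem measurableSet_Ioi] with u hu using hk.norm_integrand_le hz hu

lemma psi_nonneg (hβ : 0 ≤ β) (hk : MemK k) {z : ℝ} (hz : 0 ≤ z) : 0 ≤ psi β k z := by
  refine add_nonneg (mul_nonneg hβ hz) (setIntegral_nonneg measurableSet_Ioi fun u hu => ?_)
  exact mul_nonneg (one_sub_exp_mem hz (le_of_lt hu)) (hk.nonneg u hu)

lemma continuousOn_psi (β : ℝ) (hk : MemK k) : ContinuousOn (psi β k) (Ici 0) := by
  intro z₀ hz₀
  refine ContinuousWithinAt.add (by fun_prop) ?_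
  refine continuousWithinAt_of_dominated (bound := fun u => max (z₀ + 1) 1 * (k u * min u 1)) ?_ ?_
    (hk.integrable.const_mul _) ?_
  · exact Eventually.of_forall fun z =>
      ((Measurable.aestronglyMeasurable (by fun_prop)).mul hk.aestronglyMeasurable)
  · filter_upwards [self_mem_nhdsWithin, mem_nhdsWithin_of_mem_nhds (Iio_mem_nhds (lt_add_one z₀))]
      with z hz hz1
    filter_upwards [ae_restrict_mem measurableSet_Ioi] with u hu
    refine (hk.norm_integrand_le hz hu).trans ?_
    have : 0 ≤ k u * min u 1 := mul_nonneg (hk.nonneg u hu) (le_min (le_of_lt hu) zero_le_one)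
    have hz1' : z ≤ z₀ + 1 := le_of_lt hz1
    gcongr
  · refine ae_of_all _ fun u => ?_
    have : Continuous fun z : ℝ => (1 - Real.exp (-(z * u))) * k u := by fun_prop
    exact this.continuousWithinAt

lemma MemK.integrable_mul (hk : MemK k) (hk_sq : IntegrableOn (fun z => z ^ 2 * k z) (Ioi 0)) :
    IntegrableOn (fun z => z * k z) (Ioi 0) := by
  refine Integrable.mono' (hk.integrable.add hk_sq)
    (measurable_id.aestronglyMeasurable.mul hk.aestronglyMeasurable) ?_
  filter_upwards [ae_restrict_mem measurableSet_Ioi] with u hu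
  have hku := hk.nonneg u hu
  have hu' : 0 < u := hu
  rw [Real.norm_eq_abs, abs_of_nonneg (by positivity), Pi.add_apply]
  rcases le_total u 1 with h | h
  · rw [min_eq_left h]
    have : 0 ≤ u ^ 2 * k u := by positivity
    linarith [mul_comm u (k u)]
  · have h1 : 0 ≤ k u * min u 1 := mul_nonneg hku (le_min hu'.le zero_le_one)
    have h2 : u * k u ≤ u ^ 2 * k u := by
      gcongr; nlinarith
    linarith

lemma psi_le (hk : MemK k) (hk1 : IntegrableOn (fun z => z * k z) (Ioi 0)) {z : ℝ} (hz : 0 ≤ z) :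
    psi β k z ≤ (β + ∫ u in Ioi 0, u * k u) * z := by
  have : ∫ u in Ioi 0, (1 - Real.exp (-(z * u))) * k u ≤ ∫ u in Ioi 0, z * (u * k u) := by
    refine setIntegral_mono_on (hk.integrable_integrand hz) (hk1.const_mul z) measurableSet_Ioi
      fun u hu => ?_
    have := Real.add_one_le_exp (-(z * u))
    rw [← mul_assoc]
    exact mul_le_mul_of_nonneg_right (by linarith) (hk.nonneg u hu)
  rw [integral_const_mul] at this
  unfold psi
  linarith

variable {b c : ℝ}

lemma continuousOn_psi_v (β : ℝ) (hb : 0 < b) (hc : 0 < c) (hk : MemK k) {l : ℝ} (hl : 0 ≤ l) :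
    ContinuousOn (fun s => psi β k (v b c s l)) (Ici 0) :=
  (continuousOn_psi β hk).comp (continuousOn_v_left hb hc hl) fun _ hs => v_nonneg hb hc hs hl

lemma integrableOn_psi_v (hβ : 0 ≤ β) (hb : 0 < b) (hc : 0 < c) (hk : MemK k)
    (hk1 : IntegrableOn (fun z => z * k z) (Ioi 0)) {l : ℝ} (hl : 0 ≤ l) :
    IntegrableOn (fun s => psi β k (v b c s l)) (Ioi 0) := by
  set C := β + ∫ u in Ioi 0, u * k u with hC
  have hC0 : 0 ≤ C := add_nonneg hβ (setIntegral_nonneg measurableSet_Ioi fun u hu =>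
    mul_nonneg (le_of_lt hu) (hk.nonneg u hu))
  have hi : IntegrableOn (fun s => C * (Real.exp (-b * s) * l)) (Ioi 0) :=
    ((exp_neg_integrableOn_Ioi 0 hb).mul_const l).const_mul C
  refine Integrable.mono' hi
    (((continuousOn_psi_v β hb hc hk hl).mono Ioi_subset_Ici_self).aestronglyMeasurable
      measurableSet_Ioi) ?_
  filter_upwards [ae_restrict_mem measurableSet_Ioi] with s hs
  have hs' : (0 : ℝ) ≤ s := le_of_lt hs
  have hv := v_nonneg hb hc hs' hl
  rw [Real.norm_eq_abs, abs_of_nonneg (psi_nonneg hβ hk hv)]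
  refine (psi_le hk hk1 hv).trans ?_
  rw [neg_mul]
  gcongr
  exact v_le hb hc hs' hl

end Immigration

/-! ### Exponential moments of the stationary law -/

section ExpMoments

variable {β b c : ℝ} {k : ℝ → ℝ}

/-- The critical exponent of the stationary law. -/
noncomputable def critExp (b c : ℝ) : ℝ := b * Real.exp (-b) / (c * (1 - Real.exp (-b)))

lemma exp_neg_lt_one (hb : 0 < b) : Real.exp (-b) < 1 := by
  rw [Real.exp_lt_one_iff]; linarith

lemma critExp_pos (hb : 0 < b) (hc : 0 < c) : 0 < critExp b c := by
  have := exp_neg_lt_one hb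
  have : 0 < 1 - Real.exp (-b) := by linarith
  unfold critExp
  positivity

/-- The coefficient `κ` in `-v_s(-z) = e^{-bs} z / (1 - κ z)`. -/
noncomputable def kap (b c s : ℝ) : ℝ := c / b * (1 - Real.exp (-(b * s)))

lemma kap_nonneg (hb : 0 < b) (hc : 0 < c) {s : ℝ} (hs : 0 ≤ s) : 0 ≤ kap b c s :=
  mul_nonneg (by positivity) (one_sub_exp_nonneg hb hs)

lemma kap_mul_lt (hb : 0 < b) (hc : 0 < c) {s z : ℝ} (hz : |z| < b / c) :
    kap b c s * |z| < 1 := by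
  have h1 : kap b c s ≤ c / b := by
    refine mul_le_of_le_one_right (by positivity) ?_
    have := Real.exp_pos (-(b * s)); linarith
  calc kap b c s * |z| ≤ c / b * |z| := by gcongr
    _ < c / b * (b / c) := by gcongr
    _ = 1 := by field_simp

lemma v_neg_eq (b c s z : ℝ) : -v b c s (-z) = Real.exp (-(b * s)) * z / (1 - kap b c s * z) := by
  unfold v kap
  have : 1 + c * -z / b * (1 - Real.exp (-(b * s))) = 1 - c / b * (1 - Real.exp (-(b * s))) * z := by
    ring
  rw [this]; ring

/-- The negative binomial series. Its coefficients are nonnegative because `kap` is, and the radius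
`b / c` serves all `s ≥ 0` at once because `kap b c s ≤ c / b`. -/
lemma hasSum_v_neg_pow (hb : 0 < b) (hc : 0 < c) {s z : ℝ} (hs : 0 ≤ s) (hz : |z| < b / c) (m : ℕ) :
    HasSum (fun j : ℕ => Real.exp (-(b * s)) ^ (m + 1) * ((j + m).choose m * kap b c s ^ j) *
      z ^ (m + 1 + j)) ((-v b c s (-z)) ^ (m + 1)) := by
  have h1 : ‖kap b c s * z‖ < 1 := by
    rw [Real.norm_eq_abs, abs_mul, abs_of_nonneg (kap_nonneg hb hc hs)]
    exact kap_mul_lt hb hc hz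
  have h2 := (hasSum_choose_mul_geometric_of_norm_lt_one m h1).mul_left
    ((Real.exp (-(b * s)) * z) ^ (m + 1))
  rw [v_neg_eq, div_pow, div_eq_mul_one_div]
  refine h2.congr_fun fun j => ?_
  rw [mul_pow, mul_pow, pow_add]
  ring

lemma posSeries_drift (hβ : 0 ≤ β) (hb : 0 < b) (hc : 0 < c) {ρ : ℝ} (hρ : ρ ≤ b / c)
    (hk_exp : ∀ l : ℝ, -ρ < l → ∫⁻ s in Ioi (0 : ℝ), absPsi β k (v b c s l) < ∞) :
    PosSeries ρ fun z => ∫ s in Ioi (0 : ℝ), β * -v b c s (-z) := by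
  refine PosSeries.integral (ι := ℕ)
    (a := fun j s => β * (Real.exp (-(b * s)) ^ (0 + 1) * ((j + 0).choose 0 * kap b c s ^ j)))
    (fun j => Measurable.aestronglyMeasurable (by unfold kap; fun_prop)) (fun j => ?_)
    (fun j => 0 + 1 + j) (fun z hz => ?_) fun θ h0 hθ => ?_
  · filter_upwards [ae_restrict_mem measurableSet_Ioi] with s hs
    have := kap_nonneg hb hc (le_of_lt hs)
    positivity
  · filter_upwards [ae_restrict_mem measurableSet_Ioi] with s hs
    have := (hasSum_v_neg_pow hb hc (le_of_lt hs) (hz.trans_le hρ) 0).mul_left β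
    have e : (-v b c s (-z)) ^ (0 + 1) = -v b c s (-z) := by rw [zero_add, pow_one]
    rw [e] at this
    exact this.congr_fun fun j => mul_assoc _ _ _
  · refine lt_of_le_of_lt (lintegral_mono fun s => ?_) (hk_exp (-θ) (by linarith))
    refine le_trans (ENNReal.ofReal_le_ofReal ?_) le_self_add
    rw [← abs_neg, ← mul_neg]
    exact le_abs_self _

/-- Expand the exponential in powers of `-v_s(-z)`, then each power in `z`: all coefficients are
nonnegative. Tonelli allows integration over time and jump size, and finiteness at `θ` is the moment
hypothesis at `-θ`. -/
lemma posSeries_jump (hb : 0 < b) (hc : 0 < c) (hk : MemK k) {ρ : ℝ} (hρ : ρ ≤ b / c)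
    (hk_exp : ∀ l : ℝ, -ρ < l → ∫⁻ s in Ioi (0 : ℝ), absPsi β k (v b c s l) < ∞) :
    PosSeries ρ fun z => ∫ p, (Real.exp (p.2 * -v b c p.1 (-z)) - 1) * k p.2
      ∂((volume.restrict (Ioi (0 : ℝ))).prod (volume.restrict (Ioi (0 : ℝ)))) := by
  have hpos : ∀ᵐ p : ℝ × ℝ ∂((volume.restrict (Ioi (0 : ℝ))).prod (volume.restrict (Ioi (0 : ℝ)))),
      0 < p.1 ∧ 0 < p.2 := by
    rw [Measure.prod_restrict]
    exact ae_restrict_mem (measurableSet_Ioi.prod measurableSet_Ioi)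
  have hkm : AEStronglyMeasurable (fun p : ℝ × ℝ => k p.2)
      ((volume.restrict (Ioi (0 : ℝ))).prod (volume.restrict (Ioi (0 : ℝ)))) :=
    hk.aestronglyMeasurable.comp_snd
  refine PosSeries.integral (ι := ℕ × ℕ)
    (a := fun i p => p.2 ^ (i.1 + 1) / (i.1 + 1).factorial *
      (Real.exp (-(b * p.1)) ^ (i.1 + 1) * ((i.2 + i.1).choose i.1 * kap b c p.1 ^ i.2)) * k p.2)
    (fun i => (Measurable.aestronglyMeasurable (by unfold kap; fun_prop)).mul hkm) (fun i => ?_)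
    (fun i => i.1 + 1 + i.2) (fun z hz => ?_) fun θ h0 hθ => ?_
  · filter_upwards [hpos] with p hp
    have h1 := kap_nonneg hb hc hp.1.le
    have h2 := hk.nonneg _ hp.2
    have h3 := hp.2
    positivity
  · filter_upwards [hpos] with p hp
    have hexp : ∀ x : ℝ, HasSum (fun m : ℕ => x ^ (m + 1) / (m + 1).factorial) (Real.exp x - 1) := by
      intro x
      have := NormedSpace.expSeries_div_hasSum_exp x
      rw [← Real.exp_eq_exp_ℝ] at this
      have := (hasSum_nat_add_iff' 1).2 this
      simpa using this
    have hz' : |(|z|)| < b / c := by rw [abs_abs]; exact hz.trans_le hρ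
    have hE : ∀ y : ℝ, HasSum (fun m : ℕ => p.2 ^ (m + 1) / (m + 1).factorial *
        (-v b c p.1 (-y)) ^ (m + 1) * k p.2) ((Real.exp (p.2 * -v b c p.1 (-y)) - 1) * k p.2) := by
      intro y
      refine ((hexp (p.2 * -v b c p.1 (-y))).mul_right (k p.2)).congr_fun fun m => ?_
      rw [mul_pow]; ring
    refine hasSum_prod_of_abs (G := fun m => p.2 ^ (m + 1) / (m + 1).factorial *
        (-v b c p.1 (-|z|)) ^ (m + 1) * k p.2) (fun m => ?_) (hE |z|).summable (fun m => ?_) (hE z)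
    · have := ((hasSum_v_neg_pow hb hc hp.1.le hz' m).mul_left
        (p.2 ^ (m + 1) / (m + 1).factorial)).mul_right (k p.2)
      refine this.congr_fun fun j => ?_
      have h1 := kap_nonneg hb hc hp.1.le
      have h2 := hk.nonneg _ hp.2
      have h3 := hp.2
      rw [abs_mul, abs_pow, abs_of_nonneg (by positivity)]
      ring
    · have := ((hasSum_v_neg_pow hb hc hp.1.le (hz.trans_le hρ) m).mul_left
        (p.2 ^ (m + 1) / (m + 1).factorial)).mul_right (k p.2)
      exact this.congr_fun fun j => by ring
  · have hm : AEMeasurable (fun p : ℝ × ℝ =>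
        ENNReal.ofReal ((Real.exp (p.2 * -v b c p.1 (-θ)) - 1) * k p.2))
        ((volume.restrict (Ioi (0 : ℝ))).prod (volume.restrict (Ioi (0 : ℝ)))) := by
      refine (AEMeasurable.mul ?_ hkm.aemeasurable).ennreal_ofReal
      exact Measurable.aemeasurable (by unfold v; fun_prop)
    rw [lintegral_prod _ hm]
    refine lt_of_le_of_lt (lintegral_mono fun s => ?_) (hk_exp (-θ) (by linarith))
    refine le_trans ?_ le_add_self
    refine lintegral_mono_ae ?_
    filter_upwards [ae_restrict_mem measurableSet_Ioi] with u hu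
    refine ENNReal.ofReal_le_ofReal (mul_le_mul_of_nonneg_right ?_ (hk.nonneg u hu))
    rw [← abs_neg, neg_sub]
    refine le_trans (le_of_eq ?_) (le_abs_self _)
    congr 2; ring

/-- For `z ≤ 0` the exponent of the Laplace transform is brought by Fubini into the form shown above
to be a power series with nonnegative coefficients. The jump integrand is dominated by the product
of `v` and `u * k u`. -/
lemma neg_integral_psi_eq (hb : 0 < b) (hc : 0 < c) (hk : MemK k)
    (hk1 : IntegrableOn (fun z => z * k z) (Ioi 0)) {z : ℝ} (hz : z ≤ 0) :
    -∫ s in Ioi (0 : ℝ), psi β k (v b c s (-z)) =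
      (∫ s in Ioi (0 : ℝ), β * -v b c s (-z)) +
      ∫ p, (Real.exp (p.2 * -v b c p.1 (-z)) - 1) * k p.2
        ∂((volume.restrict (Ioi (0 : ℝ))).prod (volume.restrict (Ioi (0 : ℝ)))) := by
  have hl : 0 ≤ -z := by linarith
  set l := -z
  have hpos : ∀ᵐ p : ℝ × ℝ ∂((volume.restrict (Ioi (0 : ℝ))).prod (volume.restrict (Ioi (0 : ℝ)))),
      0 < p.1 ∧ 0 < p.2 := by
    rw [Measure.prod_restrict]
    exact ae_restrict_mem (measurableSet_Ioi.prod measurableSet_Ioi)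
  have hkm : AEStronglyMeasurable (fun p : ℝ × ℝ => k p.2)
      ((volume.restrict (Ioi (0 : ℝ))).prod (volume.restrict (Ioi (0 : ℝ)))) :=
    hk.aestronglyMeasurable.comp_snd
  have hexp : IntegrableOn (fun s => Real.exp (-(b * s)) * l) (Ioi 0) := by
    have := (exp_neg_integrableOn_Ioi 0 hb).mul_const l
    simpa only [neg_mul, IntegrableOn] using this
  have hvi : IntegrableOn (fun s => v b c s l) (Ioi 0) := by
    refine Integrable.mono' hexp (Measurable.aestronglyMeasurable (by unfold v; fun_prop)) ?_
    filter_upwards [ae_restrict_mem measurableSet_Ioi] with s hs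
    rw [Real.norm_eq_abs, abs_of_nonneg (v_nonneg hb hc (le_of_lt hs) hl)]
    exact v_le hb hc (le_of_lt hs) hl
  have hFi : Integrable (fun p : ℝ × ℝ => (Real.exp (p.2 * -v b c p.1 l) - 1) * k p.2)
      ((volume.restrict (Ioi (0 : ℝ))).prod (volume.restrict (Ioi (0 : ℝ)))) := by
    refine Integrable.mono' (Integrable.mul_prod hvi hk1)
      ((Measurable.aestronglyMeasurable (by unfold v; fun_prop)).mul hkm) ?_
    filter_upwards [hpos] with p hp
    have h1 := v_nonneg hb hc hp.1.le hl
    have h2 := hk.nonneg _ hp.2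
    have h3 : Real.exp (p.2 * -v b c p.1 l) ≤ 1 := by
      rw [Real.exp_le_one_iff]
      nlinarith [hp.2]
    have h4 := Real.add_one_le_exp (p.2 * -v b c p.1 l)
    rw [Real.norm_eq_abs, abs_mul, abs_of_nonneg h2, abs_of_nonpos (by linarith), ← mul_assoc]
    refine mul_le_mul_of_nonneg_right ?_ h2
    linarith
  have hvi' : IntegrableOn (fun s => β * -v b c s l) (Ioi 0) := hvi.neg.const_mul β
  have hFi' : IntegrableOn (fun s => ∫ u in Ioi (0 : ℝ), (Real.exp (u * -v b c s l) - 1) * k u)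
      (Ioi 0) := hFi.integral_prod_left
  rw [integral_prod _ hFi, ← integral_neg]
  dsimp only
  rw [← integral_add hvi' hFi']
  refine integral_congr_ae (ae_of_all _ fun s => ?_)
  have e : ∫ u in Ioi (0 : ℝ), (Real.exp (u * -v b c s l) - 1) * k u =
      -∫ u in Ioi (0 : ℝ), (1 - Real.exp (-(v b c s l * u))) * k u := by
    rw [← integral_neg]
    refine integral_congr_ae (ae_of_all _ fun u => ?_)
    have : u * -v b c s l = -(v b c s l * u) := by ring
    simp only [this]
    ring
  simp only [psi, e]
  ring

/-- If the critical exponent exceeds `b / c`, the moment condition forces trivial immigration. -/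
lemma psi_eq_zero_of_critExp (hβ : 0 ≤ β) (hb : 0 < b) (hc : 0 < c) (hk : MemK k)
    (hlt : b / c < critExp b c)
    (hk_exp : ∀ l : ℝ, -critExp b c < l → ∫⁻ s in Ioi (0 : ℝ), absPsi β k (v b c s l) < ∞) (z : ℝ) :
    psi β k z = 0 := by
  obtain ⟨y, hy1, hy2⟩ := exists_between hlt
  have hfin := hk_exp (-y) (by linarith)
  have hy0 : 0 < y := lt_trans (by positivity) hy1
  set x := c * y / b with hx
  have hx1 : 1 < x := by
    rw [hx, one_lt_div hb]
    rwa [div_lt_iff₀ hc, mul_comm] at hy1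
  have hq : 0 < 1 - 1 / x := by
    rw [sub_pos, div_lt_one (by linarith)]; exact hx1
  -- The time at which the denominator of `v_s(-y)` vanishes; it is positive and finite because `y >
  -- b / c`.
  set s₀ := -Real.log (1 - 1 / x) / b with hs₀
  have hs₀pos : 0 < s₀ := by
    refine div_pos (neg_pos.2 (Real.log_neg hq ?_)) hb
    have : 0 < 1 / x := by positivity
    linarith
  have hes₀ : Real.exp (-(b * s₀)) = 1 - 1 / x := by
    have : -(b * s₀) = Real.log (1 - 1 / x) := by rw [hs₀]; field_simp
    rw [this, Real.exp_log hq]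
  -- Near the blow-up time `v_s(-y)` behaves like `-1 / (c (s₀ - s))`, which is not integrable.
  have hvle : ∀ s, 0 < s → s < s₀ → v b c s (-y) ≤ -(c⁻¹ * (s₀ - s)⁻¹) := by
    intro s hs hss
    have hE := Real.exp_pos (-(b * s))
    have e1 : Real.exp (-(b * s₀)) = Real.exp (-(b * s)) * Real.exp (-(b * (s₀ - s))) := by
      rw [← Real.exp_add]; congr 1; ring
    have h1 := Real.add_one_le_exp (-(b * (s₀ - s)))
    have h2 : Real.exp (-(b * (s₀ - s))) < 1 := by
      rw [Real.exp_lt_one_iff]; nlinarith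
    have hden : 1 + c * -y / b * (1 - Real.exp (-(b * s))) =
        x * (Real.exp (-(b * s)) * (1 - Real.exp (-(b * (s₀ - s))))) := by
      have h3 : x * Real.exp (-(b * s₀)) = x - 1 := by rw [hes₀]; field_simp
      have h4 : x * (Real.exp (-(b * s)) * (1 - Real.exp (-(b * (s₀ - s))))) =
          x * Real.exp (-(b * s)) - x * Real.exp (-(b * s₀)) := by rw [e1]; ring
      rw [h4, h3, hx]; ring
    unfold v
    rw [hden]
    have hd : 0 < x * (Real.exp (-(b * s)) * (1 - Real.exp (-(b * (s₀ - s))))) := by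
      have : 0 < 1 - Real.exp (-(b * (s₀ - s))) := by linarith
      positivity
    rw [div_le_iff₀ hd, ← mul_inv]
    have hcs : 0 < c * (s₀ - s) := by have : 0 < s₀ - s := by linarith
                                      positivity
    have h5 : x * (Real.exp (-(b * s)) * (1 - Real.exp (-(b * (s₀ - s))))) ≤
        (Real.exp (-(b * s)) * y) * (c * (s₀ - s)) := by
      calc x * (Real.exp (-(b * s)) * (1 - Real.exp (-(b * (s₀ - s)))))
          ≤ x * (Real.exp (-(b * s)) * (b * (s₀ - s))) := by gcongr; linarith
        _ = _ := by rw [hx]; field_simp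
    have h6 := (inv_mul_le_iff₀ hcs).2 (h5.trans (le_of_eq (mul_comm _ _)))
    linarith
  set K : ℝ≥0∞ := ENNReal.ofReal β + ∫⁻ u in Ioi (0 : ℝ), ENNReal.ofReal (u * k u) with hK
  have hkm : AEMeasurable (fun u => ENNReal.ofReal (u * k u)) (volume.restrict (Ioi (0 : ℝ))) :=
    (measurable_id.aemeasurable.mul hk.aestronglyMeasurable.aemeasurable).ennreal_ofReal
  -- Since `e^x - 1 ≥ x`, the absolute mechanism at `-r` is at least `r * K`. Finiteness of the time
  -- integral of `absPsi` therefore forces `K = 0`, that is, no drift and no jumps.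
  have hlow : ∀ s ∈ Ioo 0 s₀, ENNReal.ofReal (c⁻¹ * (s₀ - s)⁻¹) * K ≤ absPsi β k (v b c s (-y)) := by
    intro s hs
    have hv := hvle s hs.1 hs.2
    set r := c⁻¹ * (s₀ - s)⁻¹ with hr
    have hr0 : 0 ≤ r := by have : 0 < s₀ - s := by linarith [hs.2]
                           positivity
    rw [hK, mul_add, ← ENNReal.ofReal_mul hr0, ← lintegral_const_mul'' _ hkm]
    refine add_le_add (ENNReal.ofReal_le_ofReal ?_) (lintegral_mono_ae ?_)
    · rw [abs_mul, abs_of_nonneg hβ, mul_comm]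
      gcongr
      rw [abs_of_nonpos (by linarith)]; linarith
    · filter_upwards [ae_restrict_mem measurableSet_Ioi] with u hu
      rw [← ENNReal.ofReal_mul hr0]
      refine ENNReal.ofReal_le_ofReal ?_
      rw [← mul_assoc]
      refine mul_le_mul_of_nonneg_right ?_ (hk.nonneg u hu)
      have hu' : (0 : ℝ) < u := hu
      have h1 := Real.add_one_le_exp (-(v b c s (-y) * u))
      have h2 : r * u ≤ -(v b c s (-y)) * u := by gcongr; linarith
      rw [← abs_neg]
      refine le_trans ?_ (le_abs_self _)
      linarith
  have hK0 : K = 0 := by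
    by_contra hne
    have hnot : ¬ IntervalIntegrable (fun s : ℝ => (s - s₀)⁻¹) volume 0 s₀ := by
      rw [intervalIntegrable_sub_inv_iff]
      push Not
      exact ⟨hs₀pos.ne, right_mem_uIcc⟩
    apply hnot
    rw [intervalIntegrable_iff_integrableOn_Ioo_of_le hs₀pos.le]
    refine ⟨Measurable.aestronglyMeasurable (by fun_prop), ?_⟩
    rw [hasFiniteIntegral_iff_enorm]
    have h1 : ∫⁻ s in Ioo 0 s₀, ENNReal.ofReal (c⁻¹ * (s₀ - s)⁻¹) * K < ∞ := by
      refine lt_of_le_of_lt (setLIntegral_mono' measurableSet_Ioo hlow) ?_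
      refine lt_of_le_of_lt (lintegral_mono_set Ioo_subset_Ioi_self) hfin
    rw [lintegral_mul_const _ (by fun_prop)] at h1
    have h2 : ∫⁻ s in Ioo 0 s₀, ENNReal.ofReal (c⁻¹ * (s₀ - s)⁻¹) < ∞ := by
      by_contra htop
      rw [not_lt, top_le_iff] at htop
      rw [htop, ENNReal.top_mul hne] at h1
      exact lt_irrefl _ h1
    have h3 : ∫⁻ s in Ioo 0 s₀, ‖(s - s₀)⁻¹‖ₑ =
        ∫⁻ s in Ioo 0 s₀, ENNReal.ofReal c * ENNReal.ofReal (c⁻¹ * (s₀ - s)⁻¹) := by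
      refine setLIntegral_congr_fun measurableSet_Ioo fun s hs => ?_
      rw [← ENNReal.ofReal_mul hc.le, ← mul_assoc, mul_inv_cancel₀ hc.ne', one_mul, ← ofReal_norm,
        norm_inv, Real.norm_eq_abs, abs_sub_comm, abs_of_pos (by linarith [hs.2])]
    rw [h3, lintegral_const_mul _ (by fun_prop)]
    exact ENNReal.mul_lt_top ENNReal.ofReal_lt_top h2
  rw [hK, add_eq_zero, ENNReal.ofReal_eq_zero, lintegral_eq_zero_iff' hkm] at hK0
  have hβ0 : β = 0 := le_antisymm hK0.1 hβ
  unfold psi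
  rw [hβ0, zero_mul, zero_add]
  refine integral_eq_zero_of_ae ?_
  filter_upwards [hK0.2, ae_restrict_mem measurableSet_Ioi] with u hu hu0
  have hu0' : (0 : ℝ) < u := hu0
  rw [Pi.zero_apply, ENNReal.ofReal_eq_zero] at hu
  have : k u = 0 := le_antisymm (nonpos_of_mul_nonpos_right hu hu0') (hk.nonneg u hu0)
  simp [this]

/-- The stationary law has exponential moments below the critical exponent. -/
theorem integrable_exp_of_laplace {Ω : Type*} [MeasurableSpace Ω] {P : Measure Ω}
    [IsProbabilityMeasure P] {Y : Ω → ℝ≥0} (hY : Measurable Y)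
    (hβ : 0 ≤ β) (hb : 0 < b) (hc : 0 < c) (hk : MemK k)
    (hk1 : IntegrableOn (fun z => z * k z) (Ioi 0))
    (hk_exp : ∀ l : ℝ, -critExp b c < l → ∫⁻ s in Ioi (0 : ℝ), absPsi β k (v b c s l) < ∞)
    (hlap : ∀ l : ℝ, 0 ≤ l → ∫ ω, Real.exp (-(l * (Y ω : ℝ))) ∂P =
      Real.exp (-∫ s in Ioi (0 : ℝ), psi β k (v b c s l)))
    {θ : ℝ} (hθ : θ < critExp b c) : Integrable (fun ω => Real.exp (θ * (Y ω : ℝ))) P := by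
  have hYm : Measurable fun ω => (Y ω : ℝ) := hY.coe_nnreal_real
  rcases le_or_gt (critExp b c) (b / c) with hM | hM
  · refine ((posSeries_drift hβ hb hc hM hk_exp).add
      (posSeries_jump hb hc hk hM hk_exp)).exp.integrable_exp hYm (fun ω => NNReal.coe_nonneg _)
      (fun z _ hz => ?_) hθ
    rw [← neg_integral_psi_eq hb hc hk hk1 hz, ← hlap (-z) (by linarith)]
    simp
  -- With trivial immigration the Laplace transform is identically one, a constant power series of
  -- any radius; `θ + 1` exceeds `θ`.
  · refine (PosSeries.const (θ + 1) zero_le_one).integrable_exp hYm (fun ω => NNReal.coe_nonneg _)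
      (fun z _ hz => ?_) (lt_add_one θ)
    have := hlap (-z) (by linarith)
    simp only [psi_eq_zero_of_critExp hβ hb hc hk hM hk_exp, integral_zero, neg_zero,
      Real.exp_zero] at this
    simpa using this

end ExpMoments

end CBI

/-! ### Laplace transforms on the half-line -/

lemma abs_polynomial_eval_le (p : Polynomial ℝ) :
    ∃ C : ℝ, ∀ u ∈ Icc (0 : ℝ) 1, |p.eval u| ≤ C := by
  obtain ⟨C, hC⟩ := isCompact_Icc.exists_bound_of_continuousOn
    (p.continuous.continuousOn (s := Icc (0 : ℝ) 1))
  exact ⟨C, fun u hu => hC u hu⟩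

lemma exp_neg_coe_mem (x : ℝ≥0) : Real.exp (-(x : ℝ)) ∈ Icc (0 : ℝ) 1 :=
  ⟨(Real.exp_pos _).le, by rw [Real.exp_le_one_iff]; simp⟩

lemma integrable_polynomial_exp_neg (μ : Measure ℝ≥0) [IsFiniteMeasure μ] (p : Polynomial ℝ) :
    Integrable (fun x : ℝ≥0 => p.eval (Real.exp (-(x : ℝ)))) μ := by
  obtain ⟨C, hC⟩ := abs_polynomial_eval_le p
  have hm : Continuous fun x : ℝ≥0 => p.eval (Real.exp (-(x : ℝ))) :=
    p.continuous.comp (by fun_prop)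
  exact Integrable.of_bound hm.aestronglyMeasurable C
    (Eventually.of_forall fun x => hC _ (exp_neg_coe_mem x))

lemma integral_polynomial_exp_neg (μ : Measure ℝ≥0) [IsFiniteMeasure μ] (p : Polynomial ℝ) :
    ∫ x, p.eval (Real.exp (-(x : ℝ))) ∂μ =
      ∑ i ∈ Finset.range (p.natDegree + 1), p.coeff i * ∫ x, Real.exp (-(i * (x : ℝ))) ∂μ := by
  have hi : ∀ i : ℕ, Integrable (fun x : ℝ≥0 => Real.exp (-(i * (x : ℝ)))) μ := by
    intro i
    refine Integrable.of_bound (by fun_prop) 1 (Eventually.of_forall fun x => ?_)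
    rw [Real.norm_eq_abs, abs_of_pos (Real.exp_pos _), Real.exp_le_one_iff]
    have : (0 : ℝ) ≤ i * (x : ℝ) := by positivity
    linarith
  simp_rw [Polynomial.eval_eq_sum_range]
  rw [integral_finsetSum]
  · refine Finset.sum_congr rfl fun i _ => ?_
    rw [← integral_const_mul]
    refine integral_congr_ae (Eventually.of_forall fun x => ?_)
    simp only
    rw [← Real.exp_nat_mul, mul_neg]
  · intro i _
    refine ((hi i).const_mul (p.coeff i)).congr (Eventually.of_forall fun x => ?_)
    simp only
    rw [← Real.exp_nat_mul, mul_neg]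

/-- Polynomials in `e ^ (-x)` are dense in `L¹` of a finite measure on the half-line. -/
theorem exists_polynomial_exp_neg_near {μ : Measure ℝ≥0} [IsFiniteMeasure μ] {q : ℝ≥0 → ℝ}
    (hq : Integrable q μ) {ε : ℝ} (hε : 0 < ε) :
    ∃ p : Polynomial ℝ, ∫ x, |q x - p.eval (Real.exp (-(x : ℝ)))| ∂μ ≤ ε := by
  obtain ⟨g, hgs, hg, hgc, hgi⟩ := hq.exists_hasCompactSupport_integral_sub_le (half_pos hε)
  -- The substitution `u = e^{-x}` maps the half-line to `(0, 1]`. Because `g` has compact support,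
  -- extending by zero at `u = 0` stays continuous, and Weierstrass' theorem applies on `[0, 1]`.
  set F : ℝ → ℝ := fun u => if u ≤ 0 then 0 else g (Real.toNNReal (-Real.log u)) with hF
  obtain ⟨T, hT⟩ : ∃ T : ℝ≥0, ∀ x, T < x → g x = 0 := by
    obtain ⟨T, hT⟩ := hgs.isCompact.bddAbove
    refine ⟨T, fun x hx => ?_⟩
    by_contra h
    exact absurd (hT (subset_tsupport g h)) (not_le.2 hx)
  have hFc : ContinuousOn F (Icc 0 1) := by
    intro u hu
    rcases hu.1.eq_or_lt with h0 | h0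
    · have : F =ᶠ[𝓝 u] fun _ => 0 := by
        filter_upwards [Iio_mem_nhds (show u < Real.exp (-(T : ℝ)) by
          rw [← h0]; exact Real.exp_pos _)] with y hy
        simp only [hF]
        split_ifs with h
        · rfl
        · push Not at h
          refine hT _ ?_
          rw [Real.lt_toNNReal_iff_coe_lt, lt_neg, Real.log_lt_iff_lt_exp h]
          exact hy
      exact (continuousAt_const.congr this.symm).continuousWithinAt
    · have : F =ᶠ[𝓝 u] fun y => g (Real.toNNReal (-Real.log y)) := by
        filter_upwards [Ioi_mem_nhds h0] with y hy
        have hy' : ¬ y ≤ 0 := not_le.2 hy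
        simp only [hF, if_neg hy']
      refine (ContinuousAt.congr ?_ this.symm).continuousWithinAt
      exact hgc.continuousAt.comp
        (continuous_real_toNNReal.continuousAt.comp (Real.continuousAt_log h0.ne').neg)
  have hδ : 0 < ε / (2 * (μ.real univ + 1)) := by positivity
  obtain ⟨p, hp⟩ := exists_polynomial_near_of_continuousOn 0 1 F hFc _ hδ
  refine ⟨p, ?_⟩
  have hFg : ∀ x : ℝ≥0, F (Real.exp (-(x : ℝ))) = g x := by
    intro x
    simp only [hF, if_neg (not_le.2 (Real.exp_pos (-(x : ℝ)))), Real.log_exp, neg_neg,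
      Real.toNNReal_coe]
  have hpi := integrable_polynomial_exp_neg μ p
  calc ∫ x, |q x - p.eval (Real.exp (-(x : ℝ)))| ∂μ
      ≤ ∫ x, (‖q x - g x‖ + ε / (2 * (μ.real univ + 1))) ∂μ := by
        refine integral_mono (hq.sub hpi).abs ((hq.sub hgi).norm.add (integrable_const _)) fun x => ?_
        have h1 := hp _ (exp_neg_coe_mem x)
        rw [hFg] at h1
        have h2 := abs_sub_le (q x) (g x) (p.eval (Real.exp (-(x : ℝ))))
        rw [abs_sub_comm (g x)] at h2
        simp only [Real.norm_eq_abs]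
        linarith
    _ = (∫ x, ‖q x - g x‖ ∂μ) + μ.real univ * (ε / (2 * (μ.real univ + 1))) := by
        have hn : Integrable (fun x => ‖q x - g x‖) μ := (hq.sub hgi).norm
        rw [integral_add hn (integrable_const _), integral_const, smul_eq_mul]
    _ ≤ ε / 2 + ε / 2 := by
        refine add_le_add hg ?_
        have h0 : 0 ≤ μ.real univ := measureReal_nonneg
        rw [mul_div_assoc', div_le_div_iff₀ (by positivity) two_pos]
        nlinarith
    _ = ε := add_halves ε

theorem Measure.ext_of_integral_exp_neg {μ ν : Measure ℝ≥0} [IsFiniteMeasure μ] [IsFiniteMeasure ν]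
    (h : ∀ l : ℝ, 0 ≤ l → ∫ x, Real.exp (-(l * (x : ℝ))) ∂μ = ∫ x, Real.exp (-(l * (x : ℝ))) ∂ν) :
    μ = ν := by
  refine Measure.ext fun A hA => ?_
  rw [← measureReal_eq_measureReal_iff, ← integral_indicator_one hA, ← integral_indicator_one hA]
  have hint : ∀ ρ : Measure ℝ≥0, IsFiniteMeasure ρ → Integrable (A.indicator (1 : ℝ≥0 → ℝ)) ρ :=
    fun ρ _ => (integrable_const (1 : ℝ)).indicator hA
  refine eq_of_forall_dist_le fun ε hε => ?_
  rw [Real.dist_eq]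
  -- Approximating with respect to the sum gives one polynomial that works for both measures.
  obtain ⟨p, hp⟩ := exists_polynomial_exp_neg_near (hint (μ + ν) inferInstance) hε
  have hpμ := integrable_polynomial_exp_neg μ p
  have hpν := integrable_polynomial_exp_neg ν p
  have habs : ∀ ρ : Measure ℝ≥0, IsFiniteMeasure ρ →
      Integrable (fun x => |A.indicator (1 : ℝ≥0 → ℝ) x - p.eval (Real.exp (-(x : ℝ)))|) ρ :=
    fun ρ hρ => ((hint ρ hρ).sub (integrable_polynomial_exp_neg ρ p)).abs
  rw [integral_add_measure (habs μ inferInstance) (habs ν inferInstance)] at hp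
  have e : ∫ x, p.eval (Real.exp (-(x : ℝ))) ∂μ = ∫ x, p.eval (Real.exp (-(x : ℝ))) ∂ν := by
    rw [integral_polynomial_exp_neg, integral_polynomial_exp_neg]
    exact Finset.sum_congr rfl fun i _ => by rw [h i (Nat.cast_nonneg i)]
  have h1 := abs_integral_le_integral_abs (μ := μ)
    (f := fun x => A.indicator (1 : ℝ≥0 → ℝ) x - p.eval (Real.exp (-(x : ℝ))))
  have h2 := abs_integral_le_integral_abs (μ := ν)
    (f := fun x => A.indicator (1 : ℝ≥0 → ℝ) x - p.eval (Real.exp (-(x : ℝ))))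
  rw [integral_sub (hint μ inferInstance) hpμ] at h1
  rw [integral_sub (hint ν inferInstance) hpν] at h2
  rw [abs_le] at *
  constructor <;> linarith [h1.1, h1.2, h2.1, h2.2]

/-! ### Markov processes in continuous time observed at two times -/

namespace CBI

section Markov

set_option linter.unusedSectionVars false

variable {Ω : Type*} [mΩ : MeasurableSpace Ω] {P : Measure Ω} [IsProbabilityMeasure P]
  {X : ℝ≥0 → Ω → ℝ≥0}

lemma past_le (hX : ∀ t, Measurable (X t)) (s : ℝ≥0) : past X s ≤ mΩ :=
  iSup₂_le fun u _ => (hX u).comap_le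

lemma past_mono {s t : ℝ≥0} (h : s ≤ t) : past X s ≤ past X t :=
  iSup₂_le fun u hu => le_iSup₂_of_le u (hu.trans h) le_rfl

lemma measurable_past {u s : ℝ≥0} (h : u ≤ s) : Measurable[past X s] (X u) :=
  Measurable.mono (comap_measurable (X u)) (le_iSup₂_of_le u h le_rfl) le_rfl

/-- The simple Markov property with transition kernels `Q`. -/
structure IsMarkov (P : Measure Ω) (X : ℝ≥0 → Ω → ℝ≥0) (Q : ℝ≥0 → Kernel ℝ≥0 ℝ≥0) : Prop where
  measurable : ∀ t, Measurable (X t)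
  kernel : ∀ t, IsMarkovKernel (Q t)
  condExp : ∀ (s t : ℝ≥0) (f : ℝ≥0 → ℝ), Measurable f → (∃ C : ℝ, ∀ y, |f y| ≤ C) →
      P[fun ω => f (X (s + t) ω) | past X s] =ᵐ[P] fun ω => ∫ y, f y ∂(Q t (X s ω))

variable {Q : ℝ≥0 → Kernel ℝ≥0 ℝ≥0}

/-- Rectangles determine the joint law. Restricting to an arbitrary event of the past encodes
conditioning at the level of measures, so the Markov property for bounded functions of the future
extends to integrable functions of the pair. -/
lemma IsMarkov.map_restrict_prodMk (h : IsMarkov P X Q) (s t : ℝ≥0) {A : Set Ω}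
    (hA : MeasurableSet[past X s] A) :
    (P.restrict A).map (fun ω => (X s ω, X (s + t) ω)) = (P.restrict A).map (X s) ⊗ₘ Q t := by
  have := h.kernel t
  have hm : Measurable fun ω => (X s ω, X (s + t) ω) :=
    (h.measurable s).prodMk (h.measurable (s + t))
  have hA' : MeasurableSet A := past_le h.measurable s _ hA
  refine Measure.ext_prod fun {S T} hS hT => ?_
  rw [Measure.compProd_apply_prod hS hT, Measure.map_apply hm (hS.prod hT),
    Measure.restrict_apply (hm (hS.prod hT)),
    setLIntegral_map hS (Kernel.measurable_coe _ hT) (h.measurable s),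
    Measure.restrict_restrict (h.measurable s hS)]
  have hB : MeasurableSet[past X s] (X s ⁻¹' S ∩ A) :=
    MeasurableSet.inter (measurable_past le_rfl hS) hA
  have hB' : MeasurableSet (X s ⁻¹' S ∩ A) := past_le h.measurable s _ hB
  have hfi : Integrable (fun ω => T.indicator (1 : ℝ≥0 → ℝ) (X (s + t) ω)) P := by
    have : (fun ω => T.indicator (1 : ℝ≥0 → ℝ) (X (s + t) ω)) =
        (X (s + t) ⁻¹' T).indicator 1 := rfl
    rw [this]
    exact (integrable_const (1 : ℝ)).indicator (h.measurable _ hT)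
  have key := setIntegral_condExp (past_le h.measurable s) hfi hB
  have hce := h.condExp s t (T.indicator 1) (measurable_one.indicator hT) ⟨1, fun y => by
    by_cases hy : y ∈ T <;> simp [hy]⟩
  rw [setIntegral_congr_ae hB' (hce.mono fun ω hω _ => hω)] at key
  have e1 : ∀ ω, ∫ y, T.indicator (1 : ℝ≥0 → ℝ) y ∂(Q t (X s ω)) = (Q t (X s ω)).real T :=
    fun ω => integral_indicator_one hT
  simp_rw [e1] at key
  have e2 : ∫ ω in X s ⁻¹' S ∩ A, T.indicator (1 : ℝ≥0 → ℝ) (X (s + t) ω) ∂P =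
      P.real (X (s + t) ⁻¹' T ∩ (X s ⁻¹' S ∩ A)) := by
    have : (fun ω => T.indicator (1 : ℝ≥0 → ℝ) (X (s + t) ω)) =
        (X (s + t) ⁻¹' T).indicator 1 := rfl
    rw [this, integral_indicator_one (h.measurable _ hT), measureReal_restrict_apply
      (h.measurable _ hT)]
  rw [e2] at key
  have e3 : (fun ω => (X s ω, X (s + t) ω)) ⁻¹' S ×ˢ T ∩ A =
      X (s + t) ⁻¹' T ∩ (X s ⁻¹' S ∩ A) := by
    ext ω
    simp only [mem_inter_iff, mem_preimage, mem_prod]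
    tauto
  rw [e3, ← ofReal_measureReal, ← key]
  rw [ofReal_integral_eq_lintegral_ofReal]
  · exact lintegral_congr fun ω => ofReal_measureReal
  · refine Integrable.of_bound ?_ 1 (Eventually.of_forall fun ω => ?_)
    · exact ((Kernel.measurable_coe _ hT).comp (h.measurable s)).ennreal_toReal.aestronglyMeasurable
    · rw [Real.norm_of_nonneg measureReal_nonneg]
      exact measureReal_le_one
  · exact Eventually.of_forall fun ω => measureReal_nonneg

lemma IsMarkov.map_prodMk (h : IsMarkov P X Q) (s t : ℝ≥0) :
    P.map (fun ω => (X s ω, X (s + t) ω)) = P.map (X s) ⊗ₘ Q t := by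
  simpa using h.map_restrict_prodMk s t MeasurableSet.univ

lemma IsMarkov.integrable_integral (h : IsMarkov P X Q) (s t : ℝ≥0) {f : ℝ≥0 × ℝ≥0 → ℝ}
    (hf : Measurable f) (hi : Integrable (fun ω => f (X s ω, X (s + t) ω)) P) :
    Integrable (fun ω => ∫ y, f (X s ω, y) ∂(Q t (X s ω))) P := by
  have := h.kernel t
  have hm : Measurable fun ω => (X s ω, X (s + t) ω) :=
    (h.measurable s).prodMk (h.measurable (s + t))
  have h1 : Integrable f (P.map (X s) ⊗ₘ Q t) := by
    rw [← h.map_prodMk]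
    exact (integrable_map_measure hf.aestronglyMeasurable hm.aemeasurable).2 hi
  have h2 : Integrable (fun x => ∫ y, f (x, y) ∂(Q t x)) (P.map (X s)) :=
    Integrable.integral_compProd (κ := Kernel.const Unit (P.map (X s)))
      (η := Kernel.prodMkLeft Unit (Q t)) (a := ()) h1
  exact h2.comp_measurable (h.measurable s)

lemma IsMarkov.condExp_prodMk (h : IsMarkov P X Q) (s t : ℝ≥0) {f : ℝ≥0 × ℝ≥0 → ℝ}
    (hf : Measurable f) (hi : Integrable (fun ω => f (X s ω, X (s + t) ω)) P) :
    P[fun ω => f (X s ω, X (s + t) ω) | past X s] =ᵐ[P]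
      fun ω => ∫ y, f (X s ω, y) ∂(Q t (X s ω)) := by
  have := h.kernel t
  have hm : Measurable fun ω => (X s ω, X (s + t) ω) :=
    (h.measurable s).prodMk (h.measurable (s + t))
  have hsm : StronglyMeasurable fun x => ∫ y, f (x, y) ∂(Q t x) :=
    hf.stronglyMeasurable.integral_kernel_prod_right'
  symm
  refine ae_eq_condExp_of_forall_setIntegral_eq (past_le h.measurable s) hi
    (fun A _ _ => (h.integrable_integral s t hf hi).integrableOn) (fun A hA _ => ?_) ?_
  · have h1 : Integrable f ((P.restrict A).map (X s) ⊗ₘ Q t) := by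
      rw [← h.map_restrict_prodMk s t hA]
      exact (integrable_map_measure hf.aestronglyMeasurable hm.aemeasurable).2 hi.integrableOn
    have h2 := Measure.integral_compProd h1
    rw [← h.map_restrict_prodMk s t hA,
      integral_map hm.aemeasurable hf.aestronglyMeasurable,
      integral_map (h.measurable s).aemeasurable hsm.aestronglyMeasurable] at h2
    exact h2.symm
  · exact (hsm.comp_measurable (measurable_past le_rfl)).aestronglyMeasurable

lemma IsMarkov.integral_mul (h : IsMarkov P X Q) (s t : ℝ≥0) {f : ℝ≥0 × ℝ≥0 → ℝ}
    (hf : Measurable f) (hi : Integrable (fun ω => f (X s ω, X (s + t) ω)) P) {φ : Ω → ℝ}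
    (hφ : Measurable[past X s] φ) {C : ℝ} (hφC : ∀ ω, |φ ω| ≤ C) :
    ∫ ω, φ ω * f (X s ω, X (s + t) ω) ∂P =
      ∫ ω, φ ω * ∫ y, f (X s ω, y) ∂(Q t (X s ω)) ∂P := by
  have hle := past_le h.measurable s
  rw [← integral_condExp hle]
  refine integral_congr_ae ?_
  have h1 := condExp_stronglyMeasurable_mul_of_bound hle hφ.stronglyMeasurable hi C
    (Eventually.of_forall hφC)
  filter_upwards [h1, h.condExp_prodMk s t hf hi] with ω h1 h2
  rw [← h2]
  exact h1

lemma IsMarkov.integral_eq (h : IsMarkov P X Q) (s t : ℝ≥0) {f : ℝ≥0 × ℝ≥0 → ℝ}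
    (hf : Measurable f) (hi : Integrable (fun ω => f (X s ω, X (s + t) ω)) P) :
    ∫ ω, f (X s ω, X (s + t) ω) ∂P = ∫ ω, ∫ y, f (X s ω, y) ∂(Q t (X s ω)) ∂P := by
  simpa using h.integral_mul s t hf hi (φ := fun _ => 1) measurable_const (C := 1) (by simp)

end Markov

end CBI

/-! ### Stationarity and mixing of the CBI-process -/

namespace CBI

section Stationary

set_option linter.unusedSectionVars false

variable {Ω : Type*} [mΩ : MeasurableSpace Ω] {P : Measure Ω} [IsProbabilityMeasure P]
  {X : ℝ≥0 → Ω → ℝ≥0} {Q : ℝ≥0 → Kernel ℝ≥0 ℝ≥0} {β b c : ℝ} {k : ℝ → ℝ}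

lemma IsStationaryCBI.exists_isMarkov (hX : IsStationaryCBI P β b c k X) :
    ∃ Q, IsTransitionSemigroup β b c k Q ∧ IsMarkov P X Q := by
  obtain ⟨Q, hQ, h⟩ := hX.markov
  exact ⟨Q, hQ, hX.measurable, hQ.markov, h⟩

lemma abs_exp_neg_mul_le {l : ℝ} (hl : 0 ≤ l) (x : ℝ≥0) : |Real.exp (-(l * (x : ℝ)))| ≤ 1 := by
  rw [abs_of_pos (Real.exp_pos _), Real.exp_le_one_iff]
  have := mul_nonneg hl x.2
  simpa using this

/-- The flow property turns the second integral into the part of the third beyond time `t`. This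
identity is the invariance of the stationary law at the level of Laplace exponents. -/
lemma integral_psi_v_shift (hβ : 0 ≤ β) (hb : 0 < b) (hc : 0 < c) (hk : MemK k)
    (hk1 : IntegrableOn (fun z => z * k z) (Ioi 0)) {t l : ℝ} (ht : 0 ≤ t) (hl : 0 ≤ l) :
    (∫ s in (0 : ℝ)..t, psi β k (v b c s l)) + ∫ s in Ioi (0 : ℝ), psi β k (v b c s (v b c t l)) =
      ∫ s in Ioi (0 : ℝ), psi β k (v b c s l) := by
  have hi := integrableOn_psi_v hβ hb hc hk hk1 hl
  have e1 : ∫ s in Ioi (0 : ℝ), psi β k (v b c s (v b c t l)) =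
      ∫ s in Ioi (0 : ℝ), psi β k (v b c (s + t) l) :=
    setIntegral_congr_fun measurableSet_Ioi fun s hs => by
      rw [v_add hb hc (le_of_lt hs) ht hl]
  have e2 : ∫ s in Ioi (0 : ℝ), psi β k (v b c (s + t) l) =
      ∫ s in Ioi t, psi β k (v b c s l) := by
    have := (measurePreserving_add_right volume t).setIntegral_preimage_emb
      (measurableEmbedding_addRight t) (fun s => psi β k (v b c s l)) (Ioi t)
    rwa [preimage_add_const_Ioi, sub_self] at this
  rw [e1, e2, intervalIntegral.integral_of_le ht, ← setIntegral_union Ioc_disjoint_Ioi_same measurableSet_Ioi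
      (hi.mono_set Ioc_subset_Ioi_self) (hi.mono_set (Ioi_subset_Ioi ht)), Ioc_union_Ioi_eq_Ioi ht]

lemma IsStationaryCBI.map_eq (hX : IsStationaryCBI P β b c k X) (hβ : 0 ≤ β) (hb : 0 < b)
    (hc : 0 < c) (hk : MemK k) (hk1 : IntegrableOn (fun z => z * k z) (Ioi 0)) (t : ℝ≥0) :
    P.map (X t) = P.map (X 0) := by
  obtain ⟨Q, hQ, hM⟩ := hX.exists_isMarkov
  have := Measure.isProbabilityMeasure_map (μ := P) (hX.measurable t).aemeasurable
  have := Measure.isProbabilityMeasure_map (μ := P) (hX.measurable 0).aemeasurable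
  refine Measure.ext_of_integral_exp_neg fun l hl => ?_
  have hme : ∀ l : ℝ, Measurable fun x : ℝ≥0 => Real.exp (-(l * (x : ℝ))) := fun l => by fun_prop
  rw [integral_map (hX.measurable t).aemeasurable (hme l).aestronglyMeasurable,
    integral_map (hX.measurable 0).aemeasurable (hme l).aestronglyMeasurable, hX.initial l hl]
  have hi : Integrable (fun ω => Real.exp (-(l * (X (0 + t) ω : ℝ)))) P :=
    Integrable.of_bound ((hme l).comp (hX.measurable _)).aestronglyMeasurable 1
      (Eventually.of_forall fun ω => abs_exp_neg_mul_le hl _)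
  have key := hM.integral_eq 0 t (f := fun p => Real.exp (-(l * (p.2 : ℝ))))
    ((hme l).comp measurable_snd) hi
  simp only [zero_add] at key
  rw [key]
  simp_rw [hQ.laplace t _ l hl]
  have hvt := v_nonneg hb hc t.coe_nonneg hl
  have e : ∀ ω, Real.exp (-((X 0 ω : ℝ) * v b c t l) - ∫ s in (0 : ℝ)..t, psi β k (v b c s l)) =
      Real.exp (-∫ s in (0 : ℝ)..t, psi β k (v b c s l)) *
        Real.exp (-(v b c t l * (X 0 ω : ℝ))) := fun ω => by
    rw [← Real.exp_add]; congr 1; ring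
  simp_rw [e]
  rw [integral_const_mul, hX.initial _ hvt, ← Real.exp_add]
  congr 1
  rw [← integral_psi_v_shift hβ hb hc hk hk1 t.coe_nonneg hl]
  ring

/-- The starting point enters only through `x * v_t(l)`, which vanishes as `t → ∞`; this is the
source of mixing. -/
lemma IsTransitionSemigroup.tendsto_laplace (hQ : IsTransitionSemigroup β b c k Q) (hβ : 0 ≤ β)
    (hb : 0 < b) (hc : 0 < c) (hk : MemK k) (hk1 : IntegrableOn (fun z => z * k z) (Ioi 0))
    (x : ℝ≥0) {l : ℝ} (hl : 0 ≤ l) :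
    Tendsto (fun m : ℕ => ∫ y, Real.exp (-(l * (y : ℝ))) ∂(Q m x)) atTop
      (𝓝 (Real.exp (-∫ s in Ioi (0 : ℝ), psi β k (v b c s l)))) := by
  simp_rw [hQ.laplace _ x l hl]
  refine (Real.continuous_exp.tendsto _).comp ?_
  have h1 : Tendsto (fun m : ℕ => ((m : ℝ≥0) : ℝ)) atTop atTop := by
    simpa using tendsto_natCast_atTop_atTop (R := ℝ)
  have h2 := ((tendsto_v_atTop hb hc hl).comp h1).const_mul (x : ℝ)
  have h3 := intervalIntegral_tendsto_integral_Ioi 0 (integrableOn_psi_v hβ hb hc hk hk1 hl) h1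
  simpa using h2.neg.sub h3

/-- Mixing in the form needed for the central limit theorem. -/
theorem IsStationaryCBI.exists_abs_integral_mul_sub_le (hX : IsStationaryCBI P β b c k X)
    (hβ : 0 ≤ β) (hb : 0 < b) (hc : 0 < c) (hk : MemK k)
    (hk1 : IntegrableOn (fun z => z * k z) (Ioi 0)) {q : ℝ≥0 → ℝ} (hqm : Measurable q)
    (hq : Integrable (fun ω => q (X 0 ω)) P) {ε : ℝ} (hε : 0 < ε) :
    ∃ m : ℕ, ∀ (s : ℝ≥0) (φ : Ω → ℝ), Measurable[past X s] φ → (∀ ω, |φ ω| ≤ 1) →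
      |∫ ω, φ ω * (q (X (s + m) ω) - ∫ ω, q (X 0 ω) ∂P) ∂P| ≤ ε := by
  obtain ⟨Q, hQ, hM⟩ := hX.exists_isMarkov
  have hXm := hX.measurable
  set η := P.map (X 0) with hη
  have hηp : IsProbabilityMeasure η :=
    Measure.isProbabilityMeasure_map (μ := P) (hXm 0).aemeasurable
  have hmap : ∀ t, P.map (X t) = η := fun t => hX.map_eq hβ hb hc hk hk1 t
  have hint : ∀ (f : ℝ≥0 → ℝ) (t : ℝ≥0), Measurable f →
      ∫ ω, f (X t ω) ∂P = ∫ x, f x ∂η := fun f t hf => by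
    rw [← hmap t, integral_map (hXm t).aemeasurable hf.aestronglyMeasurable]
  have hintb : ∀ (f : ℝ≥0 → ℝ) (t : ℝ≥0), Integrable f η → Integrable (fun ω => f (X t ω)) P :=
    fun f t hf => (show Integrable f (P.map (X t)) by rwa [hmap t]).comp_measurable (hXm t)
  have hqη : Integrable q η :=
    (integrable_map_measure hqm.aestronglyMeasurable (hXm 0).aemeasurable).2 hq
  -- For a polynomial in `e^{-x}` the kernels `Q m` converge pointwise with a uniform bound, so
  -- dominated convergence applies. Since `q` is only integrable, it is approximated in `L¹(η)`, and
  -- stationarity keeps the error the same at every time.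
  obtain ⟨p, hp⟩ := exists_polynomial_exp_neg_near hqη (show 0 < ε / 3 by positivity)
  set r : ℝ≥0 → ℝ := fun x => p.eval (Real.exp (-(x : ℝ))) with hr
  have hrm : Measurable r := (p.continuous.comp (by fun_prop)).measurable
  have hrη : Integrable r η := integrable_polynomial_exp_neg η p
  obtain ⟨C, hC⟩ := abs_polynomial_eval_le p
  have hrC : ∀ x, |r x| ≤ C := fun x => hC _ (exp_neg_coe_mem x)
  have hC0 : 0 ≤ C := (abs_nonneg _).trans (hrC 0)
  have hrI : |∫ x, r x ∂η| ≤ C := by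
    have := norm_integral_le_of_norm_le_const (μ := η) (f := r)
      (C := C) (Eventually.of_forall hrC)
    simpa using this
  have hrQ : ∀ (m : ℕ) x, |∫ y, r y ∂(Q m x)| ≤ C := fun m x => by
    have := hQ.markov m
    have := norm_integral_le_of_norm_le_const (μ := Q m x) (f := r)
      (C := C) (Eventually.of_forall hrC)
    simpa using this
  have hQm : ∀ m : ℕ, Measurable fun x => ∫ y, r y ∂(Q m x) := fun m =>
    have := hQ.markov m
    hrm.stronglyMeasurable.integral_kernel.measurable
  have hlim : Tendsto (fun m : ℕ => ∫ x, |(∫ y, r y ∂(Q m x)) - ∫ y, r y ∂η| ∂η) atTop (𝓝 0) := by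
    have h0 : ∀ x, Tendsto (fun m : ℕ => |(∫ y, r y ∂(Q m x)) - ∫ y, r y ∂η|) atTop (𝓝 0) := by
      intro x
      have h1 : Tendsto (fun m : ℕ => ∫ y, r y ∂(Q m x)) atTop (𝓝 (∫ y, r y ∂η)) := by
        have e : ∀ m : ℕ, ∫ y, r y ∂(Q m x) = ∑ i ∈ Finset.range (p.natDegree + 1),
            p.coeff i * ∫ y, Real.exp (-(i * (y : ℝ))) ∂(Q m x) := fun m =>
          have := hQ.markov m
          integral_polynomial_exp_neg _ p
        rw [integral_polynomial_exp_neg η p]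
        simp_rw [e]
        refine tendsto_finsetSum _ fun i _ => Tendsto.const_mul _ ?_
        rw [← hint _ 0 (by fun_prop), hX.initial _ (Nat.cast_nonneg i)]
        exact hQ.tendsto_laplace hβ hb hc hk hk1 x (Nat.cast_nonneg i)
      have h2 := (h1.sub_const (∫ y, r y ∂η)).abs
      simpa using h2
    have := tendsto_integral_of_dominated_convergence (μ := η)
      (F := fun (m : ℕ) x => |(∫ y, r y ∂(Q m x)) - ∫ y, r y ∂η|) (f := fun _ => 0)
      (fun _ => 2 * C) (fun m => (((hQm m).sub_const _).norm).aestronglyMeasurable)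
      (integrable_const _) (fun m => Eventually.of_forall fun x => ?_)
      (Eventually.of_forall h0)
    · simpa using this
    · rw [Real.norm_eq_abs, abs_abs]
      have := abs_sub (∫ y, r y ∂(Q m x)) (∫ y, r y ∂η)
      linarith [hrQ m x]
  obtain ⟨m, hm⟩ := (hlim.eventually (gt_mem_nhds (show 0 < ε / 3 by positivity))).exists
  refine ⟨m, fun s φ hφ hφ1 => ?_⟩
  have hφm : Measurable φ := hφ.mono (past_le hXm s) le_rfl
  have hbd : ∀ f : Ω → ℝ, Integrable f P → Integrable (fun ω => φ ω * f ω) P := fun f hf =>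
    hf.bdd_mul hφm.aestronglyMeasurable (Eventually.of_forall hφ1)
  have hbdi : ∀ f : Ω → ℝ, Integrable f P → |∫ ω, φ ω * f ω ∂P| ≤ ∫ ω, |f ω| ∂P := fun f hf => by
    refine (abs_integral_le_integral_abs).trans (integral_mono (hbd f hf).abs hf.abs fun ω => ?_)
    simp only
    rw [abs_mul]
    exact mul_le_of_le_one_left (abs_nonneg _) (hφ1 ω)
  have hi1 : Integrable (fun ω => q (X (s + m) ω) - r (X (s + m) ω)) P :=
    (hintb q _ hqη).sub (hintb r _ hrη)
  have hi2 : Integrable (fun ω => (∫ y, r y ∂(Q m (X s ω))) - ∫ y, r y ∂η) P := by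
    refine Integrable.sub (Integrable.of_bound ((hQm m).comp (hXm s)).aestronglyMeasurable C
      (Eventually.of_forall fun ω => hrQ m _)) (integrable_const _)
  have hi3 : Integrable (fun _ : Ω => (∫ y, r y ∂η) - ∫ y, q y ∂η) P := integrable_const _
  have h1 := hbdi _ hi1
  have h2 := hbdi _ hi2
  have h3 := hbdi _ hi3
  have e1 : ∫ ω, |q (X (s + m) ω) - r (X (s + m) ω)| ∂P = ∫ x, |q x - r x| ∂η :=
    hint (fun x => |q x - r x|) _ (hqm.sub hrm).norm
  have e2 : ∫ ω, |(∫ y, r y ∂(Q m (X s ω))) - ∫ y, r y ∂η| ∂P =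
      ∫ x, |(∫ y, r y ∂(Q m x)) - ∫ y, r y ∂η| ∂η :=
    hint (fun x => |(∫ y, r y ∂(Q m x)) - ∫ y, r y ∂η|) _ ((hQm m).sub_const _).norm
  have h4 : |(∫ y, r y ∂η) - ∫ y, q y ∂η| ≤ ∫ x, |q x - r x| ∂η := by
    rw [abs_sub_comm, ← integral_sub hqη hrη]
    exact abs_integral_le_integral_abs
  rw [integral_const, probReal_univ, one_smul] at h3
  have e4 : ∫ ω, φ ω * r (X (s + m) ω) ∂P = ∫ ω, φ ω * ∫ y, r y ∂(Q m (X s ω)) ∂P :=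
    hM.integral_mul s m (f := fun p => r p.2) (hrm.comp measurable_snd) (hintb r _ hrη) hφ hφ1
  -- Three errors of size `ε / 3`: approximation at time `s + m`, ergodicity of the approximant
  -- after conditioning on the past of `s`, and approximation of the mean.
  have e5 : ∫ ω, φ ω * (q (X (s + m) ω) - ∫ ω, q (X 0 ω) ∂P) ∂P =
      (∫ ω, φ ω * (q (X (s + m) ω) - r (X (s + m) ω)) ∂P) +
      (∫ ω, φ ω * ((∫ y, r y ∂(Q m (X s ω))) - ∫ y, r y ∂η) ∂P) +
      ∫ ω, φ ω * ((∫ y, r y ∂η) - ∫ y, q y ∂η) ∂P := by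
    have hb1 := hbd _ (hintb q (s + m) hqη)
    have hb2 := hbd _ (hintb r (s + m) hrη)
    have hb3 : Integrable (fun ω => φ ω * ∫ y, r y ∂(Q m (X s ω))) P :=
      hbd _ (Integrable.of_bound ((hQm m).comp (hXm s)).aestronglyMeasurable C
        (Eventually.of_forall fun ω => hrQ m _))
    have hb4 : ∀ a : ℝ, Integrable (fun ω => φ ω * a) P := fun a => hbd _ (integrable_const a)
    rw [hint q 0 hqm]
    simp only [mul_sub]
    rw [integral_sub hb1 (hb4 _), integral_sub hb1 hb2, integral_sub hb3 (hb4 _),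
      integral_sub (hb4 _) (hb4 _), e4]
    ring
  rw [e5]
  refine (abs_add_three _ _ _).trans ?_
  linarith

/-- A square integrable function of two successive observations with vanishing conditional mean
generates a mixing martingale difference sequence. -/
theorem IsStationaryCBI.isMixingMDS (hX : IsStationaryCBI P β b c k X) (hM : IsMarkov P X Q)
    (hβ : 0 ≤ β) (hb : 0 < b) (hc : 0 < c) (hk : MemK k)
    (hk1 : IntegrableOn (fun z => z * k z) (Ioi 0)) {f : ℝ≥0 × ℝ≥0 → ℝ} (hf : Measurable f)
    (hf2 : MemLp (fun ω => f (X 0 ω, X 1 ω)) 2 P)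
    (hf0 : ∀ᵐ ω ∂P, ∫ y, f (X 0 ω, y) ∂(Q 1 (X 0 ω)) = 0) :
    IsMixingMDS P (fun j => past X j) fun j ω => f (X j ω, X (j + 1) ω) := by
  have hXm := hX.measurable
  have hK := hM.kernel 1
  have hmap : ∀ t, P.map (X t) = P.map (X 0) := fun t => hX.map_eq hβ hb hc hk hk1 t
  have hpm : ∀ j : ℝ≥0, Measurable fun ω => (X j ω, X (j + 1) ω) := fun j =>
    (hXm j).prodMk (hXm (j + 1))
  have hid : ∀ j : ℝ≥0, IdentDistrib (fun ω => f (X j ω, X (j + 1) ω))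
      (fun ω => f (X 0 ω, X (0 + 1) ω)) P P := fun j => by
    have : IdentDistrib (fun ω => (X j ω, X (j + 1) ω)) (fun ω => (X 0 ω, X (0 + 1) ω)) P P :=
      ⟨(hpm j).aemeasurable, (hpm 0).aemeasurable, by rw [hM.map_prodMk, hM.map_prodMk, hmap j]⟩
    exact this.comp hf
  have hL2 : ∀ j : ℝ≥0, MemLp (fun ω => f (X j ω, X (j + 1) ω)) 2 P := fun j =>
    (hid j).symm.memLp_snd (by simpa using hf2)
  have hκ0 : ∀ j : ℝ≥0, ∀ᵐ ω ∂P, ∫ y, f (X j ω, y) ∂(Q 1 (X j ω)) = 0 := fun j => by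
    have hs : MeasurableSet {x : ℝ≥0 | ∫ y, f (x, y) ∂(Q 1 x) = 0} :=
      (hf.stronglyMeasurable.integral_kernel_prod_right' (κ := Q 1)).measurable
        (measurableSet_singleton 0)
    have h1 : ∀ᵐ x ∂(P.map (X 0)), ∫ y, f (x, y) ∂(Q 1 x) = 0 :=
      (ae_map_iff (hXm 0).aemeasurable hs).2 hf0
    rw [← hmap j] at h1
    exact (ae_map_iff (hXm j).aemeasurable hs).1 h1
  refine ⟨fun j => past_le hXm _, fun i j hij => past_mono (by exact_mod_cast hij), fun j => ?_,
    by simpa using hf2, fun j => by simpa using hid j, fun j φ hφ hφ1 => ?_, fun ε hε => ?_⟩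
  · refine hf.comp (Measurable.prodMk (measurable_past ?_) (measurable_past ?_))
    · push_cast; exact le_self_add
    · push_cast; exact le_rfl
  · rw [hM.integral_mul j 1 hf ((hL2 j).integrable one_le_two) hφ hφ1]
    refine integral_eq_zero_of_ae ?_
    filter_upwards [hκ0 j] with ω hω
    simp [hω]
  -- Conditioning one step back replaces the squared difference by the function `q` of a single
  -- observation, which is integrable; this is all the mixing theorem asks for.
  · set q : ℝ≥0 → ℝ := fun x => ∫ y, f (x, y) ^ 2 ∂(Q 1 x) with hq
    have hqm : Measurable q :=
      ((hf.pow_const 2).stronglyMeasurable.integral_kernel_prod_right' (κ := Q 1)).measurable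
    have hsq : ∀ j : ℝ≥0, Integrable (fun ω => f (X j ω, X (j + 1) ω) ^ 2) P := fun j =>
      (hL2 j).integrable_sq
    have hqi : Integrable (fun ω => q (X 0 ω)) P :=
      hM.integrable_integral 0 1 (hf.pow_const 2) (hsq 0)
    obtain ⟨m, hm⟩ := hX.exists_abs_integral_mul_sub_le hβ hb hc hk hk1 hqm hqi hε
    refine ⟨m, fun j φ hφ hφ1 => ?_⟩
    have h1 := hm j φ hφ hφ1
    have hφ' : Measurable[past X ((j : ℝ≥0) + m)] φ := hφ.mono (past_mono le_self_add) le_rfl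
    have hφm : Measurable φ := hφ.mono (past_le hXm _) le_rfl
    have e1 := hM.integral_mul (j + m) 1 (hf.pow_const 2) (hsq _) hφ' hφ1
    have e2 := hM.integral_eq 0 1 (hf.pow_const 2) (hsq 0)
    have hbd : ∀ g : Ω → ℝ, Integrable g P → Integrable (fun ω => φ ω * g ω) P := fun g hg =>
      hg.bdd_mul hφm.aestronglyMeasurable (Eventually.of_forall hφ1)
    have hqi' : Integrable (fun ω => q (X (j + m) ω)) P :=
      hM.integrable_integral (j + m) 1 (hf.pow_const 2) (hsq _)
    simp only [zero_add] at e2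
    simp only [Nat.cast_zero, Nat.cast_add, zero_add]
    simp only [mul_sub] at h1 ⊢
    rw [integral_sub (hbd _ hqi') (hbd _ (integrable_const _))] at h1
    rw [integral_sub (hbd _ (hsq _)) (hbd _ (integrable_const _)), e1, e2]
    exact h1

end Stationary

end CBI

/-! ### The logarithm of an empirical mean -/

lemma abs_log_one_add_sub_le {y : ℝ} (hy : -(1 / 2) ≤ y) : |Real.log (1 + y) - y| ≤ 2 * y ^ 2 := by
  have h0 : 0 < 1 + y := by linarith
  have h1 := Real.log_le_sub_one_of_pos h0
  have h2 := Real.one_sub_inv_le_log_of_pos h0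
  have h3 : y - (1 - (1 + y)⁻¹) ≤ 2 * y ^ 2 := by
    have : y - (1 - (1 + y)⁻¹) = y ^ 2 / (1 + y) := by field_simp; ring
    rw [this, div_le_iff₀ h0]
    nlinarith [sq_nonneg y]
  rw [abs_le]
  constructor <;> nlinarith [sq_nonneg y]

/-- Truncated bound for the remainder of the logarithm of `1 + y`, given a lower bound for the
logarithm. -/
lemma mul_log_remainder_sq_le {C n y x e K K' : ℝ} (hn : 0 < n) (hy : -1 < y)
    (hlog : -(C * (x / n + 1 + |e|)) ≤ Real.log (1 + y)) (hK : 0 ≤ K) (hK' : 0 ≤ K')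
    (hKn : 8 * K ≤ n) :
    n * (Real.log (1 + y) - y) ^ 2 ≤ (16 + 24 * C ^ 2) *
      (K ^ 2 / n + max (n * y ^ 2 - K) 0 + x ^ 2 / n + max (n * e ^ 2 - K') 0 +
        K' * (n * y ^ 2 / n)) := by
  set a1 := K ^ 2 / n with ha1
  set a2 := max (n * y ^ 2 - K) 0 with ha2
  set a3 := x ^ 2 / n with ha3
  set a4 := max (n * e ^ 2 - K') 0 with ha4
  have h1 : 0 ≤ a1 := by positivity
  have h2 : 0 ≤ a2 := le_max_right _ _
  have h3 : 0 ≤ a3 := by positivity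
  have h4 : 0 ≤ a4 := le_max_right _ _
  have e5 : n * y ^ 2 / n = y ^ 2 := by field_simp
  rw [e5]
  have h5 : 0 ≤ K' * y ^ 2 := by positivity
  have hC2 : 0 ≤ C ^ 2 := sq_nonneg C
  have ha2' : n * y ^ 2 - K ≤ a2 := le_max_left _ _
  have ha4' : n * e ^ 2 - K' ≤ a4 := le_max_left _ _
  have hfin : ∀ r, r ≤ 16 * (a1 + a2 + a3 + a4 + K' * y ^ 2) →
      r ≤ (16 + 24 * C ^ 2) * (a1 + a2 + a3 + a4 + K' * y ^ 2) := fun r hr => by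
    refine hr.trans (mul_le_mul_of_nonneg_right ?_ (by positivity))
    linarith
  -- For `|y| ≤ 1 / 2` the quadratic Taylor bound holds, and `n y²` is compared with `2 K`.
  -- Otherwise `n y² ≥ n / 4 ≥ 2 K`, so the excess over `K` dominates. For `y > 1 / 2` the remainder
  -- is at most `y`; for `y < -1 / 2` the assumed lower bound on the logarithm takes over.
  rcases le_or_gt (-(1 / 2)) y with hy1 | hy1
  · refine hfin _ ?_
    rcases le_or_gt y (1 / 2) with hy2 | hy2
    · have hR : (Real.log (1 + y) - y) ^ 2 ≤ (2 * y ^ 2) ^ 2 :=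
        sq_le_sq' (by linarith [(abs_le.1 (abs_log_one_add_sub_le hy1)).1])
          (abs_le.1 (abs_log_one_add_sub_le hy1)).2
      have hy3 : y ^ 2 ≤ 1 / 4 := by nlinarith
      have hR' : n * (Real.log (1 + y) - y) ^ 2 ≤ 4 * (n * y ^ 2) * y ^ 2 := by
        calc n * (Real.log (1 + y) - y) ^ 2 ≤ n * (2 * y ^ 2) ^ 2 := by gcongr
          _ = _ := by ring
      rcases le_or_gt (n * y ^ 2) (2 * K) with hz | hz
      · have : 4 * (n * y ^ 2) * y ^ 2 ≤ 16 * a1 := by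
          have : (n * y ^ 2) * (n * y ^ 2) ≤ (2 * K) * (2 * K) :=
            mul_le_mul hz hz (by positivity) (by positivity)
          rw [ha1, mul_div_assoc', le_div_iff₀ hn]
          nlinarith
        linarith
      · have : 4 * (n * y ^ 2) * y ^ 2 ≤ n * y ^ 2 := by
          have : 0 ≤ n * y ^ 2 := by positivity
          nlinarith
        linarith
    · have hl0 : 0 ≤ Real.log (1 + y) := Real.log_nonneg (by linarith)
      have hl1 := Real.log_le_sub_one_of_pos (show 0 < 1 + y by linarith)
      have hR : (Real.log (1 + y) - y) ^ 2 ≤ y ^ 2 := sq_le_sq' (by linarith) (by linarith)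
      have hR' : n * (Real.log (1 + y) - y) ^ 2 ≤ n * y ^ 2 := by gcongr
      have : n * (1 / 4) ≤ n * y ^ 2 := by gcongr; nlinarith
      linarith
  · have hl1 := Real.log_le_sub_one_of_pos (show 0 < 1 + y by linarith)
    have hR : (Real.log (1 + y) - y) ^ 2 ≤ (C * (x / n + 1 + |e|)) ^ 2 := by
      rw [← neg_sq]
      exact sq_le_sq' (by linarith) (by linarith)
    have h3' : (x / n + 1 + |e|) ^ 2 ≤ 3 * ((x / n) ^ 2 + 1 + e ^ 2) := by
      rw [← sq_abs e]
      nlinarith [sq_nonneg (x / n - 1), sq_nonneg (x / n - |e|), sq_nonneg (1 - |e|)]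
    have h6 : n * ((x / n) ^ 2 + 1 + e ^ 2) ≤ 8 * (a1 + a2 + a3 + a4 + K' * y ^ 2) := by
      have e1 : n * (x / n) ^ 2 = a3 := by rw [ha3]; field_simp
      have hyq : 1 / 4 ≤ y ^ 2 := by nlinarith
      have e2 : n * (1 / 4) ≤ n * y ^ 2 := by gcongr
      have e3 : K' * (1 / 4) ≤ K' * y ^ 2 := by gcongr
      have e4 : n * ((x / n) ^ 2 + 1 + e ^ 2) = n * (x / n) ^ 2 + n + n * e ^ 2 := by ring
      rw [e4, e1]
      linarith
    calc n * (Real.log (1 + y) - y) ^ 2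
        ≤ n * (C * (x / n + 1 + |e|)) ^ 2 := by gcongr
      _ = C ^ 2 * (n * (x / n + 1 + |e|) ^ 2) := by ring
      _ ≤ C ^ 2 * (n * (3 * ((x / n) ^ 2 + 1 + e ^ 2))) := by gcongr
      _ = 3 * C ^ 2 * (n * ((x / n) ^ 2 + 1 + e ^ 2)) := by ring
      _ ≤ 3 * C ^ 2 * (8 * (a1 + a2 + a3 + a4 + K' * y ^ 2)) := by gcongr
      _ = (0 + 24 * C ^ 2) * (a1 + a2 + a3 + a4 + K' * y ^ 2) := by ring
      _ ≤ _ := by gcongr; norm_num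

namespace IsMixingMDS

variable {Ω : Type*} [m0 : MeasurableSpace Ω] {P : Measure Ω} [IsProbabilityMeasure P]
  {F : ℕ → MeasurableSpace Ω} {D E : ℕ → Ω → ℝ}

lemma integrable_mean_sq (h : IsMixingMDS P F D) (n : ℕ) :
    Integrable (fun ω => (n : ℝ) * ((n : ℝ)⁻¹ * ∑ j ∈ Finset.range n, D j ω) ^ 2) P := by
  refine ((h.memLp_sum n).integrable_sq.const_mul ((n : ℝ) * (n : ℝ)⁻¹ ^ 2)).congr
    (Eventually.of_forall fun ω => ?_)
  simp only
  ring

lemma integral_mean_sq (h : IsMixingMDS P F D) {n : ℕ} (hn : 1 ≤ n) :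
    ∫ ω, (n : ℝ) * ((n : ℝ)⁻¹ * ∑ j ∈ Finset.range n, D j ω) ^ 2 ∂P = ∫ ω, D 0 ω ^ 2 ∂P := by
  have h0 : (n : ℝ) ≠ 0 := by positivity
  have e : ∀ ω, (n : ℝ) * ((n : ℝ)⁻¹ * ∑ j ∈ Finset.range n, D j ω) ^ 2 =
      (n : ℝ)⁻¹ * (∑ j ∈ Finset.range n, D j ω) ^ 2 := fun ω => by field_simp
  simp_rw [e]
  rw [integral_const_mul, h.integral_sum_sq, inv_mul_cancel_left₀ h0]

/-- Uniform integrability of the squares of the normalized sums. -/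
theorem exists_integral_mean_max_sub_le (h : IsMixingMDS P F D) {ε : ℝ} (hε : 0 < ε) :
    ∃ K : ℝ, 0 ≤ K ∧ ∀ᶠ n : ℕ in atTop,
      ∫ ω, max ((n : ℝ) * ((n : ℝ)⁻¹ * ∑ j ∈ Finset.range n, D j ω) ^ 2 - K) 0 ∂P ≤ ε := by
  set σ2 : ℝ≥0 := ⟨∫ ω, D 0 ω ^ 2 ∂P, integral_nonneg fun ω => sq_nonneg _⟩ with hσ2
  have hm : ∀ n : ℕ, Measurable fun ω => (√n)⁻¹ * ∑ j ∈ Finset.range n, D j ω := fun n =>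
    (Finset.measurable_sum _ fun j _ => h.measurable j).const_mul _
  set μ : ℕ → ProbabilityMeasure ℝ := fun n =>
    ⟨P.map fun ω => (√n)⁻¹ * ∑ j ∈ Finset.range n, D j ω,
      Measure.isProbabilityMeasure_map (hm n).aemeasurable⟩ with hμ
  set μ₀ : ProbabilityMeasure ℝ := ⟨gaussianReal 0 σ2, inferInstance⟩ with hμ₀
  have hconv : Tendsto μ atTop (𝓝 μ₀) := by
    refine ProbabilityMeasure.tendsto_iff_tendsto_charFun.2 fun t => ?_
    have h1 := h.tendsto_charFun t
    have e1 : charFun (μ₀ : Measure ℝ) t =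
        Complex.exp (-((t ^ 2 * (∫ ω, D 0 ω ^ 2 ∂P) / 2 : ℝ) : ℂ)) := by
      change charFun (gaussianReal 0 σ2) t = _
      rw [charFun_gaussianReal]
      congr 1
      have : ((σ2 : ℝ) : ℂ) = ((∫ ω, D 0 ω ^ 2 ∂P : ℝ) : ℂ) := rfl
      push_cast
      rw [this]
      ring
    rw [e1]
    refine h1.congr fun n => ?_
    change _ = charFun (P.map fun ω => (√n)⁻¹ * ∑ j ∈ Finset.range n, D j ω) t
    rw [charFun_apply_real, integral_map (hm n).aemeasurable
      (Measurable.aestronglyMeasurable (by fun_prop))]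
    refine integral_congr_ae (Eventually.of_forall fun ω => ?_)
    simp only
    congr 1
    push_cast
    ring
  have hsq : ∀ n : ℕ, 1 ≤ n → ∀ ω, ‖(√n)⁻¹ * ∑ j ∈ Finset.range n, D j ω‖ ^ 2 =
      (n : ℝ) * ((n : ℝ)⁻¹ * ∑ j ∈ Finset.range n, D j ω) ^ 2 := fun n hn ω => by
    have h0 : (n : ℝ) ≠ 0 := by positivity
    rw [Real.norm_eq_abs, sq_abs, mul_pow, inv_pow, Real.sq_sqrt (by positivity)]
    field_simp
  have hi : ∀ᶠ n in atTop, Integrable (fun z => ‖z‖ ^ 2) (μ n : Measure ℝ) := by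
    filter_upwards [eventually_ge_atTop 1] with n hn
    refine (integrable_map_measure (by fun_prop) (hm n).aemeasurable).2 ?_
    exact (h.integrable_mean_sq n).congr (Eventually.of_forall fun ω => (hsq n hn ω).symm)
  have hV : ∀ᶠ n in atTop, ∫ z, ‖z‖ ^ 2 ∂(μ n : Measure ℝ) = σ2 := by
    filter_upwards [eventually_ge_atTop 1] with n hn
    change ∫ z, ‖z‖ ^ 2 ∂(P.map fun ω => (√n)⁻¹ * ∑ j ∈ Finset.range n, D j ω) = _
    rw [integral_map (hm n).aemeasurable (by fun_prop)]
    simp_rw [hsq n hn]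
    exact h.integral_mean_sq hn
  have hi₀ : Integrable (fun z => ‖z‖ ^ 2) (μ₀ : Measure ℝ) := by
    have := (memLp_id_gaussianReal (μ := 0) (v := σ2) 2).integrable_norm_pow (by norm_num)
    simpa [μ₀] using this
  have hV₀ : ∫ z, ‖z‖ ^ 2 ∂(μ₀ : Measure ℝ) = σ2 := by
    change ∫ z, ‖z‖ ^ 2 ∂(gaussianReal 0 σ2) = _
    have h1 := variance_id_gaussianReal (μ := 0) (v := σ2)
    rw [variance_of_integral_eq_zero aemeasurable_id (by simp)] at h1
    simpa using h1
  obtain ⟨K, hK, hK1, -⟩ := exists_integral_max_sub_le hconv hi hV hi₀ hV₀ hε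
  refine ⟨K, hK, ?_⟩
  filter_upwards [hK1, eventually_ge_atTop 1] with n hn hn1
  change ∫ z, max (‖z‖ ^ 2 - K) 0 ∂(P.map fun ω => (√n)⁻¹ * ∑ j ∈ Finset.range n, D j ω) ≤ _ at hn
  rw [integral_map (hm n).aemeasurable (by fun_prop)] at hn
  simp_rw [hsq n hn1] at hn
  exact hn

lemma lintegral_log_remainder_le_aux (hD : IsMixingMDS P F D) (hE : IsMixingMDS P F E) {x : Ω → ℝ}
    (hx : MemLp x 2 P) {C K K' : ℝ} (hK : 0 ≤ K) (hK' : 0 ≤ K') {n : ℕ} (hn : 1 ≤ n)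
    (hKn : 8 * K ≤ n)
    (hY : ∀ ω, -1 < (n : ℝ)⁻¹ * ∑ j ∈ Finset.range n, D j ω)
    (hlog : ∀ ω, -(C * (x ω / n + 1 + |(n : ℝ)⁻¹ * ∑ j ∈ Finset.range n, E j ω|)) ≤
      Real.log (1 + (n : ℝ)⁻¹ * ∑ j ∈ Finset.range n, D j ω)) :
    ∫⁻ ω, ENNReal.ofReal (n * (Real.log (1 + (n : ℝ)⁻¹ * ∑ j ∈ Finset.range n, D j ω) -
        (n : ℝ)⁻¹ * ∑ j ∈ Finset.range n, D j ω) ^ 2) ∂P ≤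
      ENNReal.ofReal ((16 + 24 * C ^ 2) * (K ^ 2 / n +
        (∫ ω, max ((n : ℝ) * ((n : ℝ)⁻¹ * ∑ j ∈ Finset.range n, D j ω) ^ 2 - K) 0 ∂P) +
        (∫ ω, x ω ^ 2 ∂P) / n +
        (∫ ω, max ((n : ℝ) * ((n : ℝ)⁻¹ * ∑ j ∈ Finset.range n, E j ω) ^ 2 - K') 0 ∂P) +
        K' * ((∫ ω, D 0 ω ^ 2 ∂P) / n))) := by
  have hn0 : (0 : ℝ) < n := by exact_mod_cast hn
  have i1 : Integrable (fun _ : Ω => K ^ 2 / (n : ℝ)) P := integrable_const _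
  have i2 : Integrable (fun ω => max ((n : ℝ) * ((n : ℝ)⁻¹ * ∑ j ∈ Finset.range n, D j ω) ^ 2 - K)
      0) P := ((hD.integrable_mean_sq n).sub (integrable_const _)).pos_part
  have i3 : Integrable (fun ω => x ω ^ 2 / n) P := hx.integrable_sq.div_const _
  have i4 : Integrable (fun ω => max ((n : ℝ) * ((n : ℝ)⁻¹ * ∑ j ∈ Finset.range n, E j ω) ^ 2 - K')
      0) P := ((hE.integrable_mean_sq n).sub (integrable_const _)).pos_part
  have i5 : Integrable (fun ω => K' * ((n : ℝ) * ((n : ℝ)⁻¹ * ∑ j ∈ Finset.range n, D j ω) ^ 2 / n))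
      P := ((hD.integrable_mean_sq n).div_const _).const_mul _
  rw [← hD.integral_mean_sq hn, ← integral_div, ← integral_div, ← integral_const_mul]
  have e1 : K ^ 2 / (n : ℝ) = ∫ _, K ^ 2 / (n : ℝ) ∂P := by simp
  rw [e1, ← integral_add i1 i2, ← integral_add (by exact i1.add i2) i3,
    ← integral_add (by exact (i1.add i2).add i3) i4,
    ← integral_add (by exact ((i1.add i2).add i3).add i4) i5, ← integral_const_mul,
    ofReal_integral_eq_lintegral_ofReal]
  · exact lintegral_mono fun ω => ENNReal.ofReal_le_ofReal
      (mul_log_remainder_sq_le hn0 (hY ω) (hlog ω) hK hK' hKn)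
  · exact (((((i1.add i2).add i3).add i4).add i5).const_mul _)
  · exact Eventually.of_forall fun ω => by positivity

/-- The choice `K = K' = 0` gives a bound uniform in `n`, which later serves as the dominating
constant when integrating over `l`. -/
theorem lintegral_log_remainder_le (hD : IsMixingMDS P F D) (hE : IsMixingMDS P F E) {x : Ω → ℝ}
    (hx : MemLp x 2 P) {C : ℝ} {n : ℕ} (hn : 1 ≤ n)
    (hY : ∀ ω, -1 < (n : ℝ)⁻¹ * ∑ j ∈ Finset.range n, D j ω)
    (hlog : ∀ ω, -(C * (x ω / n + 1 + |(n : ℝ)⁻¹ * ∑ j ∈ Finset.range n, E j ω|)) ≤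
      Real.log (1 + (n : ℝ)⁻¹ * ∑ j ∈ Finset.range n, D j ω)) :
    ∫⁻ ω, ENNReal.ofReal (n * (Real.log (1 + (n : ℝ)⁻¹ * ∑ j ∈ Finset.range n, D j ω) -
        (n : ℝ)⁻¹ * ∑ j ∈ Finset.range n, D j ω) ^ 2) ∂P ≤
      ENNReal.ofReal ((16 + 24 * C ^ 2) * ((∫ ω, D 0 ω ^ 2 ∂P) + (∫ ω, x ω ^ 2 ∂P) +
        ∫ ω, E 0 ω ^ 2 ∂P)) := by
  refine (hD.lintegral_log_remainder_le_aux hE hx le_rfl le_rfl hn (by simp) hY hlog).trans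
    (ENNReal.ofReal_le_ofReal ?_)
  have hn0 : (1 : ℝ) ≤ n := by exact_mod_cast hn
  have e : ∀ y : ℝ, max ((n : ℝ) * y ^ 2 - 0) 0 = n * y ^ 2 := fun y => by
    rw [sub_zero]; exact max_eq_left (by positivity)
  simp_rw [e]
  rw [hD.integral_mean_sq hn, hE.integral_mean_sq hn]
  have h1 : (∫ ω, x ω ^ 2 ∂P) / n ≤ ∫ ω, x ω ^ 2 ∂P :=
    div_le_self (integral_nonneg fun ω => sq_nonneg _) hn0
  refine mul_le_mul_of_nonneg_left ?_ (by positivity)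
  simp only [ne_eq, OfNat.ofNat_ne_zero, not_false_eq_true, zero_pow, zero_div, zero_add, zero_mul,
    add_zero]
  linarith

/-- The logarithm of one plus the mean of martingale differences is linearized with an error that
is `o(n ^ (-1/2))` in `L²`. -/
theorem tendsto_lintegral_log_remainder (hD : IsMixingMDS P F D) (hE : IsMixingMDS P F E)
    {x : Ω → ℝ} (hx : MemLp x 2 P) {C : ℝ}
    (hY : ∀ n : ℕ, 1 ≤ n → ∀ ω, -1 < (n : ℝ)⁻¹ * ∑ j ∈ Finset.range n, D j ω)
    (hlog : ∀ n : ℕ, 1 ≤ n → ∀ ω,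
      -(C * (x ω / n + 1 + |(n : ℝ)⁻¹ * ∑ j ∈ Finset.range n, E j ω|)) ≤
      Real.log (1 + (n : ℝ)⁻¹ * ∑ j ∈ Finset.range n, D j ω)) :
    Tendsto (fun n : ℕ => ∫⁻ ω, ENNReal.ofReal
      (n * (Real.log (1 + (n : ℝ)⁻¹ * ∑ j ∈ Finset.range n, D j ω) -
        (n : ℝ)⁻¹ * ∑ j ∈ Finset.range n, D j ω) ^ 2) ∂P) atTop (𝓝 0) := by
  set A := 16 + 24 * C ^ 2 with hA
  have hA0 : 0 < A := by positivity
  have key : ∀ ε : ℝ, 0 < ε → ∀ᶠ n : ℕ in atTop, ∫⁻ ω, ENNReal.ofReal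
      (n * (Real.log (1 + (n : ℝ)⁻¹ * ∑ j ∈ Finset.range n, D j ω) -
        (n : ℝ)⁻¹ * ∑ j ∈ Finset.range n, D j ω) ^ 2) ∂P ≤ ENNReal.ofReal ε := by
    intro ε hε
    have hε' : 0 < ε / (5 * A) := by positivity
    obtain ⟨K, hK, hK1⟩ := hD.exists_integral_mean_max_sub_le hε'
    obtain ⟨K', hK', hK1'⟩ := hE.exists_integral_mean_max_sub_le hε'
    have t1 := tendsto_const_div_atTop_nhds_zero_nat (K ^ 2)
    have t2 := tendsto_const_div_atTop_nhds_zero_nat (∫ ω, x ω ^ 2 ∂P)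
    have t3 := (tendsto_const_div_atTop_nhds_zero_nat (∫ ω, D 0 ω ^ 2 ∂P)).const_mul K'
    rw [mul_zero] at t3
    filter_upwards [hK1, hK1', t1.eventually (gt_mem_nhds hε'), t2.eventually (gt_mem_nhds hε'),
      t3.eventually (gt_mem_nhds hε'), eventually_ge_atTop 1,
      tendsto_natCast_atTop_atTop.eventually_ge_atTop (8 * K)] with n h1 h2 h3 h4 h5 hn hn'
    refine (hD.lintegral_log_remainder_le_aux hE hx hK hK' hn hn' (hY n hn) (hlog n hn)).trans
      (ENNReal.ofReal_le_ofReal ?_)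
    calc _ ≤ A * (ε / (5 * A) + ε / (5 * A) + ε / (5 * A) + ε / (5 * A) + ε / (5 * A)) := by
          gcongr
      _ = ε := by field_simp; norm_num
  rw [ENNReal.tendsto_atTop_zero]
  intro δ hδ
  rcases eq_or_ne δ ∞ with rfl | hδt
  · exact ⟨0, fun n _ => le_top⟩
  · obtain ⟨N, hN⟩ := eventually_atTop.1 (key δ.toReal (ENNReal.toReal_pos hδ.ne' hδt))
    exact ⟨N, fun n hn => (hN n hn).trans (ENNReal.ofReal_toReal hδt).le⟩

end IsMixingMDS

/-! ### Moments of two successive observations -/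

namespace CBI

section Moments

set_option linter.unusedSectionVars false

variable {Ω : Type*} [mΩ : MeasurableSpace Ω] {P : Measure Ω} [IsProbabilityMeasure P]
  {X : ℝ≥0 → Ω → ℝ≥0} {Q : ℝ≥0 → Kernel ℝ≥0 ℝ≥0} {β b c : ℝ} {k : ℝ → ℝ}

lemma v_one_eq (b c l : ℝ) :
    v b c 1 l = Real.exp (-b) * l / (1 + c / b * (1 - Real.exp (-b)) * l) := by
  unfold v
  rw [mul_one]
  congr 2
  ring

/-- With `q = e^{-b}` and `A = c (1 - q) / b`, the quantity equals `2 q A l² / (1 + 3 A l + 2 A²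
l²)`. It increases in `l` towards `q / A`, the critical exponent, without reaching it. It is the
exponential rate in `X 0` of the second moment of the score. -/
lemma exists_two_mul_v_sub_le (hb : 0 < b) (hc : 0 < c) {Λ : ℝ} (hΛ : 0 ≤ Λ) :
    ∃ θ < critExp b c, ∀ l ∈ Icc 0 Λ, 2 * v b c 1 l - v b c 1 (2 * l) ≤ θ := by
  have hq := exp_neg_lt_one hb
  have hq0 := Real.exp_pos (-b)
  set q := Real.exp (-b) with hqdef
  set A := c / b * (1 - q) with hA
  have hA0 : 0 < A := mul_pos (by positivity) (by linarith)
  have hcrit : critExp b c = q / A := by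
    have : 0 < 1 - q := by linarith
    rw [critExp, ← hqdef, hA]; field_simp
  have heq : ∀ l, 0 ≤ l → 2 * v b c 1 l - v b c 1 (2 * l) =
      2 * q * A * l ^ 2 / (1 + 3 * A * l + 2 * A ^ 2 * l ^ 2) := by
    intro l hl
    rw [v_one_eq, v_one_eq, ← hqdef, ← hA]
    have h1 : 0 < 1 + A * l := by positivity
    have h2 : 0 < 1 + A * (2 * l) := by positivity
    have h3 : 0 < 1 + 3 * A * l + 2 * A ^ 2 * l ^ 2 := by positivity
    field_simp
    ring
  refine ⟨2 * q * A * Λ ^ 2 / (1 + 3 * A * Λ + 2 * A ^ 2 * Λ ^ 2), ?_, fun l hl => ?_⟩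
  · rw [hcrit, div_lt_div_iff₀ (by positivity) hA0]
    have : 0 ≤ 3 * A * Λ := by positivity
    nlinarith
  · have hl0 := hl.1
    rw [heq l hl.1, div_le_div_iff₀ (by positivity) (by positivity)]
    have h1 : l ^ 2 ≤ Λ ^ 2 := pow_le_pow_left₀ hl.1 hl.2 2
    have h2 : l ^ 2 * Λ ≤ Λ ^ 2 * l := by nlinarith [mul_nonneg (mul_nonneg hl.1 hΛ) (sub_nonneg.2 hl.2)]
    have h3 : l ^ 2 * (1 + 3 * A * Λ + 2 * A ^ 2 * Λ ^ 2) ≤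
        Λ ^ 2 * (1 + 3 * A * l + 2 * A ^ 2 * l ^ 2) := by
      nlinarith [mul_le_mul_of_nonneg_left h2 hA0.le]
    calc _ = 2 * q * A * (l ^ 2 * (1 + 3 * A * Λ + 2 * A ^ 2 * Λ ^ 2)) := by ring
      _ ≤ 2 * q * A * (Λ ^ 2 * (1 + 3 * A * l + 2 * A ^ 2 * l ^ 2)) := by gcongr
      _ = _ := by ring

lemma g₂_nonpos (hβ : 0 ≤ β) (hb : 0 < b) (hc : 0 < c) (hk : MemK k) {l : ℝ} (hl : 0 ≤ l) :
    g₂ β b c k l ≤ 0 :=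
  neg_nonpos.2 <| intervalIntegral.integral_nonneg zero_le_one fun _ hs =>
    psi_nonneg hβ hk (v_nonneg hb hc hs.1 hl)

lemma meanRate_nonneg (hβ : 0 ≤ β) (hk : MemK k) : 0 ≤ β + ∫ u in Ioi 0, u * k u :=
  add_nonneg hβ (setIntegral_nonneg measurableSet_Ioi fun u hu =>
    mul_nonneg (le_of_lt hu) (hk.nonneg u hu))

lemma intervalIntegrable_psi_v (β : ℝ) (hb : 0 < b) (hc : 0 < c) (hk : MemK k) {l : ℝ}
    (hl : 0 ≤ l) : IntervalIntegrable (fun s => psi β k (v b c s l)) volume 0 1 :=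
  ((continuousOn_psi_v β hb hc hk hl).mono
    (by rw [uIcc_of_le zero_le_one]; exact Icc_subset_Ici_self)).intervalIntegrable

lemma neg_g₂_le (hβ : 0 ≤ β) (hb : 0 < b) (hc : 0 < c) (hk : MemK k)
    (hk1 : IntegrableOn (fun z => z * k z) (Ioi 0)) {l : ℝ} (hl : 0 ≤ l) :
    -g₂ β b c k l ≤ (β + ∫ u in Ioi 0, u * k u) * l := by
  have hm := meanRate_nonneg hβ hk
  rw [g₂, neg_neg]
  calc ∫ s in (0 : ℝ)..1, psi β k (v b c s l)
      ≤ ∫ s in (0 : ℝ)..1, (β + ∫ u in Ioi 0, u * k u) * l := by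
        refine intervalIntegral.integral_mono_on zero_le_one
          (intervalIntegrable_psi_v β hb hc hk hl) intervalIntegrable_const fun s hs => ?_
        exact (psi_le hk hk1 (v_nonneg hb hc hs.1 hl)).trans
          (mul_le_mul_of_nonneg_left (v_le_self hb hc hs.1 hl) hm)
    _ = _ := by simp

lemma IsTransitionSemigroup.laplace_one (hQ : IsTransitionSemigroup β b c k Q) (x : ℝ≥0) {l : ℝ}
    (hl : 0 ≤ l) : ∫ y, Real.exp (-(l * (y : ℝ))) ∂(Q 1 x) =
      Real.exp (-((x : ℝ) * v b c 1 l) + g₂ β b c k l) := by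
  rw [hQ.laplace 1 x l hl, NNReal.coe_one, g₂, sub_eq_add_neg]

lemma IsTransitionSemigroup.lintegral_exp (hQ : IsTransitionSemigroup β b c k Q) (x : ℝ≥0) {l : ℝ}
    (hl : 0 ≤ l) : ∫⁻ y, ENNReal.ofReal (Real.exp (-(l * (y : ℝ)))) ∂(Q 1 x) =
      ENNReal.ofReal (Real.exp (-((x : ℝ) * v b c 1 l) + g₂ β b c k l)) := by
  have := hQ.markov 1
  rw [← hQ.laplace_one x hl, ofReal_integral_eq_lintegral_ofReal]
  · exact Integrable.of_bound (by fun_prop) 1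
      (Eventually.of_forall fun y => abs_exp_neg_mul_le hl y)
  · exact Eventually.of_forall fun y => (Real.exp_pos _).le

/-- `g₂` agrees on the half-line with a measurable function. -/
lemma IsTransitionSemigroup.exists_measurable_eq_g₂ (hQ : IsTransitionSemigroup β b c k Q) :
    ∃ γ : ℝ → ℝ, Measurable γ ∧ ∀ l, 0 ≤ l → γ l = g₂ β b c k l := by
  have := hQ.markov 1
  refine ⟨fun l => Real.log (∫ y, Real.exp (-(l * (y : ℝ))) ∂(Q 1 0)), ?_, fun l hl => ?_⟩
  · have : StronglyMeasurable fun l : ℝ => ∫ y : ℝ≥0, Real.exp (-(l * (y : ℝ))) ∂(Q 1 0) :=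
      StronglyMeasurable.integral_prod_right (f := fun (l : ℝ) (y : ℝ≥0) =>
        Real.exp (-(l * (y : ℝ)))) (Measurable.stronglyMeasurable (by fun_prop))
    exact this.measurable.log
  · simp only
    rw [hQ.laplace_one 0 hl, Real.log_exp]
    simp

/-- The mean is the limit of `(1 - e^{-l y}) / l` as `l → 0`. Fatou's lemma reduces it to the
Laplace transform, whose exponent is linear in `l` up to a bound. -/
lemma IsTransitionSemigroup.lintegral_id_le (hQ : IsTransitionSemigroup β b c k Q) (hβ : 0 ≤ β)
    (hb : 0 < b) (hc : 0 < c) (hk : MemK k) (hk1 : IntegrableOn (fun z => z * k z) (Ioi 0))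
    (x : ℝ≥0) : ∫⁻ y : ℝ≥0, ENNReal.ofReal (y : ℝ) ∂(Q 1 x) ≤
      ENNReal.ofReal (Real.exp (-b) * x + (β + ∫ u in Ioi 0, u * k u)) := by
  have := hQ.markov 1
  set m := β + ∫ u in Ioi 0, u * k u with hm
  set l : ℕ → ℝ := fun n => 1 / ((n : ℝ) + 1) with hl
  have hl0 : ∀ n, 0 < l n := fun n => by positivity
  have hlt : Tendsto l atTop (𝓝 0) := tendsto_one_div_add_atTop_nhds_zero_nat
  have hpt : ∀ y : ℝ≥0, Tendsto (fun n => ENNReal.ofReal ((1 - Real.exp (-(l n * (y : ℝ)))) / l n))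
      atTop (𝓝 (ENNReal.ofReal (y : ℝ))) := by
    intro y
    refine (ENNReal.continuous_ofReal.tendsto _).comp ?_
    have hd : HasDerivAt (fun t : ℝ => 1 - Real.exp (-(t * (y : ℝ)))) (y : ℝ) 0 := by
      have h1 : HasDerivAt (fun t : ℝ => -(t * (y : ℝ))) (-(y : ℝ)) 0 := by
        have := ((hasDerivAt_id (0 : ℝ)).mul_const (y : ℝ)).neg
        rw [one_mul] at this
        exact this
      simpa using h1.exp.const_sub 1
    have h2 := (hasDerivAt_iff_tendsto_slope.1 hd).comp
      (tendsto_nhdsWithin_iff.2 ⟨hlt, Eventually.of_forall fun n => (hl0 n).ne'⟩)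
    refine h2.congr fun n => ?_
    simp [slope_def_field]
  calc ∫⁻ y : ℝ≥0, ENNReal.ofReal (y : ℝ) ∂(Q 1 x)
      = ∫⁻ y, liminf (fun n => ENNReal.ofReal ((1 - Real.exp (-(l n * (y : ℝ)))) / l n)) atTop
          ∂(Q 1 x) := lintegral_congr fun y => (hpt y).liminf_eq.symm
    _ ≤ liminf (fun n => ∫⁻ y : ℝ≥0, ENNReal.ofReal ((1 - Real.exp (-(l n * (y : ℝ)))) / l n)
          ∂(Q 1 x)) atTop := lintegral_liminf_le fun n => by fun_prop
    _ ≤ liminf (fun _ : ℕ => ENNReal.ofReal (Real.exp (-b) * x + m)) atTop := by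
        refine liminf_le_liminf (Eventually.of_forall fun n => ?_)
        have hi : Integrable (fun y : ℝ≥0 => Real.exp (-(l n * (y : ℝ)))) (Q 1 x) :=
          Integrable.of_bound (by fun_prop) 1
            (Eventually.of_forall fun y => abs_exp_neg_mul_le (hl0 n).le y)
        rw [← ofReal_integral_eq_lintegral_ofReal]
        · refine ENNReal.ofReal_le_ofReal ?_
          rw [integral_div, integral_sub (integrable_const _) hi, integral_const, probReal_univ,
            one_smul, hQ.laplace_one x (hl0 n).le, div_le_iff₀ (hl0 n)]
          have h1 := Real.add_one_le_exp (-((x : ℝ) * v b c 1 (l n)) + g₂ β b c k (l n))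
          have h2 := neg_g₂_le hβ hb hc hk hk1 (hl0 n).le
          have h3 := v_le hb hc zero_le_one (hl0 n).le
          rw [mul_one] at h3
          have h4 := mul_le_mul_of_nonneg_left h3 x.coe_nonneg
          rw [← hm] at h2
          nlinarith
        · exact ((integrable_const _).sub hi).div_const _
        · exact Eventually.of_forall fun y => by
            have := (abs_le.1 (abs_exp_neg_mul_le (hl0 n).le y)).2
            exact div_nonneg (by linarith) (hl0 n).le
    _ = _ := liminf_const _

lemma IsTransitionSemigroup.integrable_id (hQ : IsTransitionSemigroup β b c k Q) (hβ : 0 ≤ β)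
    (hb : 0 < b) (hc : 0 < c) (hk : MemK k) (hk1 : IntegrableOn (fun z => z * k z) (Ioi 0))
    (x : ℝ≥0) : Integrable (fun y : ℝ≥0 => (y : ℝ)) (Q 1 x) := by
  refine ⟨by fun_prop, ?_⟩
  rw [hasFiniteIntegral_iff_ofReal (Eventually.of_forall fun y => y.coe_nonneg)]
  exact (hQ.lintegral_id_le hβ hb hc hk hk1 x).trans_lt ENNReal.ofReal_lt_top

lemma IsTransitionSemigroup.integral_id_le (hQ : IsTransitionSemigroup β b c k Q) (hβ : 0 ≤ β)
    (hb : 0 < b) (hc : 0 < c) (hk : MemK k) (hk1 : IntegrableOn (fun z => z * k z) (Ioi 0))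
    (x : ℝ≥0) : ∫ y : ℝ≥0, (y : ℝ) ∂(Q 1 x) ≤
      Real.exp (-b) * x + (β + ∫ u in Ioi 0, u * k u) := by
  have hm := meanRate_nonneg hβ hk
  rw [integral_eq_lintegral_of_nonneg_ae (Eventually.of_forall fun y => y.coe_nonneg) (by fun_prop)]
  exact ENNReal.toReal_le_of_le_ofReal (by positivity) (hQ.lintegral_id_le hβ hb hc hk hk1 x)

lemma sq_le_exp_mul {θ x : ℝ} (hθ : 0 < θ) (hx : 0 ≤ x) : x ^ 2 ≤ 2 / θ ^ 2 * Real.exp (θ * x) := by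
  have h := Real.quadratic_le_exp_of_nonneg (mul_nonneg hθ.le hx)
  rw [div_mul_eq_mul_div, le_div_iff₀ (by positivity)]
  have : 0 ≤ θ * x := by positivity
  nlinarith

lemma IsStationaryCBI.integrable_exp (hX : IsStationaryCBI P β b c k X) (hβ : 0 ≤ β) (hb : 0 < b)
    (hc : 0 < c) (hk : MemK k) (hk1 : IntegrableOn (fun z => z * k z) (Ioi 0))
    (hk_exp : ∀ l : ℝ, -critExp b c < l → ∫⁻ s in Ioi (0 : ℝ), absPsi β k (v b c s l) < ∞)
    {θ : ℝ} (hθ : θ < critExp b c) : Integrable (fun ω => Real.exp (θ * (X 0 ω : ℝ))) P :=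
  integrable_exp_of_laplace (hX.measurable 0) hβ hb hc hk hk1 hk_exp hX.initial hθ

lemma IsStationaryCBI.memLp_two (hX : IsStationaryCBI P β b c k X) (hβ : 0 ≤ β) (hb : 0 < b)
    (hc : 0 < c) (hk : MemK k) (hk1 : IntegrableOn (fun z => z * k z) (Ioi 0))
    (hk_exp : ∀ l : ℝ, -critExp b c < l → ∫⁻ s in Ioi (0 : ℝ), absPsi β k (v b c s l) < ∞)
    (t : ℝ≥0) : MemLp (fun ω => (X t ω : ℝ)) 2 P := by
  have hcr := critExp_pos hb hc
  have h0 : MemLp (fun ω => (X 0 ω : ℝ)) 2 P := by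
    have hm : AEStronglyMeasurable (fun ω => (X 0 ω : ℝ)) P :=
      (hX.measurable 0).coe_nnreal_real.aestronglyMeasurable
    rw [memLp_two_iff_integrable_sq hm]
    refine Integrable.mono' ((hX.integrable_exp hβ hb hc hk hk1 hk_exp
      (half_lt_self hcr)).const_mul (2 / (critExp b c / 2) ^ 2)) (hm.pow 2)
      (Eventually.of_forall fun ω => ?_)
    rw [Real.norm_of_nonneg (sq_nonneg _)]
    exact sq_le_exp_mul (half_pos hcr) (X 0 ω).coe_nonneg
  have hid : IdentDistrib (X 0) (X t) P P :=
    ⟨(hX.measurable 0).aemeasurable, (hX.measurable t).aemeasurable,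
      (hX.map_eq hβ hb hc hk hk1 t).symm⟩
  exact (hid.comp (u := fun x : ℝ≥0 => (x : ℝ)) measurable_coe_nnreal_real).memLp_snd h0

/-- The likelihood-type ratio `exp (-l y + x v(l) - γ(l)) - 1`, which has vanishing conditional mean
for `γ = g₂`. -/
noncomputable def score (b c : ℝ) (γ : ℝ → ℝ) (l : ℝ) (p : ℝ≥0 × ℝ≥0) : ℝ :=
  Real.exp (-(l * (p.2 : ℝ)) + (p.1 : ℝ) * v b c 1 l - γ l) - 1

lemma measurable_v_one (b c : ℝ) : Measurable (v b c 1) :=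
  (measurable_v b c).comp (measurable_const.prodMk measurable_id)

lemma measurable_score (b c : ℝ) {γ : ℝ → ℝ} (hγ : Measurable γ) :
    Measurable fun q : ℝ × (ℝ≥0 × ℝ≥0) => score b c γ q.1 q.2 := by
  have := measurable_v_one b c
  unfold score
  fun_prop

lemma measurable_score_right (b c : ℝ) (γ : ℝ → ℝ) (l : ℝ) : Measurable (score b c γ l) := by
  unfold score
  fun_prop

lemma IsTransitionSemigroup.integral_score (hQ : IsTransitionSemigroup β b c k Q) {γ : ℝ → ℝ}
    {l : ℝ} (hl : 0 ≤ l) (hγ : γ l = g₂ β b c k l) (x : ℝ≥0) :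
    ∫ y, score b c γ l (x, y) ∂(Q 1 x) = 0 := by
  have := hQ.markov 1
  have hi : Integrable (fun y : ℝ≥0 => Real.exp (-(l * (y : ℝ)))) (Q 1 x) :=
    Integrable.of_bound (by fun_prop) 1 (Eventually.of_forall fun y => abs_exp_neg_mul_le hl y)
  have e : ∀ y : ℝ≥0, score b c γ l (x, y) =
      Real.exp ((x : ℝ) * v b c 1 l - γ l) * Real.exp (-(l * (y : ℝ))) - 1 := fun y => by
    rw [score, ← Real.exp_add]; congr 2; ring
  simp_rw [e]
  rw [integral_sub (hi.const_mul _) (integrable_const _), integral_const_mul, hQ.laplace_one x hl,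
    ← Real.exp_add, hγ]
  simp

/-- The second moment of the score is bounded for `l` in compact sets. -/
theorem IsStationaryCBI.exists_memLp_score (hX : IsStationaryCBI P β b c k X)
    (hQ : IsTransitionSemigroup β b c k Q) (hM : IsMarkov P X Q) (hβ : 0 ≤ β) (hb : 0 < b)
    (hc : 0 < c) (hk : MemK k) (hk1 : IntegrableOn (fun z => z * k z) (Ioi 0))
    (hk_exp : ∀ l : ℝ, -critExp b c < l → ∫⁻ s in Ioi (0 : ℝ), absPsi β k (v b c s l) < ∞)
    {γ : ℝ → ℝ} (hγ : ∀ l, 0 ≤ l → γ l = g₂ β b c k l) {Λ : ℝ} (hΛ : 0 ≤ Λ) :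
    ∃ B : ℝ, ∀ l ∈ Icc 0 Λ, MemLp (fun ω => score b c γ l (X 0 ω, X 1 ω)) 2 P ∧
      ∫ ω, score b c γ l (X 0 ω, X 1 ω) ^ 2 ∂P ≤ B := by
  have := hQ.markov 1
  obtain ⟨θ, hθ, hθv⟩ := exists_two_mul_v_sub_le hb hc hΛ
  have hexp := hX.integrable_exp hβ hb hc hk hk1 hk_exp hθ
  set m := β + ∫ u in Ioi 0, u * k u with hm
  have hm0 : 0 ≤ m := meanRate_nonneg hβ hk
  set B := Real.exp (2 * (m * Λ)) * ∫ ω, Real.exp (θ * (X 0 ω : ℝ)) ∂P with hB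
  have hB0 : 0 ≤ B := mul_nonneg (Real.exp_pos _).le (integral_nonneg fun ω => (Real.exp_pos _).le)
  refine ⟨2 * B + 2, fun l hl => ?_⟩
  set U : ℝ≥0 × ℝ≥0 → ℝ := fun p =>
    Real.exp (-(l * (p.2 : ℝ)) + (p.1 : ℝ) * v b c 1 l - γ l) with hU
  have hUm : Measurable U := by fun_prop
  have hpm : Measurable fun ω => (X 0 ω, X (0 + 1) ω) :=
    (hX.measurable 0).prodMk (hX.measurable _)
  have hbound : ∫⁻ ω, ENNReal.ofReal (U (X 0 ω, X 1 ω) ^ 2) ∂P ≤ ENNReal.ofReal B := by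
    have e1 : ∫⁻ ω, ENNReal.ofReal (U (X 0 ω, X 1 ω) ^ 2) ∂P =
        ∫⁻ ω, ∫⁻ y, ENNReal.ofReal (U (X 0 ω, y) ^ 2) ∂(Q 1 (X 0 ω)) ∂P := by
      have hm1 : Measurable fun p => ENNReal.ofReal (U p ^ 2) := by fun_prop
      have h1 := lintegral_map (μ := P) hm1 hpm
      rw [hM.map_prodMk, Measure.lintegral_compProd hm1,
        lintegral_map (hm1.lintegral_kernel_prod_right') (hX.measurable 0)] at h1
      simpa using h1.symm
    rw [e1, hB, ENNReal.ofReal_mul (Real.exp_pos _).le, ofReal_integral_eq_lintegral_ofReal hexp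
      (Eventually.of_forall fun ω => (Real.exp_pos _).le), ← lintegral_const_mul']
    · refine lintegral_mono fun ω => ?_
      -- Given `X 0 = x`, squaring doubles the argument of the Laplace transform. The exponent
      -- becomes `x (2 v(l) - v(2l)) - 2 g₂(l) + g₂(2l)`: the first term is at most `x θ`, the
      -- second at most `2 m Λ`, and the last is nonpositive.
      have e2 : ∀ y : ℝ≥0, ENNReal.ofReal (U (X 0 ω, y) ^ 2) =
          ENNReal.ofReal (Real.exp (2 * ((X 0 ω : ℝ) * v b c 1 l - γ l))) *
            ENNReal.ofReal (Real.exp (-(2 * l * (y : ℝ)))) := fun y => by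
        rw [← ENNReal.ofReal_mul (Real.exp_pos _).le, ← Real.exp_add, hU, ← Real.exp_nat_mul]
        congr 2
        push_cast
        ring
      simp_rw [e2]
      have h2l : 0 ≤ 2 * l := by linarith [hl.1]
      rw [lintegral_const_mul' _ _ ENNReal.ofReal_ne_top, hQ.lintegral_exp _ h2l,
        ← ENNReal.ofReal_mul (Real.exp_pos _).le, ← ENNReal.ofReal_mul (Real.exp_pos _).le,
        ← Real.exp_add, ← Real.exp_add]
      refine ENNReal.ofReal_le_ofReal (Real.exp_le_exp.2 ?_)
      have h3 := neg_g₂_le hβ hb hc hk hk1 hl.1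
      have h4 := g₂_nonpos hβ hb hc hk h2l
      have h5 := mul_le_mul_of_nonneg_left (hθv l hl) (X 0 ω).coe_nonneg
      have h6 := mul_le_mul_of_nonneg_left hl.2 hm0
      rw [← hm] at h3
      rw [hγ l hl.1]
      nlinarith
    · exact ENNReal.ofReal_ne_top
  have hUΩ : AEStronglyMeasurable (fun ω => U (X 0 ω, X 1 ω)) P :=
    (hUm.comp ((hX.measurable 0).prodMk (hX.measurable 1))).aestronglyMeasurable
  have hUi : Integrable (fun ω => U (X 0 ω, X 1 ω) ^ 2) P := by
    refine ⟨hUΩ.pow 2, ?_⟩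
    rw [hasFiniteIntegral_iff_ofReal (Eventually.of_forall fun ω => sq_nonneg _)]
    exact hbound.trans_lt ENNReal.ofReal_lt_top
  have hUL : MemLp (fun ω => U (X 0 ω, X 1 ω)) 2 P := (memLp_two_iff_integrable_sq hUΩ).2 hUi
  have hUB : ∫ ω, U (X 0 ω, X 1 ω) ^ 2 ∂P ≤ B := by
    rw [integral_eq_lintegral_of_nonneg_ae (Eventually.of_forall fun ω => sq_nonneg _)
      (hUΩ.pow 2)]
    exact ENNReal.toReal_le_of_le_ofReal hB0 hbound
  have hS : MemLp (fun ω => score b c γ l (X 0 ω, X 1 ω)) 2 P := hUL.sub (memLp_const 1)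
  refine ⟨hS, ?_⟩
  calc ∫ ω, score b c γ l (X 0 ω, X 1 ω) ^ 2 ∂P
      ≤ ∫ ω, (2 * U (X 0 ω, X 1 ω) ^ 2 + 2) ∂P := by
        refine integral_mono hS.integrable_sq ((hUi.const_mul 2).add (integrable_const _))
          fun ω => ?_
        change (U (X 0 ω, X 1 ω) - 1) ^ 2 ≤ _
        nlinarith [sq_nonneg (U (X 0 ω, X 1 ω) + 1)]
    _ = 2 * (∫ ω, U (X 0 ω, X 1 ω) ^ 2 ∂P) + 2 := by
        rw [integral_add (hUi.const_mul 2) (integrable_const _), integral_const_mul]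
        simp
    _ ≤ 2 * B + 2 := by linarith

end Moments

end CBI

/-! ### Linearization of the empirical Laplace transform -/

namespace CBI

section EmpiricalMean

variable {b c : ℝ} {γ : ℝ → ℝ} {x : ℕ → ℝ≥0} {n : ℕ} {l : ℝ}

/-- The mean of the scores of the first `n` transitions. -/
noncomputable def meanScore (b c : ℝ) (γ : ℝ → ℝ) (x : ℕ → ℝ≥0) (n : ℕ) (l : ℝ) : ℝ :=
  (n : ℝ)⁻¹ * ∑ j ∈ Finset.range n, score b c γ l (x j, x (j + 1))

lemma L₂_eq (hn : 1 ≤ n) :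
    L₂ b c x n l = Real.exp (γ l) * (1 + meanScore b c γ x n l) := by
  have h0 : (n : ℝ) ≠ 0 := by positivity
  have e : ∀ j, Real.exp (-(l * (x (j + 1) : ℝ)) + (x j : ℝ) * v b c 1 l) =
      Real.exp (γ l) * (score b c γ l (x j, x (j + 1)) + 1) := fun j => by
    rw [score, sub_add_cancel, ← Real.exp_add]
    congr 1
    ring
  simp_rw [L₂, e, meanScore]
  rw [← Finset.mul_sum, Finset.sum_add_distrib]
  simp only [Finset.sum_const, Finset.card_range, nsmul_eq_mul, mul_one]
  field_simp
  ring

lemma L₂_pos (hn : 1 ≤ n) : 0 < L₂ b c x n l := by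
  have h0 : (0 : ℝ) < n := by exact_mod_cast hn
  refine mul_pos (by positivity) (Finset.sum_pos (fun i _ => Real.exp_pos _) ?_)
  exact Finset.nonempty_range_iff.2 (by omega)

lemma neg_one_lt_meanScore (hn : 1 ≤ n) : -1 < meanScore b c γ x n l := by
  have h1 := L₂_pos (b := b) (c := c) (x := x) (l := l) hn
  rw [L₂_eq (γ := γ) hn] at h1
  have := (mul_pos_iff_of_pos_left (Real.exp_pos _)).1 h1
  linarith

lemma gEmp_eq (hn : 1 ≤ n) :
    gEmp b c x n l = γ l + Real.log (1 + meanScore b c γ x n l) := by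
  have := neg_one_lt_meanScore (b := b) (c := c) (γ := γ) (x := x) (l := l) hn
  rw [gEmp, L₂_eq (γ := γ) hn, Real.log_mul (Real.exp_pos _).ne' (by linarith), Real.log_exp]

/-- Drop the nonnegative term `x_j v(l)` and apply Jensen's inequality to the exponential. This
prevents the logarithm from diverging when the empirical transform is close to zero. -/
lemma neg_mul_mean_le_gEmp (hb : 0 < b) (hc : 0 < c) (hn : 1 ≤ n) (hl : 0 ≤ l) :
    -(l * ((n : ℝ)⁻¹ * ∑ j ∈ Finset.range n, (x (j + 1) : ℝ))) ≤ gEmp b c x n l := by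
  have h0 : (0 : ℝ) < n := by exact_mod_cast hn
  rw [gEmp, Real.le_log_iff_exp_le (L₂_pos hn)]
  have h1 := convexOn_exp.map_sum_le (t := Finset.range n) (w := fun _ => (n : ℝ)⁻¹)
    (p := fun j => -(l * (x (j + 1) : ℝ))) (fun _ _ => by positivity)
    (by simp [h0.ne']) (fun _ _ => mem_univ _)
  simp only [smul_eq_mul] at h1
  rw [← Finset.mul_sum, ← Finset.mul_sum, Finset.sum_neg_distrib, ← Finset.mul_sum] at h1
  calc Real.exp (-(l * ((n : ℝ)⁻¹ * ∑ j ∈ Finset.range n, (x (j + 1) : ℝ))))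
      = Real.exp ((n : ℝ)⁻¹ * -(l * ∑ j ∈ Finset.range n, (x (j + 1) : ℝ))) := by
        congr 1; ring
    _ ≤ _ := h1
    _ ≤ L₂ b c x n l := by
        rw [L₂, one_div]
        gcongr with j
        have := mul_nonneg (x j).coe_nonneg (v_nonneg hb hc zero_le_one hl)
        linarith

/-- An autoregressive argument: the conditional means contract by `e^{-b}`, so the sample mean
satisfies a linear inequality in itself, up to the initial value and the mean of the innovations.
Solving it divides by `1 - e^{-b}`. -/
lemma mean_le_of_condMean_le (hb : 0 < b) {m : ℝ} (hm : 0 ≤ m) (hn : 1 ≤ n) {h : ℝ≥0 → ℝ}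
    (hh : ∀ y, h y ≤ Real.exp (-b) * y + m) :
    (n : ℝ)⁻¹ * ∑ j ∈ Finset.range n, (x (j + 1) : ℝ) ≤ (1 + m) / (1 - Real.exp (-b)) *
      ((x 0 : ℝ) / n + 1 + |(n : ℝ)⁻¹ * ∑ j ∈ Finset.range n, ((x (j + 1) : ℝ) - h (x j))|) := by
  have h0 : (0 : ℝ) < n := by exact_mod_cast hn
  have hq := exp_neg_lt_one hb
  have hq0 := Real.exp_pos (-b)
  have hq1 : 0 < 1 - Real.exp (-b) := by linarith
  set S := ∑ j ∈ Finset.range n, (x (j + 1) : ℝ) with hS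
  set T := ∑ j ∈ Finset.range n, ((x (j + 1) : ℝ) - h (x j)) with hT
  have h1 : ∑ j ∈ Finset.range n, (x j : ℝ) ≤ S + x 0 := by
    have e := Finset.sum_range_succ (fun j => (x j : ℝ)) n
    rw [Finset.sum_range_succ'] at e
    have := (x n).coe_nonneg
    linarith
  have h2 : S - T ≤ Real.exp (-b) * (S + x 0) + n * m := by
    have e : S - T = ∑ j ∈ Finset.range n, h (x j) := by
      rw [hS, hT, ← Finset.sum_sub_distrib]
      exact Finset.sum_congr rfl fun j _ => by ring
    rw [e]
    calc ∑ j ∈ Finset.range n, h (x j)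
        ≤ ∑ j ∈ Finset.range n, (Real.exp (-b) * x j + m) := Finset.sum_le_sum fun j _ => hh _
      _ = Real.exp (-b) * (∑ j ∈ Finset.range n, (x j : ℝ)) + n * m := by
        rw [Finset.sum_add_distrib, Finset.mul_sum]; simp
      _ ≤ _ := by gcongr
  have h3 : (1 - Real.exp (-b)) * S ≤ T + x 0 + n * m := by
    have := mul_le_of_le_one_left (x 0).coe_nonneg hq.le
    linarith
  have h4 : (1 - Real.exp (-b)) * ((n : ℝ)⁻¹ * S) ≤ (n : ℝ)⁻¹ * T + x 0 / n + m := by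
    calc _ = (n : ℝ)⁻¹ * ((1 - Real.exp (-b)) * S) := by ring
      _ ≤ (n : ℝ)⁻¹ * (T + x 0 + n * m) := by gcongr
      _ = _ := by field_simp
  rw [div_mul_eq_mul_div, le_div_iff₀ hq1]
  have h5 := le_abs_self ((n : ℝ)⁻¹ * T)
  have h6 : 0 ≤ (x 0 : ℝ) / n := by positivity
  have h7 := abs_nonneg ((n : ℝ)⁻¹ * T)
  nlinarith [mul_nonneg hm h6, mul_nonneg hm h7]

end EmpiricalMean

/-! ### Order of the linearization error for each argument, with bounds uniform on compact sets. -/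

section Remainder

variable {Ω : Type*} [mΩ : MeasurableSpace Ω] {P : Measure Ω} [IsProbabilityMeasure P]
  {X : ℝ≥0 → Ω → ℝ≥0} {Q : ℝ≥0 → Kernel ℝ≥0 ℝ≥0} {β b c : ℝ} {k : ℝ → ℝ}

lemma IsStationaryCBI.isMixingMDS_score (hX : IsStationaryCBI P β b c k X)
    (hQ : IsTransitionSemigroup β b c k Q) (hM : IsMarkov P X Q) (hβ : 0 ≤ β) (hb : 0 < b)
    (hc : 0 < c) (hk : MemK k) (hk1 : IntegrableOn (fun z => z * k z) (Ioi 0))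
    {γ : ℝ → ℝ} {l : ℝ} (hl : 0 ≤ l) (hγ : γ l = g₂ β b c k l)
    (h2 : MemLp (fun ω => score b c γ l (X 0 ω, X 1 ω)) 2 P) :
    IsMixingMDS P (fun j => past X j) fun j ω => score b c γ l (X j ω, X (j + 1 : ℕ) ω) := by
  simpa only [Nat.cast_succ] using hX.isMixingMDS hM hβ hb hc hk hk1
    (measurable_score_right b c γ l) h2
    (Eventually.of_forall fun ω => hQ.integral_score hl hγ _)

/-- The difference of the next observation and its conditional mean. -/
lemma IsStationaryCBI.isMixingMDS_innovation (hX : IsStationaryCBI P β b c k X)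
    (hQ : IsTransitionSemigroup β b c k Q) (hM : IsMarkov P X Q) (hβ : 0 ≤ β) (hb : 0 < b)
    (hc : 0 < c) (hk : MemK k) (hk1 : IntegrableOn (fun z => z * k z) (Ioi 0))
    (hk_exp : ∀ l : ℝ, -critExp b c < l → ∫⁻ s in Ioi (0 : ℝ), absPsi β k (v b c s l) < ∞) :
    IsMixingMDS P (fun j => past X j) fun j ω =>
      (X (j + 1 : ℕ) ω : ℝ) - ∫ y : ℝ≥0, (y : ℝ) ∂(Q 1 (X j ω)) := by
  have := hQ.markov 1
  have hm0 := meanRate_nonneg (β := β) hβ hk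
  have hhm : Measurable fun x => ∫ y : ℝ≥0, (y : ℝ) ∂(Q 1 x) :=
    (measurable_coe_nnreal_real.stronglyMeasurable.integral_kernel).measurable
  have h2 : MemLp (fun ω => (X 1 ω : ℝ) - ∫ y : ℝ≥0, (y : ℝ) ∂(Q 1 (X 0 ω))) 2 P := by
    refine (hX.memLp_two hβ hb hc hk hk1 hk_exp 1).sub ?_
    refine MemLp.mono' (((hX.memLp_two hβ hb hc hk hk1 hk_exp 0).const_mul (Real.exp (-b))).add
      (memLp_const (β + ∫ u in Ioi 0, u * k u)))
      (hhm.comp (hX.measurable 0)).aestronglyMeasurable (Eventually.of_forall fun ω => ?_)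
    rw [Real.norm_of_nonneg (integral_nonneg fun y => y.coe_nonneg)]
    exact hQ.integral_id_le hβ hb hc hk hk1 _
  simpa only [Nat.cast_succ] using hX.isMixingMDS hM hβ hb hc hk hk1
    (f := fun p => (p.2 : ℝ) - ∫ y : ℝ≥0, (y : ℝ) ∂(Q 1 p.1))
    (measurable_snd.coe_nnreal_real.sub (hhm.comp measurable_fst)) h2
    (Eventually.of_forall fun ω => by
      simp only
      rw [integral_sub (hQ.integrable_id hβ hb hc hk hk1 _) (integrable_const _)]
      simp)

/-- The error in the linearization of the logarithm of the empirical Laplace transform is of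
smaller order than `n ^ (-1/2)` in `L²(P)`, and bounded on this scale for `l` in compact sets. -/
theorem IsStationaryCBI.gEmp_remainder (hX : IsStationaryCBI P β b c k X)
    (hQ : IsTransitionSemigroup β b c k Q) (hM : IsMarkov P X Q) (hβ : 0 ≤ β) (hb : 0 < b)
    (hc : 0 < c) (hk : MemK k) (hk1 : IntegrableOn (fun z => z * k z) (Ioi 0))
    (hk_exp : ∀ l : ℝ, -critExp b c < l → ∫⁻ s in Ioi (0 : ℝ), absPsi β k (v b c s l) < ∞)
    {γ : ℝ → ℝ} (hγ : ∀ l, 0 ≤ l → γ l = g₂ β b c k l) {Λ : ℝ} (hΛ : 0 ≤ Λ) :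
    ∃ B : ℝ, ∀ l ∈ Icc 0 Λ,
      (∀ n : ℕ, 1 ≤ n → ∫⁻ ω, ENNReal.ofReal (n * (gEmp b c (fun i => X i ω) n l - γ l -
        meanScore b c γ (fun i => X i ω) n l) ^ 2) ∂P ≤ ENNReal.ofReal B) ∧
      Tendsto (fun n : ℕ => ∫⁻ ω, ENNReal.ofReal (n * (gEmp b c (fun i => X i ω) n l - γ l -
        meanScore b c γ (fun i => X i ω) n l) ^ 2) ∂P) atTop (𝓝 0) := by
  obtain ⟨B, hB⟩ := hX.exists_memLp_score hQ hM hβ hb hc hk hk1 hk_exp hγ hΛ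
  have hE := hX.isMixingMDS_innovation hQ hM hβ hb hc hk hk1 hk_exp
  have hx := hX.memLp_two hβ hb hc hk hk1 hk_exp 0
  set m := β + ∫ u in Ioi 0, u * k u with hm
  have hm0 : 0 ≤ m := meanRate_nonneg hβ hk
  -- Jensen's bound contributes the factor `l ≤ Λ`, the sample mean the rest. Since `γ l ≤ 0`,
  -- subtracting it from `gEmp` does not spoil the lower bound.
  set C := Λ * ((1 + m) / (1 - Real.exp (-b))) with hC
  have hq1 : 0 < 1 - Real.exp (-b) := by have := exp_neg_lt_one hb; linarith
  refine ⟨(16 + 24 * C ^ 2) * (B + (∫ ω, (X 0 ω : ℝ) ^ 2 ∂P) + ∫ ω,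
    ((X (0 + 1 : ℕ) ω : ℝ) - ∫ y : ℝ≥0, (y : ℝ) ∂(Q 1 (X (0 : ℕ) ω))) ^ 2 ∂P), fun l hl => ?_⟩
  have hl0 := hl.1
  have hD := hX.isMixingMDS_score hQ hM hβ hb hc hk hk1 hl.1 (hγ l hl.1) (hB l hl).1
  have hY : ∀ n : ℕ, 1 ≤ n → ∀ ω, -1 < (n : ℝ)⁻¹ *
      ∑ j ∈ Finset.range n, score b c γ l (X j ω, X (j + 1 : ℕ) ω) := fun n hn ω =>
    neg_one_lt_meanScore (x := fun i => X i ω) hn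
  have hlog : ∀ n : ℕ, 1 ≤ n → ∀ ω, -(C * ((X 0 ω : ℝ) / n + 1 + |(n : ℝ)⁻¹ *
      ∑ j ∈ Finset.range n, ((X (j + 1 : ℕ) ω : ℝ) - ∫ y : ℝ≥0, (y : ℝ) ∂(Q 1 (X j ω)))|)) ≤
      Real.log (1 + (n : ℝ)⁻¹ *
        ∑ j ∈ Finset.range n, score b c γ l (X j ω, X (j + 1 : ℕ) ω)) := by
    intro n hn ω
    have h1 := neg_mul_mean_le_gEmp (x := fun i : ℕ => X i ω) hb hc hn hl.1
    rw [gEmp_eq (γ := γ) hn] at h1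
    have h2 := mean_le_of_condMean_le (x := fun i : ℕ => X i ω) hb hm0 hn
      (h := fun x => ∫ y : ℝ≥0, (y : ℝ) ∂(Q 1 x)) (hQ.integral_id_le hβ hb hc hk hk1)
    have h3 : γ l ≤ 0 := by rw [hγ l hl.1]; exact g₂_nonpos hβ hb hc hk hl.1
    have h4 : (0 : ℝ) ≤ (n : ℝ)⁻¹ * ∑ j ∈ Finset.range n, (X (j + 1 : ℕ) ω : ℝ) := by positivity
    have h5 := mul_le_mul hl.2 h2 h4 hΛ
    rw [← mul_assoc Λ, ← hC] at h5
    simp only [Nat.cast_zero] at h5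
    unfold meanScore at h1
    linarith
  have he : ∀ n : ℕ, 1 ≤ n → ∀ ω, gEmp b c (fun i => X i ω) n l - γ l -
      meanScore b c γ (fun i => X i ω) n l =
      Real.log (1 + (n : ℝ)⁻¹ * ∑ j ∈ Finset.range n, score b c γ l (X j ω, X (j + 1 : ℕ) ω)) -
        (n : ℝ)⁻¹ * ∑ j ∈ Finset.range n, score b c γ l (X j ω, X (j + 1 : ℕ) ω) := by
    intro n hn ω
    rw [gEmp_eq (γ := γ) hn, meanScore]
    ring
  refine ⟨fun n hn => ?_, ?_⟩
  · simp_rw [he n hn]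
    refine (hD.lintegral_log_remainder_le hE hx hn (hY n hn) (hlog n hn)).trans
      (ENNReal.ofReal_le_ofReal ?_)
    have := (hB l hl).2
    refine mul_le_mul_of_nonneg_left ?_ (by positivity)
    simp only [Nat.cast_zero, zero_add, Nat.cast_one]
    gcongr
  · refine (hD.tendsto_lintegral_log_remainder hE hx hY hlog).congr' ?_
    filter_upwards [eventually_ge_atTop 1] with n hn
    simp_rw [he n hn]

end Remainder

end CBI

/-! ### Measurability of random elements of `L²` -/

section RandomElements

open scoped RealInnerProductSpace

/-- The vector is the pointwise limit of its finite basis expansions, which are measurable by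
assumption; the countable basis keeps the limit measurable. -/
lemma measurable_of_inner {α H : Type*} [MeasurableSpace α] [NormedAddCommGroup H]
    [InnerProductSpace ℝ H] [CompleteSpace H] [MeasurableSpace H] [BorelSpace H]
    [SecondCountableTopology H] {F : α → H} (h : ∀ x : H, Measurable fun a => ⟪x, F a⟫) :
    Measurable F := by
  obtain ⟨w, b, -⟩ := exists_hilbertBasis ℝ H
  have := b.countable_index
  refine measurable_of_tendsto_metrizable' (atTop : Filter (Finset w))
    (f := fun s a => ∑ i ∈ s, ⟪b i, F a⟫ • b i) (fun s => ?_) ?_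
  · exact Finset.measurable_sum _ fun i _ => (h _).smul_const _
  · rw [tendsto_pi_nhds]
    intro a
    have := b.hasSum_repr (F a)
    simp only [b.repr_apply_apply] at this
    exact this

variable {α : Type*} [MeasurableSpace α] {E : Type*} [MeasurableSpace E] {μ : Measure E}

lemma inner_toLp_eq {f : E → ℝ} (hf : MemLp f 2 μ) (h : Lp ℝ 2 μ) :
    ⟪h, hf.toLp f⟫ = ∫ x, h x * f x ∂μ := by
  rw [L2.inner_def]
  refine integral_congr_ae ?_
  filter_upwards [hf.coeFn_toLp] with x hx
  rw [hx]
  simp [mul_comm]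

lemma measurable_toLp [SFinite μ] [SecondCountableTopology (Lp ℝ 2 μ)]
    [MeasurableSpace (Lp ℝ 2 μ)] [BorelSpace (Lp ℝ 2 μ)] {f : α → E → ℝ}
    (hf : Measurable fun p : α × E => f p.1 p.2) (hf2 : ∀ a, MemLp (f a) 2 μ) :
    Measurable fun a => (hf2 a).toLp (f a) := by
  refine measurable_of_inner fun h => ?_
  simp_rw [inner_toLp_eq]
  have : StronglyMeasurable fun p : α × E => h p.2 * f p.1 p.2 :=
    ((Lp.stronglyMeasurable h).comp_measurable measurable_snd).mul hf.stronglyMeasurable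
  exact (StronglyMeasurable.integral_prod_right (f := fun a x => h x * f a x) this).measurable

lemma enorm_toLp_sub_eq {f : E → ℝ} (hf : MemLp f 2 μ) (h : Lp ℝ 2 μ) :
    ‖hf.toLp f - h‖ₑ = eLpNorm (fun x => f x - h x) 2 μ := by
  rw [Lp.enorm_def]
  refine eLpNorm_congr_ae ?_
  filter_upwards [Lp.coeFn_sub (hf.toLp f) h, hf.coeFn_toLp] with x h1 h2
  rw [h1, Pi.sub_apply, h2]

lemma enorm_toLp_sq_eq {f : E → ℝ} (hf : MemLp f 2 μ) :
    ‖hf.toLp f‖ₑ ^ 2 = ∫⁻ x, ENNReal.ofReal (f x ^ 2) ∂μ := by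
  rw [Lp.enorm_toLp, eLpNorm_two_sq]
  refine lintegral_congr fun x => ?_
  rw [← ofReal_norm, ← ENNReal.ofReal_pow (norm_nonneg _), Real.norm_eq_abs, sq_abs]

end RandomElements

/-! ### The weighted space and the convex set of candidates -/

/-- Variation is a seminorm, which makes the variation constraint on the densities convex. -/
lemma eVariationOn_linearCombination_le (f g : ℝ → ℝ) (s : Set ℝ) {p q : ℝ} (hp : 0 ≤ p)
    (hq : 0 ≤ q) : eVariationOn (fun z => p * f z + q * g z) s ≤
      ENNReal.ofReal p * eVariationOn f s + ENNReal.ofReal q * eVariationOn g s := by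
  refine iSup_le fun ⟨n, u, hu, us⟩ => ?_
  calc ∑ i ∈ Finset.range n, edist (p * f (u (i + 1)) + q * g (u (i + 1))) (p * f (u i) + q * g (u i))
      ≤ ∑ i ∈ Finset.range n, (ENNReal.ofReal p * edist (f (u (i + 1))) (f (u i)) +
          ENNReal.ofReal q * edist (g (u (i + 1))) (g (u i))) := by
        refine Finset.sum_le_sum fun i _ => ?_
        rw [edist_dist, edist_dist, edist_dist, ← ENNReal.ofReal_mul hp, ← ENNReal.ofReal_mul hq,
          ← ENNReal.ofReal_add (by positivity) (by positivity)]
        refine ENNReal.ofReal_le_ofReal ?_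
        rw [Real.dist_eq, Real.dist_eq, Real.dist_eq]
        calc |p * f (u (i + 1)) + q * g (u (i + 1)) - (p * f (u i) + q * g (u i))|
            = |p * (f (u (i + 1)) - f (u i)) + q * (g (u (i + 1)) - g (u i))| := by congr 1; ring
          _ ≤ |p * (f (u (i + 1)) - f (u i))| + |q * (g (u (i + 1)) - g (u i))| := abs_add_le _ _
          _ = _ := by rw [abs_mul, abs_mul, abs_of_nonneg hp, abs_of_nonneg hq]
    _ = ENNReal.ofReal p * ∑ i ∈ Finset.range n, edist (f (u (i + 1))) (f (u i)) +
          ENNReal.ofReal q * ∑ i ∈ Finset.range n, edist (g (u (i + 1))) (g (u i)) := by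
        rw [Finset.sum_add_distrib, Finset.mul_sum, Finset.mul_sum]
    _ ≤ _ := by gcongr <;> exact eVariationOn.sum_le hu us

namespace CBI

section Candidates

variable {β b c R : ℝ} {kR k k' w : ℝ → ℝ}

lemma MemKR.linearCombination (hk : MemKR R kR k) (hk' : MemKR R kR k') {p q : ℝ} (hp : 0 ≤ p)
    (hq : 0 ≤ q) (hpq : p + q = 1) : MemKR R kR fun z => p * k z + q * k' z where
  memK :=
    { nonneg := fun z hz => add_nonneg (mul_nonneg hp (hk.memK.nonneg z hz))
        (mul_nonneg hq (hk'.memK.nonneg z hz))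
      rightCont := fun z hz => (continuousWithinAt_const.mul (hk.memK.rightCont z hz)).add
        (continuousWithinAt_const.mul (hk'.memK.rightCont z hz))
      locBV := fun x y hx hy => ne_top_of_le_ne_top
        (ENNReal.add_ne_top.2 ⟨ENNReal.mul_ne_top ENNReal.ofReal_ne_top (hk.memK.locBV x y hx hy),
          ENNReal.mul_ne_top ENNReal.ofReal_ne_top (hk'.memK.locBV x y hx hy)⟩)
        (eVariationOn_linearCombination_le k k' _ hp hq)
      integrable := ((hk.memK.integrable.const_mul p).add (hk'.memK.integrable.const_mul q)).congr
        (Eventually.of_forall fun z => by simp only [Pi.add_apply]; ring) }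
  le_envelope z hz := by
    calc p * k z + q * k' z ≤ p * kR z + q * kR z :=
          add_le_add (mul_le_mul_of_nonneg_left (hk.le_envelope z hz) hp)
            (mul_le_mul_of_nonneg_left (hk'.le_envelope z hz) hq)
      _ = kR z := by rw [← add_mul, hpq, one_mul]
  variation i := by
    refine (eVariationOn_linearCombination_le k k' _ hp hq).trans ?_
    calc _ ≤ ENNReal.ofReal p * ENNReal.ofReal R + ENNReal.ofReal q * ENNReal.ofReal R := by
          gcongr
          · exact hk.variation i
          · exact hk'.variation i
      _ = ENNReal.ofReal R := by
          rw [← add_mul, ← ENNReal.ofReal_add hp hq, hpq, ENNReal.ofReal_one, one_mul]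

lemma psi_linearCombination (hk : MemK k) (hk' : MemK k') {p q z : ℝ} (hpq : p + q = 1)
    (hz : 0 ≤ z) :
    psi β (fun z => p * k z + q * k' z) z = p * psi β k z + q * psi β k' z := by
  have e : ∫ u in Ioi (0 : ℝ), (1 - Real.exp (-(z * u))) * (p * k u + q * k' u) =
      p * (∫ u in Ioi (0 : ℝ), (1 - Real.exp (-(z * u))) * k u) +
      q * ∫ u in Ioi (0 : ℝ), (1 - Real.exp (-(z * u))) * k' u := by
    rw [← integral_const_mul, ← integral_const_mul,
      ← integral_add ((hk.integrable_integrand hz).const_mul p)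
        ((hk'.integrable_integrand hz).const_mul q)]
    exact integral_congr_ae (Eventually.of_forall fun u => by simp only; ring)
  rw [psi, e, psi, psi]
  linear_combination (-(β * z)) * hpq

/-- The drift term carries the fixed `β`, so `g₂` is affine rather than linear in the density and
the weights must sum to one. -/
lemma g₂_linearCombination (hb : 0 < b) (hc : 0 < c) (hk : MemK k) (hk' : MemK k') {p q l : ℝ}
    (hpq : p + q = 1) (hl : 0 ≤ l) :
    g₂ β b c (fun z => p * k z + q * k' z) l = p * g₂ β b c k l + q * g₂ β b c k' l := by
  have e : ∫ s in (0 : ℝ)..1, psi β (fun z => p * k z + q * k' z) (v b c s l) =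
      ∫ s in (0 : ℝ)..1, (p * psi β k (v b c s l) + q * psi β k' (v b c s l)) := by
    refine intervalIntegral.integral_congr fun s hs => ?_
    rw [uIcc_of_le zero_le_one] at hs
    exact psi_linearCombination hk hk' hpq (v_nonneg hb hc hs.1 hl)
  rw [g₂, e, intervalIntegral.integral_add
    ((intervalIntegrable_psi_v β hb hc hk hl).const_mul p)
    ((intervalIntegrable_psi_v β hb hc hk' hl).const_mul q),
    intervalIntegral.integral_const_mul, intervalIntegral.integral_const_mul, g₂, g₂]
  ring

lemma IsWeight.exists_ae_mem (hw : IsWeight w) :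
    ∃ Λ : ℝ, 0 ≤ Λ ∧ ∀ᵐ l ∂wMeasure w, l ∈ Icc 0 Λ := by
  obtain ⟨Λ, hΛ⟩ := hw.compactSupport.isCompact.bddAbove
  refine ⟨max Λ 0, le_max_right _ _, ?_⟩
  rw [wMeasure, ae_withDensity_iff hw.measurable.ennreal_ofReal]
  filter_upwards [ae_restrict_mem measurableSet_Ioi] with l hl h0
  refine ⟨le_of_lt hl, le_max_of_le_left (hΛ (subset_tsupport w ?_))⟩
  intro h
  exact h0 (by rw [h, ENNReal.ofReal_zero])

lemma IsWeight.isFiniteMeasure (hw : IsWeight w) : IsFiniteMeasure (wMeasure w) := by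
  obtain ⟨C, hC⟩ := hw.bounded
  refine ⟨?_⟩
  rw [wMeasure, withDensity_apply _ MeasurableSet.univ, Measure.restrict_univ]
  calc ∫⁻ l in Ioi (0 : ℝ), ENNReal.ofReal (w l)
      ≤ ∫⁻ l, ENNReal.ofReal (w l) := setLIntegral_le_lintegral _ _
    _ ≤ ∫⁻ l, (tsupport w).indicator (fun _ => ENNReal.ofReal C) l := by
        refine lintegral_mono fun l => ?_
        by_cases hl : l ∈ tsupport w
        · rw [indicator_of_mem hl]
          exact ENNReal.ofReal_le_ofReal (hC l)
        · rw [image_eq_zero_of_notMem_tsupport hl]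
          simp
    _ = ENNReal.ofReal C * volume (tsupport w) :=
        lintegral_indicator_const (isClosed_tsupport w).measurableSet _
    _ < ∞ := ENNReal.mul_lt_top ENNReal.ofReal_lt_top hw.compactSupport.isCompact.measure_lt_top

lemma convex_PsiR (hb : 0 < b) (hc : 0 < c) (hw : IsWeight w) :
    Convex ℝ (PsiR β b c R kR w) := by
  obtain ⟨Λ, -, hΛ⟩ := hw.exists_ae_mem
  rintro f ⟨k₁, hk₁, hf⟩ f' ⟨k₂, hk₂, hf'⟩ p q hp hq hpq
  refine ⟨_, hk₁.linearCombination hk₂ hp hq hpq, ?_⟩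
  filter_upwards [hf, hf', hΛ, Lp.coeFn_add (p • f) (q • f'), Lp.coeFn_smul p f,
    Lp.coeFn_smul q f'] with l h1 h2 h3 h4 h5 h6
  rw [h4, Pi.add_apply, h5, h6, Pi.smul_apply, Pi.smul_apply, h1, h2,
    g₂_linearCombination hb hc hk₁.memK hk₂.memK hpq h3.1]
  rfl

end Candidates

/-! ### Square integrability with respect to the weight -/

section SquareIntegrable

variable {β b c : ℝ} {k w γ : ℝ → ℝ}

lemma IsWeight.memLp_of_bound (hw : IsWeight w) {f : ℝ → ℝ} (hf : Measurable f)
    (h : ∀ Λ : ℝ, ∃ C : ℝ, ∀ l ∈ Icc 0 Λ, |f l| ≤ C) : MemLp f 2 (wMeasure w) := by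
  have := hw.isFiniteMeasure
  obtain ⟨Λ, -, hΛ⟩ := hw.exists_ae_mem
  obtain ⟨C, hC⟩ := h Λ
  exact MemLp.of_bound hf.aestronglyMeasurable C (hΛ.mono fun l hl => hC l hl)

lemma memLp_g₂ (hβ : 0 ≤ β) (hb : 0 < b) (hc : 0 < c) (hk : MemK k)
    (hk1 : IntegrableOn (fun z => z * k z) (Ioi 0)) (hw : IsWeight w) (hγm : Measurable γ)
    (hγ : ∀ l, 0 ≤ l → γ l = g₂ β b c k l) : MemLp γ 2 (wMeasure w) := by
  refine hw.memLp_of_bound hγm fun Λ => ⟨(β + ∫ u in Ioi 0, u * k u) * Λ, fun l hl => ?_⟩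
  rw [hγ l hl.1, abs_of_nonpos (g₂_nonpos hβ hb hc hk hl.1)]
  exact (neg_g₂_le hβ hb hc hk hk1 hl.1).trans
    (mul_le_mul_of_nonneg_left hl.2 (meanRate_nonneg hβ hk))

/-- The bound does not involve the later observation, since `e^{-l y} ≤ 1`. For a fixed starting
point the score is thus bounded, which justifies Fubini under `Q 1 x`. -/
lemma abs_score_le (hβ : 0 ≤ β) (hb : 0 < b) (hc : 0 < c) (hk : MemK k)
    (hk1 : IntegrableOn (fun z => z * k z) (Ioi 0)) (hγ : ∀ l, 0 ≤ l → γ l = g₂ β b c k l)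
    {Λ l : ℝ} (hl : l ∈ Icc 0 Λ) (p : ℝ≥0 × ℝ≥0) :
    |score b c γ l p| ≤
      Real.exp ((p.1 : ℝ) * Λ + (β + ∫ u in Ioi 0, u * k u) * Λ) + 1 := by
  have h1 := neg_g₂_le hβ hb hc hk hk1 hl.1
  have h2 := mul_le_mul_of_nonneg_left hl.2 (meanRate_nonneg hβ hk)
  have h3 := mul_nonneg hl.1 p.2.coe_nonneg
  have h4 := mul_le_mul_of_nonneg_left ((v_le_self hb hc zero_le_one hl.1).trans hl.2)
    p.1.coe_nonneg
  have h5 : Real.exp (-(l * (p.2 : ℝ)) + (p.1 : ℝ) * v b c 1 l - γ l) ≤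
      Real.exp ((p.1 : ℝ) * Λ + (β + ∫ u in Ioi 0, u * k u) * Λ) :=
    Real.exp_le_exp.2 (by rw [hγ l hl.1]; linarith)
  have h6 := Real.exp_pos (-(l * (p.2 : ℝ)) + (p.1 : ℝ) * v b c 1 l - γ l)
  rw [score, abs_le]
  constructor <;> linarith

lemma memLp_score (hβ : 0 ≤ β) (hb : 0 < b) (hc : 0 < c) (hk : MemK k)
    (hk1 : IntegrableOn (fun z => z * k z) (Ioi 0)) (hw : IsWeight w) (hγm : Measurable γ)
    (hγ : ∀ l, 0 ≤ l → γ l = g₂ β b c k l) (p : ℝ≥0 × ℝ≥0) :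
    MemLp (fun l => score b c γ l p) 2 (wMeasure w) :=
  hw.memLp_of_bound ((measurable_score b c hγm).comp (measurable_id.prodMk measurable_const))
    fun _ => ⟨_, fun _ hl => abs_score_le hβ hb hc hk hk1 hγ hl p⟩

lemma measurable_gEmp {α : Type*} [MeasurableSpace α] (b c : ℝ) {x : α → ℕ → ℝ≥0}
    (hx : ∀ j, Measurable fun a => x a j) (n : ℕ) :
    Measurable fun q : α × ℝ => gEmp b c (x q.1) n q.2 := by
  have h1 := measurable_v_one b c
  have h2 : ∀ j, Measurable fun q : α × ℝ => (x q.1 j : ℝ) := fun j =>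
    ((hx j).comp measurable_fst).coe_nnreal_real
  unfold gEmp L₂
  refine (Measurable.const_mul (Finset.measurable_sum _ fun j _ => ?_) _).log
  exact ((measurable_snd.mul (h2 _)).neg.add ((h2 j).mul (h1.comp measurable_snd))).exp

lemma memLp_gEmp (hb : 0 < b) (hc : 0 < c) (hw : IsWeight w) (x : ℕ → ℝ≥0) (n : ℕ) :
    MemLp (gEmp b c x n) 2 (wMeasure w) := by
  refine hw.memLp_of_bound ((measurable_gEmp (α := Unit) b c (x := fun _ => x)
    (fun _ => measurable_const) n).comp (measurable_const.prodMk measurable_id : Measurable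
      fun l : ℝ => ((), l))) fun Λ => ?_
  rcases Nat.eq_zero_or_pos n with rfl | hn
  · exact ⟨0, fun l _ => by simp [gEmp, L₂]⟩
  refine ⟨Λ * ((n : ℝ)⁻¹ * ∑ j ∈ Finset.range n, (x (j + 1) : ℝ)) +
    1 / (n : ℝ) * ∑ j ∈ Finset.range n, Real.exp ((x j : ℝ) * Λ), fun l hl => ?_⟩
  have hS : 0 ≤ (n : ℝ)⁻¹ * ∑ j ∈ Finset.range n, (x (j + 1) : ℝ) := by positivity
  have hT : 0 ≤ 1 / (n : ℝ) * ∑ j ∈ Finset.range n, Real.exp ((x j : ℝ) * Λ) :=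
    mul_nonneg (by positivity) (Finset.sum_nonneg fun _ _ => (Real.exp_pos _).le)
  have h1 := neg_mul_mean_le_gEmp (b := b) (c := c) (x := x) hb hc hn hl.1
  have h2 := mul_le_mul_of_nonneg_right hl.2 hS
  have h3 : gEmp b c x n l ≤ L₂ b c x n l - 1 := Real.log_le_sub_one_of_pos (L₂_pos hn)
  have h4 : L₂ b c x n l ≤ 1 / (n : ℝ) * ∑ j ∈ Finset.range n, Real.exp ((x j : ℝ) * Λ) := by
    rw [L₂]
    gcongr with j
    have h5 := mul_nonneg hl.1 (x (j + 1)).coe_nonneg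
    have h6 := mul_le_mul_of_nonneg_left ((v_le_self hb hc zero_le_one hl.1).trans hl.2)
      (x j).coe_nonneg
    linarith
  have h7 := mul_nonneg (hl.1.trans hl.2) hS
  rw [abs_le]
  constructor <;> linarith

end SquareIntegrable

end CBI

/-! ### The asymptotic quadratic risk -/

namespace CBI

open scoped RealInnerProductSpace

section ScoreVector

variable {Ω : Type*} [mΩ : MeasurableSpace Ω] {P : Measure Ω} [IsProbabilityMeasure P]
  {X : ℝ≥0 → Ω → ℝ≥0} {Q : ℝ≥0 → Kernel ℝ≥0 ℝ≥0} {β b c : ℝ} {k w γ : ℝ → ℝ}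

/-- Fubini moves the kernel integral inside, where each score has conditional mean zero. -/
lemma IsTransitionSemigroup.integral_inner_score (hQ : IsTransitionSemigroup β b c k Q)
    (hβ : 0 ≤ β) (hb : 0 < b) (hc : 0 < c) (hk : MemK k)
    (hk1 : IntegrableOn (fun z => z * k z) (Ioi 0)) (hw : IsWeight w) (hγm : Measurable γ)
    (hγ : ∀ l, 0 ≤ l → γ l = g₂ β b c k l) (h : Lp ℝ 2 (wMeasure w)) (x : ℝ≥0) :
    ∫ y, ∫ l, h l * score b c γ l (x, y) ∂(wMeasure w) ∂(Q 1 x) = 0 := by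
  have := hQ.markov 1
  have := hw.isFiniteMeasure
  obtain ⟨Λ, -, hΛ⟩ := hw.exists_ae_mem
  have hh : Integrable h (wMeasure w) := (Lp.memLp h).integrable one_le_two
  have hm : Measurable fun q : ℝ≥0 × ℝ => score b c γ q.2 (x, q.1) :=
    (measurable_score b c hγm).comp
      (measurable_snd.prodMk (measurable_const.prodMk measurable_fst))
  rw [integral_integral_swap]
  · refine integral_eq_zero_of_ae ?_
    filter_upwards [hΛ] with l hl
    rw [integral_const_mul, hQ.integral_score hl.1 (hγ l hl.1)]
    simp
  · refine Integrable.mono' ((hh.norm.mul_const (Real.exp ((x : ℝ) * Λ +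
      (β + ∫ u in Ioi 0, u * k u) * Λ) + 1)).comp_snd (Q 1 x)) ?_ ?_
    · exact ((Lp.stronglyMeasurable h).comp_measurable measurable_snd).aestronglyMeasurable.mul
        hm.aestronglyMeasurable
    · have h2 : ∀ᵐ q : ℝ≥0 × ℝ ∂((Q 1 x).prod (wMeasure w)), q.2 ∈ Icc 0 Λ :=
        Measure.quasiMeasurePreserving_snd.ae hΛ
      filter_upwards [h2] with q hq
      simp only [Function.uncurry]
      rw [norm_mul]
      exact mul_le_mul_of_nonneg_left (abs_score_le hβ hb hc hk hk1 hγ hq _) (norm_nonneg _)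

lemma IsWeight.secondCountableTopology (hw : IsWeight w) :
    SecondCountableTopology (Lp ℝ 2 (wMeasure w)) := by
  have := hw.isFiniteMeasure
  have : Fact ((2 : ℝ≥0∞) ≠ ∞) := ⟨ENNReal.ofNat_ne_top⟩
  infer_instance

lemma IsStationaryCBI.lintegral_lintegral_score_ne_top (hX : IsStationaryCBI P β b c k X)
    (hQ : IsTransitionSemigroup β b c k Q) (hM : IsMarkov P X Q) (hβ : 0 ≤ β) (hb : 0 < b)
    (hc : 0 < c) (hk : MemK k) (hk1 : IntegrableOn (fun z => z * k z) (Ioi 0))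
    (hk_exp : ∀ l : ℝ, -critExp b c < l → ∫⁻ s in Ioi (0 : ℝ), absPsi β k (v b c s l) < ∞)
    (hw : IsWeight w) (hγm : Measurable γ) (hγ : ∀ l, 0 ≤ l → γ l = g₂ β b c k l) :
    ∫⁻ ω, ∫⁻ l, ENNReal.ofReal (score b c γ l (X 0 ω, X 1 ω) ^ 2) ∂(wMeasure w) ∂P ≠ ∞ := by
  have := hw.isFiniteMeasure
  obtain ⟨Λ, hΛ0, hΛ⟩ := hw.exists_ae_mem
  obtain ⟨B, hB⟩ := hX.exists_memLp_score hQ hM hβ hb hc hk hk1 hk_exp hγ hΛ0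
  have hm : Measurable fun q : Ω × ℝ => score b c γ q.2 (X 0 q.1, X 1 q.1) :=
    (measurable_score b c hγm).comp (measurable_snd.prodMk
      (((hX.measurable 0).comp measurable_fst).prodMk ((hX.measurable 1).comp measurable_fst)))
  rw [lintegral_lintegral_swap (hm.pow_const 2).ennreal_ofReal.aemeasurable]
  refine ne_top_of_le_ne_top (b := ∫⁻ _, ENNReal.ofReal B ∂(wMeasure w)) ?_ ?_
  · rw [lintegral_const]
    exact ENNReal.mul_ne_top ENNReal.ofReal_ne_top (measure_ne_top _ _)
  · refine lintegral_mono_ae (hΛ.mono fun l hl => ?_)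
    rw [← ofReal_integral_eq_lintegral_ofReal (hB l hl).1.integrable_sq
      (Eventually.of_forall fun ω => sq_nonneg _)]
    exact ENNReal.ofReal_le_ofReal (hB l hl).2

lemma IsStationaryCBI.isMixingMDS_inner [MeasurableSpace (Lp ℝ 2 (wMeasure w))]
    [BorelSpace (Lp ℝ 2 (wMeasure w))] (hX : IsStationaryCBI P β b c k X)
    (hQ : IsTransitionSemigroup β b c k Q) (hM : IsMarkov P X Q) (hβ : 0 ≤ β) (hb : 0 < b)
    (hc : 0 < c) (hk : MemK k) (hk1 : IntegrableOn (fun z => z * k z) (Ioi 0))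
    (hw : IsWeight w) (hγm : Measurable γ) (hγ : ∀ l, 0 ≤ l → γ l = g₂ β b c k l)
    {S : ℝ≥0 × ℝ≥0 → Lp ℝ 2 (wMeasure w)}
    (hS : ∀ p, S p = (memLp_score hβ hb hc hk hk1 hw hγm hγ p).toLp _) (hSm : Measurable S)
    (hS2 : ∫⁻ ω, ‖S (X 0 ω, X 1 ω)‖ₑ ^ 2 ∂P ≠ ∞) (h : Lp ℝ 2 (wMeasure w)) :
    IsMixingMDS P (fun j => past X j) fun j ω => ⟪h, S (X j ω, X (j + 1 : ℕ) ω)⟫ := by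
  have := hw.secondCountableTopology
  have hfm : Measurable fun p => ⟪h, S p⟫ := measurable_const.inner hSm
  have hpm : Measurable fun ω => (X 0 ω, X 1 ω) := (hX.measurable 0).prodMk (hX.measurable 1)
  have hSL : MemLp (fun ω => S (X 0 ω, X 1 ω)) 2 P := by
    refine ⟨(hSm.comp hpm).aestronglyMeasurable, ?_⟩
    exact lt_top_iff_ne_top.2 fun ht => hS2 (by rw [← eLpNorm_two_sq, ht]; simp)
  have h2 : MemLp (fun ω => ⟪h, S (X 0 ω, X 1 ω)⟫) 2 P :=
    hSL.const_inner h
  simpa only [Nat.cast_succ] using hX.isMixingMDS hM hβ hb hc hk hk1 hfm h2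
    (Eventually.of_forall fun ω => by
      simp_rw [hS, inner_toLp_eq]
      exact hQ.integral_inner_score hβ hb hc hk hk1 hw hγm hγ h _)

lemma memLp_meanScore (hβ : 0 ≤ β) (hb : 0 < b) (hc : 0 < c) (hk : MemK k)
    (hk1 : IntegrableOn (fun z => z * k z) (Ioi 0)) (hw : IsWeight w) (hγm : Measurable γ)
    (hγ : ∀ l, 0 ≤ l → γ l = g₂ β b c k l) (x : ℕ → ℝ≥0) (n : ℕ) :
    MemLp (meanScore b c γ x n) 2 (wMeasure w) :=
  (memLp_finsetSum _ fun j _ =>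
    memLp_score hβ hb hc hk hk1 hw hγm hγ (x j, x (j + 1))).const_mul _

lemma toLp_meanScore (hβ : 0 ≤ β) (hb : 0 < b) (hc : 0 < c) (hk : MemK k)
    (hk1 : IntegrableOn (fun z => z * k z) (Ioi 0)) (hw : IsWeight w) (hγm : Measurable γ)
    (hγ : ∀ l, 0 ≤ l → γ l = g₂ β b c k l) (x : ℕ → ℝ≥0) (n : ℕ) :
    (memLp_meanScore hβ hb hc hk hk1 hw hγm hγ x n).toLp _ = (n : ℝ)⁻¹ •
      ∑ j ∈ Finset.range n, (memLp_score hβ hb hc hk hk1 hw hγm hγ (x j, x (j + 1))).toLp _ := by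
  set S : ℕ → Lp ℝ 2 (wMeasure w) := fun j =>
    (memLp_score hβ hb hc hk hk1 hw hγm hγ (x j, x (j + 1))).toLp _ with hS
  have hsum : ∀ n : ℕ, ⇑(∑ j ∈ Finset.range n, S j) =ᵐ[wMeasure w]
      fun l => ∑ j ∈ Finset.range n, score b c γ l (x j, x (j + 1)) := by
    intro n
    induction n with
    | zero =>
      simp only [Finset.range_zero, Finset.sum_empty]
      exact Lp.coeFn_zero ℝ 2 (wMeasure w)
    | succ n ih =>
      rw [Finset.sum_range_succ]
      filter_upwards [ih, Lp.coeFn_add (∑ j ∈ Finset.range n, S j) (S n),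
        (memLp_score hβ hb hc hk hk1 hw hγm hγ (x n, x (n + 1))).coeFn_toLp] with l h1 h2 h3
      rw [h2, Pi.add_apply, h1, h3, Finset.sum_range_succ]
  refine Lp.ext ?_
  filter_upwards [hsum n, (memLp_meanScore hβ hb hc hk hk1 hw hγm hγ x n).coeFn_toLp,
    Lp.coeFn_smul ((n : ℝ)⁻¹) (∑ j ∈ Finset.range n, S j)] with l h1 h2 h3
  rw [h3, h2, Pi.smul_apply, h1, smul_eq_mul, meanScore]

/-- Exchange the integrals by Tonelli. For each `l` the inner integral tends to zero and is bounded
by a constant on the compact support of the weight, so dominated convergence applies; the term `n =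
0` vanishes through the factor `n`. -/
lemma IsStationaryCBI.tendsto_lintegral_gEmp_remainder (hX : IsStationaryCBI P β b c k X)
    (hQ : IsTransitionSemigroup β b c k Q) (hM : IsMarkov P X Q) (hβ : 0 ≤ β) (hb : 0 < b)
    (hc : 0 < c) (hk : MemK k) (hk1 : IntegrableOn (fun z => z * k z) (Ioi 0))
    (hk_exp : ∀ l : ℝ, -critExp b c < l → ∫⁻ s in Ioi (0 : ℝ), absPsi β k (v b c s l) < ∞)
    (hw : IsWeight w) (hγm : Measurable γ) (hγ : ∀ l, 0 ≤ l → γ l = g₂ β b c k l) :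
    Tendsto (fun n : ℕ => ∫⁻ ω, ∫⁻ l, ENNReal.ofReal (n * (gEmp b c (fun i => X i ω) n l - γ l -
      meanScore b c γ (fun i => X i ω) n l) ^ 2) ∂(wMeasure w) ∂P) atTop (𝓝 0) := by
  have := hw.isFiniteMeasure
  obtain ⟨Λ, hΛ0, hΛ⟩ := hw.exists_ae_mem
  obtain ⟨B, hB⟩ := hX.gEmp_remainder hQ hM hβ hb hc hk hk1 hk_exp hγ hΛ0
  have hpm : ∀ j : ℕ, Measurable fun ω => (X j ω, X (j + 1 : ℕ) ω) := fun j =>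
    (hX.measurable _).prodMk (hX.measurable _)
  have hsm : ∀ n, Measurable fun q : Ω × ℝ => meanScore b c γ (fun i => X i q.1) n q.2 := fun n =>
    (Finset.measurable_sum _ fun j _ => (measurable_score b c hγm).comp
      (measurable_snd.prodMk ((hpm j).comp measurable_fst))).const_mul _
  have hjm : ∀ n : ℕ, Measurable fun q : Ω × ℝ => ENNReal.ofReal
      (n * (gEmp b c (fun i => X i q.1) n q.2 - γ q.2 -
        meanScore b c γ (fun i => X i q.1) n q.2) ^ 2) := fun n =>
    (((((measurable_gEmp b c (x := fun ω (i : ℕ) => X i ω) (fun j => hX.measurable j) n).sub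
      (hγm.comp measurable_snd)).sub (hsm n)).pow_const 2).const_mul _).ennreal_ofReal
  have hdct := tendsto_lintegral_of_dominated_convergence (μ := wMeasure w)
    (F := fun (n : ℕ) l => ∫⁻ ω, ENNReal.ofReal (n * (gEmp b c (fun i => X i ω) n l - γ l -
      meanScore b c γ (fun i => X i ω) n l) ^ 2) ∂P) (f := fun _ => 0)
    (fun _ => ENNReal.ofReal B) (fun n => (hjm n).lintegral_prod_left')
    (fun n => hΛ.mono fun l hl => ?_) ?_ (hΛ.mono fun l hl => (hB l hl).2)
  · rw [lintegral_zero] at hdct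
    exact hdct.congr fun n => (lintegral_lintegral_swap (hjm n).aemeasurable).symm
  · rcases Nat.eq_zero_or_pos n with rfl | hn
    · simp
    · exact (hB l hl).1 n hn
  · rw [lintegral_const]
    exact ENNReal.mul_ne_top ENNReal.ofReal_ne_top (measure_ne_top _ _)

end ScoreVector

end CBI

/-! ### Convergence of the scaled quadratic risk. -/

theorem theorem4p4 {Ω : Type*} [MeasurableSpace Ω] (P : Measure Ω) [IsProbabilityMeasure P]
    (β b c R : ℝ) (hβ : 0 ≤ β) (hb : 0 < b) (hc : 0 < c) (hR : 0 < R)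
    (w : ℝ → ℝ) (hw : CBI.IsWeight w)
    (kR : ℝ → ℝ) (hkR : CBI.MemK kR) (hkR_norm : ∫ z in Ioi (0 : ℝ), kR z * min z 1 ≤ R)
    (k : ℝ → ℝ) (hk : CBI.MemKR R kR k)
    (X : ℝ≥0 → Ω → ℝ≥0) (hX : CBI.IsStationaryCBI P β b c k X)
    (hk_sq : IntegrableOn (fun z => z ^ 2 * k z) (Ioi (0 : ℝ)))
    (hk_exp : ∀ l : ℝ, -(b * Real.exp (-b) / (c * (1 - Real.exp (-b)))) < l →
      ∫⁻ s in Ioi (0 : ℝ), CBI.absPsi β k (CBI.v b c s l) < ∞)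
    (ghat : ℕ → Ω → Lp ℝ 2 (CBI.wMeasure w))
    (hghat : ∀ n : ℕ, 1 ≤ n → ∀ ω, CBI.IsNearest w (CBI.PsiR β b c R kR w)
      (CBI.gEmp b c (fun i => X i ω) n) (ghat n ω)) :
    ∃ L : ℝ≥0, Tendsto
      (fun n : ℕ => (n : ℝ≥0∞) *
        ∫⁻ ω, eLpNorm (fun l => ghat n ω l - CBI.g₂ β b c k l) 2 (CBI.wMeasure w) ^ 2 ∂P)
      atTop (𝓝 (L : ℝ≥0∞)) := by
  have hkK := hk.memK
  have hk1 := hkK.integrable_mul hk_sq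
  have := hw.isFiniteMeasure
  have := hw.secondCountableTopology
  obtain ⟨Λ, hΛ0, hΛ⟩ := hw.exists_ae_mem
  obtain ⟨Q, hQ, hM⟩ := hX.exists_isMarkov
  obtain ⟨γ, hγm, hγ⟩ := hQ.exists_measurable_eq_g₂
  borelize ↥(Lp ℝ 2 (CBI.wMeasure w))
  -- elements of the Hilbert space
  have hγ2 := CBI.memLp_g₂ hβ hb hc hkK hk1 hw hγm hγ
  set G₀ := hγ2.toLp γ with hG₀
  set S : ℝ≥0 × ℝ≥0 → Lp ℝ 2 (CBI.wMeasure w) := fun p =>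
    (CBI.memLp_score hβ hb hc hkK hk1 hw hγm hγ p).toLp _ with hS
  have hSm : Measurable S := measurable_toLp (f := fun p l => CBI.score b c γ l p)
    ((CBI.measurable_score b c hγm).comp measurable_swap) _
  set E : ℕ → Ω → Lp ℝ 2 (CBI.wMeasure w) := fun n ω =>
    (CBI.memLp_gEmp hb hc hw (fun i => X i ω) n).toLp _ with hE
  have hEm : ∀ n, Measurable (E n) := fun n => measurable_toLp
    (CBI.measurable_gEmp b c (x := fun ω (i : ℕ) => X i ω) (fun j => hX.measurable j) n) _
  have hpm : ∀ j : ℕ, Measurable fun ω => (X j ω, X (j + 1 : ℕ) ω) := fun j =>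
    (hX.measurable _).prodMk (hX.measurable _)
  -- the projection
  set K := closure (CBI.PsiR β b c R kR w) with hK
  have hKc : Convex ℝ K := (CBI.convex_PsiR hb hc hw).closure
  have hγg : γ =ᵐ[CBI.wMeasure w] CBI.g₂ β b c k := hΛ.mono fun l hl => hγ l hl.1
  have hG₀K : G₀ ∈ K := subset_closure ⟨k, hk, hγ2.coeFn_toLp.trans hγg⟩
  obtain ⟨π, hπ⟩ := exists_isConvexProj ⟨G₀, hG₀K⟩ isClosed_closure hKc
  -- A nearest point of a closed convex set is unique, so the estimator is a continuous function of
  -- the measurable vector `E n`; no measurability of `ghat` has to be assumed.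
  have hghat' : ∀ n : ℕ, 1 ≤ n → ∀ ω, ghat n ω = π (E n ω) := by
    intro n hn ω
    refine hπ.eq_of_norm_le (hghat n hn ω).1 ?_
    have h1 := (hghat n hn ω).2 _ (hπ (E n ω)).1
    rw [← enorm_toLp_sub_eq (CBI.memLp_gEmp hb hc hw (fun i => X i ω) n),
      ← enorm_toLp_sub_eq (CBI.memLp_gEmp hb hc hw (fun i => X i ω) n)] at h1
    exact (enorm_le_iff_norm_le).1 h1
  set N : ℕ → Lp ℝ 2 (CBI.wMeasure w) → ℝ := fun n z =>
    ‖√n • (π (G₀ + (√n)⁻¹ • z) - G₀)‖ with hN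
  set G : ℕ → Ω → Lp ℝ 2 (CBI.wMeasure w) := fun n ω =>
    √n • ((n : ℝ)⁻¹ • ∑ j ∈ Finset.range n, S (X j ω, X (j + 1 : ℕ) ω)) with hG
  set G' : ℕ → Ω → Lp ℝ 2 (CBI.wMeasure w) := fun n ω => √n • (E n ω - G₀) with hG'
  have hSsq : ∀ p, ‖S p‖ₑ ^ 2 =
      ∫⁻ l, ENNReal.ofReal (CBI.score b c γ l p ^ 2) ∂(CBI.wMeasure w) := fun p =>
    enorm_toLp_sq_eq _
  have hS2 : ∫⁻ ω, ‖S (X 0 ω, X 1 ω)‖ₑ ^ 2 ∂P ≠ ∞ := by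
    simp_rw [hSsq]
    exact hX.lintegral_lintegral_score_ne_top hQ hM hβ hb hc hkK hk1 hk_exp hw hγm hγ
  have hmds : ∀ h, IsMixingMDS P (fun j => CBI.past X j)
      fun j ω => inner ℝ h (S (X j ω, X (j + 1 : ℕ) ω)) := fun h =>
    hX.isMixingMDS_inner hQ hM hβ hb hc hkK hk1 hw hγm hγ (fun p => rfl) hSm hS2 h
  have hinner : ∀ n h ω, inner ℝ h (G n ω) =
      √n * ((n : ℝ)⁻¹ * ∑ j ∈ Finset.range n, inner ℝ h (S (X j ω, X (j + 1 : ℕ) ω))) := fun n h ω => by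
    simp only [hG, inner_smul_right, inner_sum]
  -- With `G' n = √n (E n - G₀)` one has `N n (G' n) = √n ‖π (E n) - G₀‖`, so for `n ≥ 1` the two
  -- sequences coincide.
  suffices h : ∃ L : ℝ≥0, Tendsto (fun n => ∫⁻ ω, ‖N n (G' n ω)‖ₑ ^ 2 ∂P) atTop (𝓝 (L : ℝ≥0∞)) by
    obtain ⟨L, hL⟩ := h
    refine ⟨L, hL.congr' ?_⟩
    filter_upwards [eventually_ge_atTop 1] with n hn
    rw [← lintegral_const_mul' _ _ (ENNReal.natCast_ne_top n)]
    refine lintegral_congr fun ω => ?_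
    have hn0 : √(n : ℝ) ≠ 0 := by positivity
    have e1 : eLpNorm (fun l => ghat n ω l - CBI.g₂ β b c k l) 2 (CBI.wMeasure w) =
        ‖π (E n ω) - G₀‖ₑ := by
      rw [hghat' n hn ω, Lp.enorm_def]
      refine eLpNorm_congr_ae ?_
      filter_upwards [Lp.coeFn_sub (π (E n ω)) G₀, hγ2.coeFn_toLp, hγg] with l h1 h2 h3
      rw [h1, Pi.sub_apply, h2, h3]
    have e2 : G₀ + (√(n : ℝ))⁻¹ • G' n ω = E n ω := by
      rw [hG', smul_smul, inv_mul_cancel₀ hn0, one_smul]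
      abel
    rw [e1]
    simp only [hN]
    rw [e2, enorm_norm, enorm_smul, mul_pow, ← ofReal_norm (√(n : ℝ)),
      ← ENNReal.ofReal_pow (norm_nonneg _), Real.norm_of_nonneg (Real.sqrt_nonneg _),
      Real.sq_sqrt (Nat.cast_nonneg n), ENNReal.ofReal_natCast]
  refine exists_tendsto_lintegral_sq (P := P) (D := fun ω => S (X 0 ω, X 1 ω))
    (hSm.comp ((hX.measurable 0).prodMk (hX.measurable 1))) hS2 (G := G) (G' := G') (N := N)
    ?_ ?_ ?_ ?_ ?_ ?_ ?_ ?_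
  · intro n
    have h1 : Measurable fun ω => ∑ j ∈ Finset.range n, S (X j ω, X (j + 1 : ℕ) ω) :=
      Finset.measurable_sum _ fun j _ => hSm.comp (hpm j)
    exact (h1.const_smul (n : ℝ)⁻¹).const_smul √(n : ℝ)
  -- Orthogonality of the martingale differences gives the normalized sum the variance of a single
  -- score in every direction.
  · intro n hn h
    have h1 := (hmds h).integral_mean_sq hn
    have h2 := (hmds h).integrable_mean_sq n
    have h3 := (hmds h).memLp.integrable_sq
    simp only [Nat.cast_zero, zero_add, Nat.cast_one] at h1 h3
    have e : ∀ ω, inner ℝ h (G n ω) ^ 2 =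
        n * ((n : ℝ)⁻¹ * ∑ j ∈ Finset.range n, inner ℝ h (S (X j ω, X (j + 1 : ℕ) ω))) ^ 2 := fun ω => by
      rw [hinner, mul_pow, Real.sq_sqrt (Nat.cast_nonneg n)]
    simp_rw [e]
    rw [← ofReal_integral_eq_lintegral_ofReal h2 (Eventually.of_forall fun ω => by positivity), h1,
      ofReal_integral_eq_lintegral_ofReal h3 (Eventually.of_forall fun ω => sq_nonneg _)]
  · intro h
    have h1 := (hmds h).tendsto_charFun 1
    simp only [Nat.cast_zero, zero_add, Nat.cast_one, one_pow, one_mul] at h1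
    refine h1.congr fun n => integral_congr_ae (Eventually.of_forall fun ω => ?_)
    simp only
    rw [hinner]
    congr 3
    rcases Nat.eq_zero_or_pos n with rfl | hn
    · simp
    · have hn0 : (0 : ℝ) < n := by exact_mod_cast hn
      have : √(n : ℝ) * (n : ℝ)⁻¹ = 1 / √(n : ℝ) := by
        rw [← div_eq_mul_inv, Real.sqrt_div_self, one_div]
      rw [← mul_assoc, this]
  · intro n z z'
    refine (abs_norm_sub_norm_le _ _).trans ?_
    rw [← smul_sub, sub_sub_sub_cancel_right, norm_smul, Real.norm_of_nonneg (Real.sqrt_nonneg _)]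
    calc √n * ‖π (G₀ + (√n)⁻¹ • z) - π (G₀ + (√n)⁻¹ • z')‖
        ≤ √n * ‖(√(n : ℝ))⁻¹ • (z - z')‖ := by
          refine mul_le_mul_of_nonneg_left ((hπ.norm_sub_le _ _).trans_eq ?_) (Real.sqrt_nonneg _)
          rw [add_sub_add_left_eq_sub, smul_sub]
      _ = (√n * (√(n : ℝ))⁻¹) * ‖z - z'‖ := by
          rw [norm_smul, norm_inv, Real.norm_of_nonneg (Real.sqrt_nonneg _), mul_assoc]
      _ ≤ 1 * ‖z - z'‖ := by gcongr; exact mul_inv_le_one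
      _ = ‖z - z'‖ := one_mul _
  · intro n
    simp only [hN, smul_zero, add_zero, hπ.apply_of_mem hG₀K, sub_self, norm_zero]
  · intro z
    -- The difference quotients need a positive scale, so the sequence starts at `√1`; shifting the
    -- index does not affect the limit.
    obtain ⟨p, hp⟩ := hπ.exists_tendsto_diffQuot hKc hG₀K z (r := fun n : ℕ => √((n + 1 : ℕ) : ℝ))
      (fun n => by positivity) (fun m n hmn =>
        Real.sqrt_le_sqrt (Nat.cast_le.2 (Nat.succ_le_succ hmn)))
    exact ⟨‖p‖, (tendsto_add_atTop_iff_nat 1).1 hp.norm⟩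
  · exact fun n => ((hEm n).sub_const G₀).const_smul √(n : ℝ)
  · refine (hX.tendsto_lintegral_gEmp_remainder hQ hM hβ hb hc hkK hk1 hk_exp hw hγm hγ).congr
      fun n => lintegral_congr fun ω => ?_
    have hr2 := CBI.memLp_gEmp hb hc hw (fun i => X i ω) n |>.sub hγ2 |>.sub
      (CBI.memLp_meanScore hβ hb hc hkK hk1 hw hγm hγ (fun i => X i ω) n)
    have e1 : G' n ω - G n ω = √n • hr2.toLp _ := by
      simp only [hG, hG', hS]
      rw [← CBI.toLp_meanScore hβ hb hc hkK hk1 hw hγm hγ (fun i => X i ω) n, ← smul_sub]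
      rfl
    rw [e1, enorm_smul, mul_pow, enorm_toLp_sq_eq, ← ofReal_norm (√(n : ℝ)),
      ← ENNReal.ofReal_pow (norm_nonneg _), Real.norm_of_nonneg (Real.sqrt_nonneg _),
      Real.sq_sqrt (Nat.cast_nonneg n), ← lintegral_const_mul' _ _ ENNReal.ofReal_ne_top]
    exact lintegral_congr fun l => ENNReal.ofReal_mul (Nat.cast_nonneg n)
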